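/- **Setting.** Let $\mathcal X=\mathbb R^n$, $\mathcal V=\mathbb R^d$ with Euclidean norms, $A\in\mathbb R^{n\times n}$, $S(t)=e^{tA}$, $\alpha\in(1/3,1/2]$. *Linear part.* All eigenvalues of $A$ lie on $i\mathbb R$ or in $\{\operatorname{Re}z<0\}$; $\mathcal X=\mathcal X^c\oplus\mathcal X^s$ is the corresponding splitting into (real) generalized eigenspaces, $P^c,P^s$ are the associated projections (they commute with $S(t)$), $S^{c},S^{s}$ the restrictions of $S$ to $\mathcal X^c,\mathcal X^s$. There are $-\beta<0\le\gamma<\beta$ and $M_c,M_s\ge1$ with $|S^c(t)x|\le M_ce^{\gamma t}|x|$ for $t\le0$, $x\in\mathcal X^c$, and $|S^s(t)x|\le M_se^{-\beta t}|x|$ for $t\ge0$, $x\in\mathcal X^s$. *Coefficients.* (F) $F:\mathcal X\to\mathcal X$ is $C^1$ with bounded derivative (hence Lipschitz), $F(0)=0$, $DF(0)=0$. (G) $G:\mathcal X\to\mathcal L(\mathcal V,\mathcal X)$ is $C^3$ with bounded derivatives of orders $1,2,3$, $G(0)=0$, $DG(0)=0$, $D^2G(0)=0$. *Rough paths.* $\mathbf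 W=(W,\mathbb W)$ is a rough path on $\mathbb R$: on every compact interval $W$ is $\alpha$-Hölder with values in $\mathcal V$ and $\mathbb W_{s,t}\in\mathcal V\otimes\mathcal V$ ($s\le t$) is $2\alpha$-Hölder, and $\mathbb W_{s,t}-\mathbb W_{s,u}-\mathbb W_{u,t}=(W_u-W_s)\otimes(W_t-W_u)$ for $s\le u\le t$. Put $\Theta_\tau\mathbf W=(W_{\cdot+\tau}-W_\tau,\mathbb W_{\cdot+\tau,\cdot+\tau})$; $\|W\|_\alpha,\|\mathbb W\|_{2\alpha}$ are Hölder semi-norms on $[0,1]$. $D^{2\alpha}_W$ is the space of pairs $(Y,Y')$ on $[0,1]$, $Y$ with values in $\mathcal X$, $Y'$ in $\mathcal L(\mathcal V,\mathcal X)$, both $\alpha$-Hölder, such that $R^Y_{s,t}=Y_t-Y_s-Y'_s(W_t-W_s)$ ($s\le t$) is $2\alpha$-Hölder, with norm $\|Y,Y'\|_W=\|Y\|_\infty+\|Y'\|_\infty+\|Y'\|_\alpha+\|R^Y\|_{2\alpha}$. The rough integral is $\int_a^bZ\,d\mathbf W=\lim_{|\mathcal P|\to0}\sum_{[u,v]\in\mathcal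 P}(Z_u(W_v-W_u)+Z'_u\mathbb W_{u,v})$. *Cut-off.* Let $f:[0,\infty)\to[0,1]$ be $C^3$, $f=1$ on $[0,1/2]$, $f=0$ on $[1,\infty)$. For $K,C_1,C_2>0$ let $\widetilde R(W)$ solve $C_1\widetilde R+C_2\widetilde R(1+\|W\|_\alpha)(\|W\|_\alpha+\|\mathbb W\|_{2\alpha})=K$ and $R(W)=\min\{\widetilde R(W),1\}$. For $(Y,Y')\in D^{2\alpha}_W$ and $R=R(W)$ let $\chi_R(Y)=f(\|Y,Y'\|_W/R)\,Y$, $\chi_R(Y)'=f(\|Y,Y'\|_W/R)\,Y'$, $F_R(Y)(t)=F(\chi_R(Y)_t)$, $G_R(Y)(t)=G(\chi_R(Y)_t)$ with Gubinelli derivative $DG(\chi_R(Y)_t)\chi_R(Y)'_t$. *Sequences.* For $-\beta<\eta<0$, $BC^\eta(D^{2\alpha}_W)$ is the set of sequences $\mathbb U=((U^{i-1},(U^{i-1})'))_{i=0,-1,-2,\dots}$ with $(U^{i-1},(U^{i-1})')\in D^{2\alpha}_{\Theta_{i-1}W}$, $U^{i-1}_0=U^{i-2}_1$, and $\|\mathbb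 U\|_{BC^\eta}=\sup_{i\le0}e^{-\eta(i-1)}\|U^{i-1},(U^{i-1})'\|_{\Theta_{i-1}W}<\infty$. *The map.* For $\xi\in\mathcal X$, $\xi^c=P^c\xi$, let $J_{R,d}(W,\mathbb U,\xi)$ have at position $i-1$ the path $$\begin{aligned}&S^c(t+i-1)\xi^c-\sum_{k=i+1}^{0}S^c(t+i-1-k)\,I^c_{k}-\int_t^1S^c(t-r)P^cF_R(U^{i-1})(r)\,dr-\int_t^1S^c(t-r)P^cG_R(U^{i-1})(r)\,d\Theta_{i-1}\mathbf W_r\\&+\sum_{k=-\infty}^{i-1}S^s(t+i-1-k)\,I^s_{k}+\int_0^tS^s(t-r)P^sF_R(U^{i-1})(r)\,dr+\int_0^tS^s(t-r)P^sG_R(U^{i-1})(r)\,d\Theta_{i-1}\mathbf W_r,\end{aligned}$$ $t\in[0,1]$, where $I^{c/s}_k=\int_0^1S^{c/s}(1-r)P^{c/s}F_R(U^{k-1})(r)\,dr+\int_0^1S^{c/s}(1-r)P^{c/s}G_R(U^{k-1})(r)\,d\Theta_{k-1}\mathbf W_r$, and the Gubinelli derivative $G_R(U^{i-1})$; here $F_R(U^{k-1})$,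 $G_R(U^{k-1})$ are formed with the rough path $\Theta_{k-1}\mathbf W$ and $R=R(\Theta_{k-1}W)$. **Theorem.** There is a constant $C_S>0$ depending only on $S$, and for each $K>0$ a constant $C_0=C_0(K)>0$ depending only on $A,F,G,f,\alpha,d$ and $K$ (and independent of $K$ if $DF$ is Lipschitz), such that the following holds whenever the dichotomy bounds hold with $\beta,\gamma,M_c,M_s$, $-\beta<\eta<0$, $C_1,C_2\ge C_0(K)$ and $K>0$ satisfies the gap condition $$K\left(\frac{e^{\beta+\eta}(C_SM_se^{-\eta}+1)}{1-e^{-(\beta+\eta)}}+\frac{e^{\gamma-\eta}(C_SM_ce^{-\eta}+1)}{1-e^{-(\gamma-\eta)}}\right)<\frac14 .$$ For every rough path $\mathbf W$ on $\mathbb R$ and every $\xi\in\mathcal X$, the rough integrals and the series defining $J_{R,d}(W,\mathbb U,\xi)$ converge for all $\mathbb U\in BC^\eta(D^{2\alpha}_W)$, the map $J_{R,d}(W,\cdot,\xi)$ sends $BC^\eta(D^{2\alpha}_W)$ into itself, it satisfies $$\|J_{R,d}(W,\mathbb U,\xi)-J_{R,d}(W,\widetilde{\mathbb U},\xi)\|_{BC^\eta}\le\tfrac14\|\mathbb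 U-\widetilde{\mathbb U}\|_{BC^\eta},$$ and it has a unique fixed point $\Gamma(\xi^c,W)\in BC^\eta(D^{2\alpha}_W)$. -/

import Mathlib

open Set Filter Topology unitInterval
open scoped TensorProduct

namespace RoughCenter

noncomputable section

/-! ### Hölder semi-norms on the unit interval and rough paths on the real line -/

section Holder

variable {E : Type*} [NormedAddCommGroup E]

/-- `R : {0 ≤ s ≤ t ≤ 1} → E` is `β`-Hölder. -/
def IsHolderTwo (β : ℝ) (R : I → I → E) : Prop :=
  ∃ C : ℝ, ∀ s t : I, s ≤ t → ‖R s t‖ ≤ C * ((t : ℝ) - s) ^ β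

/-- The `β`-Hölder semi-norm `sup_{s < t} |R_{s,t}| / |t - s|^β`, as the least Hölder constant. -/
def holderSeminormTwo (β : ℝ) (R : I → I → E) : ℝ :=
  sInf {C : ℝ | 0 ≤ C ∧ ∀ s t : I, s ≤ t → ‖R s t‖ ≤ C * ((t : ℝ) - s) ^ β}

/-- The increments `Y_{s,t} = Y_t - Y_s`. -/
def incr (Y : I → E) (s t : I) : E := Y t - Y s

/-- The supremum norm of a (bounded) path on `[0,1]`. -/
def supNorm (Y : I → E) : ℝ := ⨆ t : I, ‖Y t‖

end Holder

/-- An `α`-Hölder rough path `(W, 𝕎)` on `ℝ`: `W` is `α`-Hölder and `𝕎` is `2α`-Hölder on every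
compact interval, and Chen's relation holds. -/
structure RoughPath (V : Type*) [NormedAddCommGroup V] [InnerProductSpace ℝ V] (α : ℝ) where
  path : ℝ → V
  area : ℝ → ℝ → V ⊗[ℝ] V
  path_holder : ∀ L : ℝ, ∃ C : ℝ, ∀ s t : ℝ, -L ≤ s → s ≤ t → t ≤ L →
    ‖path t - path s‖ ≤ C * (t - s) ^ α
  area_holder : ∀ L : ℝ, ∃ C : ℝ, ∀ s t : ℝ, -L ≤ s → s ≤ t → t ≤ L →
    ‖area s t‖ ≤ C * (t - s) ^ (2 * α)
  chen : ∀ s u t : ℝ, s ≤ u → u ≤ t →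
    area s t - area s u - area u t = (path u - path s) ⊗ₜ[ℝ] (path t - path u)

section Rough

variable {V : Type*} [NormedAddCommGroup V] [InnerProductSpace ℝ V] {α : ℝ}

/-- The time shift `Θ_τ 𝓦`. -/
def RoughPath.shift (𝓦 : RoughPath V α) (τ : ℝ) : RoughPath V α where
  path t := 𝓦.path (t + τ) - 𝓦.path τ
  area s t := 𝓦.area (s + τ) (t + τ)
  path_holder L := by
    obtain ⟨C, hC⟩ := 𝓦.path_holder (L + |τ|)
    refine ⟨C, fun s t h1 h2 h3 => ?_⟩
    have := hC (s + τ) (t + τ) (by linarith [neg_abs_le τ]) (by linarith)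
      (by linarith [le_abs_self τ])
    simpa using this
  area_holder L := by
    obtain ⟨C, hC⟩ := 𝓦.area_holder (L + |τ|)
    refine ⟨C, fun s t h1 h2 h3 => ?_⟩
    have := hC (s + τ) (t + τ) (by linarith [neg_abs_le τ]) (by linarith)
      (by linarith [le_abs_self τ])
    simpa using this
  chen s u t h1 h2 := by
    simpa using 𝓦.chen (s + τ) (u + τ) (t + τ) (by linarith) (by linarith)

/-- `‖W‖_α` on `[0,1]`. -/
def RoughPath.pathSeminorm (𝓦 : RoughPath V α) : ℝ :=
  holderSeminormTwo α (incr fun t : I => 𝓦.path t)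

/-- `‖𝕎‖_{2α}` on `[0,1]`. -/
def RoughPath.areaSeminorm (𝓦 : RoughPath V α) : ℝ :=
  holderSeminormTwo (2 * α) (fun s t : I => 𝓦.area s t)

/-! ### Controlled rough paths -/

variable {E : Type*} [NormedAddCommGroup E] [NormedSpace ℝ E]

/-- A pair `(Y, Y')` of paths on `[0,1]`, with values in `E` and in `L(V, E)`. -/
abbrev PathPair (V E : Type*) [NormedAddCommGroup V] [InnerProductSpace ℝ V]
    [NormedAddCommGroup E] [NormedSpace ℝ E] : Type _ :=
  (I → E) × (I → V →L[ℝ] E)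

/-- The remainder `R^Y_{s,t} = Y_{s,t} - Y'_s W_{s,t}`. -/
def remainder (𝓦 : RoughPath V α) (Y : PathPair V E) (s t : I) : E :=
  Y.1 t - Y.1 s - Y.2 s (𝓦.path t - 𝓦.path s)

/-- `(Y, Y')` belongs to the space `D^{2α}_W([0,1]; E)` of controlled rough paths. -/
structure IsControlled (𝓦 : RoughPath V α) (Y : PathPair V E) : Prop where
  holder : IsHolderTwo α (incr Y.1)
  deriv_holder : IsHolderTwo α (incr Y.2)
  remainder_holder : IsHolderTwo (2 * α) (remainder 𝓦 Y)

/-- The norm `‖Y‖_∞ + ‖Y'‖_∞ + ‖Y'‖_α + ‖R^Y‖_{2α}` on `D^{2α}_W([0,1]; E)`. -/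
def controlledNorm (𝓦 : RoughPath V α) (Y : PathPair V E) : ℝ :=
  supNorm Y.1 + supNorm Y.2 + holderSeminormTwo α (incr Y.2)
    + holderSeminormTwo (2 * α) (remainder 𝓦 Y)

/-! ### The controlled rough integral -/

/-- `B` in `L(V, L(V, E))` acting on `V ⊗ V`, so that `v ⊗ w` is sent to `B v w`. -/
def pairing (B : V →L[ℝ] V →L[ℝ] E) : V ⊗[ℝ] V →ₗ[ℝ] E :=
  TensorProduct.lift ((ContinuousLinearMap.coeLM ℝ).comp (B : V →ₗ[ℝ] V →L[ℝ] E))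

/-- `J` is the limit, as the mesh of the partition `a = p 0 ≤ p 1 ≤ ⋯ ≤ p N = b` tends to zero, of
the sums `∑ (Z_u W_{u,v} + Z'_u 𝕎_{u,v})` over the intervals `[u,v]` of the partition. -/
def IsRoughIntegral (𝓦 : RoughPath V α) (Z : PathPair V (V →L[ℝ] E)) (a b : I) (J : E) : Prop :=
  ∀ ε : ℝ, 0 < ε → ∃ δ : ℝ, 0 < δ ∧ ∀ (N : ℕ) (p : ℕ → I), p 0 = a → p N = b →
    (∀ j < N, p j ≤ p (j + 1)) → (∀ j < N, (p (j + 1) : ℝ) - p j < δ) →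
    ‖(∑ j ∈ Finset.range N,
        (Z.1 (p j) (𝓦.path (p (j + 1)) - 𝓦.path (p j))
          + pairing (Z.2 (p j)) (𝓦.area (p j) (p (j + 1))))) - J‖ < ε

/-- The rough integral `∫_a^b Z d𝓦`. -/
def roughIntegral (𝓦 : RoughPath V α) (Z : PathPair V (V →L[ℝ] E)) (a b : I) : E :=
  Classical.epsilon (IsRoughIntegral 𝓦 Z a b)

end Rough

/-! ### The linear part -/

/-- The phase space `ℝⁿ`. -/
abbrev Sp (n : ℕ) : Type := EuclideanSpace ℝ (Fin n)

/-- `exp(tB)` for a bounded operator `B`. -/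
def expGroup {X : Type*} [NormedAddCommGroup X] [NormedSpace ℝ X] (B : X →L[ℝ] X) (t : ℝ) :
    X →L[ℝ] X :=
  NormedSpace.exp (t • B)

/-- The group `S(t) = exp(tA)` on `ℝⁿ`. -/
def grp {n : ℕ} (A : Matrix (Fin n) (Fin n) ℝ) (t : ℝ) : Sp n →L[ℝ] Sp n :=
  expGroup (Matrix.toEuclideanCLM (n := Fin n) (𝕜 := ℝ) A) t

/-- `A` acting on `ℂⁿ`. -/
def complexified {n : ℕ} (A : Matrix (Fin n) (Fin n) ℝ) : Module.End ℂ (Fin n → ℂ) :=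
  Matrix.toLin' (A.map (algebraMap ℝ ℂ))

/-- The inclusion of `ℝⁿ` in `ℂⁿ`. -/
def toComplex (n : ℕ) : Sp n →ₗ[ℝ] (Fin n → ℂ) where
  toFun x i := (x i : ℂ)
  map_add' x y := by ext i; simp
  map_smul' c x := by ext i; simp

/-- The real subspace spanned by the generalized eigenvectors whose eigenvalues lie in `Λ`. -/
def spectralSubspace {n : ℕ} (A : Matrix (Fin n) (Fin n) ℝ) (Λ : Set ℂ) : Submodule ℝ (Sp n) :=
  ((⨆ μ ∈ Λ, (complexified A).maxGenEigenspace μ).restrictScalars ℝ).comap (toComplex n)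

/-- The center subspace `X^c`. -/
def centerSubspace {n : ℕ} (A : Matrix (Fin n) (Fin n) ℝ) : Submodule ℝ (Sp n) :=
  spectralSubspace A {μ | μ.re = 0}

/-- The stable subspace `X^s`. -/
def stableSubspace {n : ℕ} (A : Matrix (Fin n) (Fin n) ℝ) : Submodule ℝ (Sp n) :=
  spectralSubspace A {μ | μ.re < 0}

/-- Center-stable situation: all eigenvalues of `A` lie on the imaginary axis or in the open left
half-plane, and `Pc`, `Ps` are the projections of the splitting `ℝⁿ = X^c ⊕ X^s`. -/
structure CenterStableSplitting {n : ℕ} (A : Matrix (Fin n) (Fin n) ℝ)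
    (Pc Ps : Sp n →L[ℝ] Sp n) : Prop where
  eigenvalue : ∀ μ : ℂ, (complexified A).HasEigenvalue μ → μ.re = 0 ∨ μ.re < 0
  center_idem : Pc ∘L Pc = Pc
  stable_idem : Ps ∘L Ps = Ps
  center_range : LinearMap.range (Pc : Sp n →ₗ[ℝ] Sp n) = centerSubspace A
  stable_range : LinearMap.range (Ps : Sp n →ₗ[ℝ] Sp n) = stableSubspace A
  sum_eq : Ps + Pc = ContinuousLinearMap.id ℝ (Sp n)
  center_comm : ∀ t : ℝ, 0 ≤ t → Pc ∘L grp A t = grp A t ∘L Pc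
  stable_comm : ∀ t : ℝ, 0 ≤ t → Ps ∘L grp A t = grp A t ∘L Ps

/-- The exponential dichotomy; `S^c` and `S^s` are the restrictions of `S` to `X^c` and `X^s`. -/
structure ExponentialDichotomy {n : ℕ} (A : Matrix (Fin n) (Fin n) ℝ) (β γ Mc Ms : ℝ) : Prop where
  beta_pos : -β < 0
  gamma_nonneg : 0 ≤ γ
  gamma_lt : γ < β
  one_le_center : 1 ≤ Mc
  one_le_stable : 1 ≤ Ms
  center_bound : ∀ t : ℝ, t ≤ 0 → ∀ x ∈ centerSubspace A,
    ‖grp A t x‖ ≤ Mc * Real.exp (γ * t) * ‖x‖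
  stable_bound : ∀ t : ℝ, 0 ≤ t → ∀ x ∈ stableSubspace A,
    ‖grp A t x‖ ≤ Ms * Real.exp (-β * t) * ‖x‖

/-! ### The coefficients and the cut-off -/

/-- `H` is `m`-times continuously differentiable with bounded derivatives of the orders `1, …, m`
(so for `1 ≤ m` it is Lipschitz). -/
def HasBoundedDerivs {E E' : Type*} [NormedAddCommGroup E] [NormedSpace ℝ E]
    [NormedAddCommGroup E'] [NormedSpace ℝ E'] (m : ℕ) (H : E → E') : Prop :=
  ContDiff ℝ m H ∧ ∀ k : ℕ, 1 ≤ k → k ≤ m → ∃ C : ℝ, ∀ x : E, ‖iteratedFDeriv ℝ k H x‖ ≤ C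

/-- The drift hypothesis. -/
structure DriftHypothesis {n : ℕ} (F : Sp n → Sp n) : Prop where
  smooth : HasBoundedDerivs 1 F
  zero : F 0 = 0
  fderiv_zero : fderiv ℝ F 0 = 0

/-- The diffusion hypothesis. -/
structure DiffusionHypothesis {n d : ℕ} (G : Sp n → Sp d →L[ℝ] Sp n) : Prop where
  smooth : HasBoundedDerivs 3 G
  zero : G 0 = 0
  fderiv_zero : fderiv ℝ G 0 = 0
  fderiv_fderiv_zero : fderiv ℝ (fderiv ℝ G) 0 = 0

/-- A `C³` cut-off function `f : [0,∞) → [0,1]`, equal to `1` on `[0,1/2]` and to `0` on `[1,∞)`. -/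
structure IsCutoff (f : ℝ → ℝ) : Prop where
  smooth : ContDiffOn ℝ 3 f (Ici 0)
  mem_Icc : ∀ x : ℝ, 0 ≤ x → f x ∈ Icc (0 : ℝ) 1
  eq_one : ∀ x : ℝ, 0 ≤ x → x ≤ 1 / 2 → f x = 1
  eq_zero : ∀ x : ℝ, 1 ≤ x → f x = 0

section Map

variable {V X : Type*} [NormedAddCommGroup V] [InnerProductSpace ℝ V]
  [NormedAddCommGroup X] [NormedSpace ℝ X] {α : ℝ}

/-- The random cut-off radius `R(W) = min {R̃(W), 1}`, where `R̃(W)` is the solution of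
`C₁ R̃ + C₂ R̃ (1 + ‖W‖_α) (‖W‖_α + ‖𝕎‖_{2α}) = K`. -/
def cutoffRadius (C₁ C₂ K : ℝ) (𝓦 : RoughPath V α) : ℝ :=
  min (K / (C₁ + C₂ * ((1 + 𝓦.pathSeminorm) * (𝓦.pathSeminorm + 𝓦.areaSeminorm)))) 1

/-- The truncation `χ_R(Y, Y') = f(‖Y, Y'‖ / R) (Y, Y')` of a controlled rough path. -/
def truncate (f : ℝ → ℝ) (R : ℝ) (𝓦 : RoughPath V α) (Y : PathPair V X) :
    PathPair V X :=
  (fun t => f (controlledNorm 𝓦 Y / R) • Y.1 t, fun t => f (controlledNorm 𝓦 Y / R) • Y.2 t)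

/-- `F_R(Y)(t) = F(χ_R(Y)_t)`. -/
def truncDrift (F : X → X) (f : ℝ → ℝ) (R : ℝ) (𝓦 : RoughPath V α)
    (Y : PathPair V X) (t : I) : X :=
  F ((truncate f R 𝓦 Y).1 t)

/-- `G_R(Y)(t) = G(χ_R(Y)_t)` together with its Gubinelli derivative
`DG(χ_R(Y)_t) (χ_R(Y)_t)'`. -/
def truncDiffusion (G : X → V →L[ℝ] X) (f : ℝ → ℝ) (R : ℝ) (𝓦 : RoughPath V α)
    (Y : PathPair V X) : PathPair V (V →L[ℝ] X) :=
  (fun t => G ((truncate f R 𝓦 Y).1 t),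
   fun t => (fderiv ℝ G ((truncate f R 𝓦 Y).1 t)).comp ((truncate f R 𝓦 Y).2 t))

/-- The pair `(S(c - ·) P Z, S(c - ·) P Z')`. -/
def convolved (S : ℝ → X →L[ℝ] X) (P : X →L[ℝ] X) (c : ℝ)
    (Z : PathPair V (V →L[ℝ] X)) : PathPair V (V →L[ℝ] X) :=
  (fun r => (S (c - r) ∘L P) ∘L Z.1 r,
   fun r => (ContinuousLinearMap.compL ℝ V X X (S (c - r) ∘L P)).comp (Z.2 r))

/-- `∫_a^b S(c - r) P F_R(Y)(r) dr + ∫_a^b S(c - r) P G_R(Y)(r) d𝓦_r`. -/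
def convolution (S : ℝ → X →L[ℝ] X) (F : X → X) (G : X → V →L[ℝ] X)
    (f : ℝ → ℝ) (R : ℝ) (P : X →L[ℝ] X) (𝓦 : RoughPath V α)
    (Y : PathPair V X) (a b : I) (c : ℝ) : X :=
  (∫ r in (a : ℝ)..b, S (c - r) (P (IccExtend zero_le_one (truncDrift F f R 𝓦 Y) r)))
    + roughIntegral 𝓦 (convolved S P c (truncDiffusion G f R 𝓦 Y)) a b

/-- Sequences `((U^{i-1}, (U^{i-1})'))`, `i = 0, -1, -2, …`; the entry at `m : ℕ` belongs to
`i = -m`. -/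
abbrev Seq (V X : Type*) [NormedAddCommGroup V] [InnerProductSpace ℝ V]
    [NormedAddCommGroup X] [NormedSpace ℝ X] : Type _ := ℕ → PathPair V X

/-- The shifted rough path `Θ_{i-1} 𝓦` for `i = -m`. -/
def fibre (𝓦 : RoughPath V α) (m : ℕ) : RoughPath V α := 𝓦.shift (-(m : ℝ) - 1)

/-- The norm `sup_i e^{-η(i-1)} ‖U^{i-1}, (U^{i-1})'‖`. -/
def bcNorm (η : ℝ) (𝓦 : RoughPath V α) (U : Seq V X) : ℝ :=
  ⨆ m : ℕ, Real.exp (-η * (-(m : ℝ) - 1)) * controlledNorm (fibre 𝓦 m) (U m)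

/-- The space `BC^η(D^{2α}_W)`. -/
def bcSpace (η : ℝ) (𝓦 : RoughPath V α) : Set (Seq V X) :=
  {U | (∀ m, IsControlled (fibre 𝓦 m) (U m)) ∧ (∀ m, (U m).1 0 = (U (m + 1)).1 1) ∧
    BddAbove (range fun m : ℕ =>
      Real.exp (-η * (-(m : ℝ) - 1)) * controlledNorm (fibre 𝓦 m) (U m))}

/-- The discrete Lyapunov-Perron map `J_{R,d}(W, U, ξ)` for the group `S`, where `R` is the
cut-off radius as a function of the rough path. At position `m` (that is, `i = -m`) the first component is
`S^c(t+i-1) ξ^c` plus four groups of terms: the sum over `k = 0, -1, …, i+1` (where `k = -j`), the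
center integrals over `[t,1]`, the sum over `k = i-1, i-2, …` (where `k = i-1-l`) and the stable
integrals over `[0,t]`. The second component is its Gubinelli derivative `G_R(U^{i-1})`. -/
def lyapunovPerron (S : ℝ → X →L[ℝ] X) (Pc Ps : X →L[ℝ] X)
    (F : X → X) (G : X → V →L[ℝ] X) (f : ℝ → ℝ) (R : RoughPath V α → ℝ)
    (𝓦 : RoughPath V α) (ξ : X) (U : Seq V X) : Seq V X := fun m =>
  let conv (P : X →L[ℝ] X) (j : ℕ) (a b : I) (c : ℝ) : X :=
    convolution S F G f (R (fibre 𝓦 j)) P (fibre 𝓦 j) (U j) a b c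
  (fun t : I =>
    S ((t : ℝ) - m - 1) (Pc ξ)
      - (∑ j ∈ Finset.range m, S ((t : ℝ) - m - 1 + j) (conv Pc j 0 1 1))
      - conv Pc m t 1 t
      + (∑' l : ℕ, S ((t : ℝ) + l) (conv Ps (m + 1 + l) 0 1 1))
      + conv Ps m 0 t t,
   (truncDiffusion G f (R (fibre 𝓦 m)) (fibre 𝓦 m) (U m)).1)

/-- All limits in the definition of `J_{R,d}(W, U, ·)` exist: the rough integrals converge, and so
do the infinite series on the stable part. -/
def IsWellDefined (S : ℝ → X →L[ℝ] X) (Pc Ps : X →L[ℝ] X)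
    (F : X → X) (G : X → V →L[ℝ] X) (f : ℝ → ℝ) (R : RoughPath V α → ℝ)
    (𝓦 : RoughPath V α) (U : Seq V X) : Prop :=
  (∀ P : X →L[ℝ] X, P = Pc ∨ P = Ps → ∀ (m : ℕ) (a b : I) (c : ℝ), a ≤ b →
    ∃ J : X, IsRoughIntegral (fibre 𝓦 m)
      (convolved S P c (truncDiffusion G f (R (fibre 𝓦 m)) (fibre 𝓦 m) (U m))) a b J) ∧
  (∀ (m : ℕ) (t : I), Summable fun l : ℕ => S ((t : ℝ) + l)
    (convolution S F G f (R (fibre 𝓦 (m + 1 + l))) Ps (fibre 𝓦 (m + 1 + l)) (U (m + 1 + l)) 0 1 1))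

/-- The gap condition. -/
def GapCondition (CS β γ Mc Ms η K : ℝ) : Prop :=
  K * (Real.exp (β + η) * (CS * Ms * Real.exp (-η) + 1) / (1 - Real.exp (-(β + η)))
    + Real.exp (γ - η) * (CS * Mc * Real.exp (-η) + 1) / (1 - Real.exp (-(γ - η)))) < 1 / 4

end Map

end

end RoughCenter

open RoughCenter

namespace RoughCenter

noncomputable section

/-! ### Hölder semi-norms and supremum norms -/

section Seminorms

variable {E : Type*} [NormedAddCommGroup E] {β : ℝ}

lemma sub_rpow_nonneg {s t : I} (h : s ≤ t) (β : ℝ) : 0 ≤ ((t : ℝ) - s) ^ β :=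
  Real.rpow_nonneg (sub_nonneg.2 h) _

lemma sub_rpow_le_rpow {s t : I} (h : s ≤ t) {p q : ℝ} (hq : 0 < q) (hqp : q ≤ p) :
    ((t : ℝ) - s) ^ p ≤ ((t : ℝ) - s) ^ q := by
  rcases h.eq_or_lt with rfl | hlt
  · simp [Real.zero_rpow hq.ne', Real.zero_rpow (hq.trans_le hqp).ne']
  · exact Real.rpow_le_rpow_of_exponent_ge (sub_pos.2 hlt)
      (by linarith [t.2.2, s.2.1]) hqp

lemma sub_le_sub_rpow {s t : I} (h : s ≤ t) {q : ℝ} (hq : 0 < q) (hq1 : q ≤ 1) :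
    (t : ℝ) - s ≤ ((t : ℝ) - s) ^ q := by
  simpa using sub_rpow_le_rpow h hq hq1

lemma holderSeminormTwo_nonneg (β : ℝ) (R : I → I → E) : 0 ≤ holderSeminormTwo β R :=
  Real.sInf_nonneg fun _ hC => hC.1

lemma holderSeminormTwo_le {R : I → I → E} {C : ℝ} (hC : 0 ≤ C)
    (h : ∀ s t : I, s ≤ t → ‖R s t‖ ≤ C * ((t : ℝ) - s) ^ β) : holderSeminormTwo β R ≤ C :=
  csInf_le ⟨0, fun _ hx => hx.1⟩ ⟨hC, h⟩

lemma IsHolderTwo.norm_le {R : I → I → E} (h : IsHolderTwo β R) {s t : I} (hst : s ≤ t) :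
    ‖R s t‖ ≤ holderSeminormTwo β R * ((t : ℝ) - s) ^ β := by
  obtain ⟨C, hC⟩ := h
  have hne : {C : ℝ | 0 ≤ C ∧ ∀ s t : I, s ≤ t → ‖R s t‖ ≤ C * ((t : ℝ) - s) ^ β}.Nonempty :=
    ⟨max C 0, le_max_right _ _, fun s t hst => (hC s t hst).trans
      (mul_le_mul_of_nonneg_right (le_max_left _ _) (sub_rpow_nonneg hst β))⟩
  rcases (sub_rpow_nonneg hst β).eq_or_lt with h0 | hpos
  · have := hC s t hst
    rw [← h0] at this ⊢
    simpa using this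
  · rw [← div_le_iff₀ hpos]
    exact le_csInf hne fun C hC => (div_le_iff₀ hpos).2 (hC.2 s t hst)

lemma supNorm_nonneg (Y : I → E) : 0 ≤ supNorm Y := Real.iSup_nonneg fun _ => norm_nonneg _

lemma supNorm_le {Y : I → E} {C : ℝ} (h : ∀ t, ‖Y t‖ ≤ C) : supNorm Y ≤ C := ciSup_le h

lemma IsHolderTwo.norm_le_supNorm (hβ : 0 < β) {Y : I → E} (h : IsHolderTwo β (incr Y)) (t : I) :
    ‖Y t‖ ≤ supNorm Y := by
  refine le_ciSup (f := fun t => ‖Y t‖) ⟨‖Y 0‖ + holderSeminormTwo β (incr Y), ?_⟩ t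
  rintro _ ⟨t, rfl⟩
  have h1 := h.norm_le (show (0 : I) ≤ t from t.2.1)
  have h2 : ((t : ℝ) - (0 : I)) ^ β ≤ 1 :=
    Real.rpow_le_one (by simpa using t.2.1) (by simpa using t.2.2) hβ.le
  have h3 := mul_le_mul_of_nonneg_left h2 (holderSeminormTwo_nonneg β (incr Y))
  have h4 : ‖Y t‖ ≤ ‖Y 0‖ + ‖incr Y 0 t‖ := by
    have : Y t = Y 0 + incr Y 0 t := by simp [incr]
    conv_lhs => rw [this]
    exact norm_add_le _ _
  simp only at *
  linarith

lemma continuous_of_norm_sub_le (hβ : 0 < β) {Y : I → E} {C : ℝ}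
    (h : ∀ s t : I, s ≤ t → ‖Y t - Y s‖ ≤ C * ((t : ℝ) - s) ^ β) : Continuous Y := by
  have hsym : ∀ s t : I, ‖Y t - Y s‖ ≤ C * |(t : ℝ) - (s : ℝ)| ^ β := by
    intro s t
    rcases le_total s t with hst | hst
    · rw [abs_of_nonneg (sub_nonneg.2 (show (s : ℝ) ≤ t from hst))]
      exact h s t hst
    · rw [norm_sub_rev, abs_sub_comm, abs_of_nonneg (sub_nonneg.2 (show (t : ℝ) ≤ s from hst))]
      exact h t s hst
  refine continuous_iff_continuousAt.2 fun s => tendsto_iff_norm_sub_tendsto_zero.2 ?_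
  refine squeeze_zero (fun _ => norm_nonneg _) (fun t => hsym s t) ?_
  have : Continuous fun t : I => C * |(t : ℝ) - (s : ℝ)| ^ β :=
    continuous_const.mul ((by fun_prop : Continuous fun t : I => |(t : ℝ) - (s : ℝ)|).rpow_const
      fun _ => Or.inr hβ.le)
  simpa [Real.zero_rpow hβ.ne'] using this.tendsto s

end Seminorms

/-! ### Controlled rough paths with explicit bounds -/

section Controlled

variable {V : Type*} [NormedAddCommGroup V] [InnerProductSpace ℝ V] {α : ℝ}
variable {E : Type*} [NormedAddCommGroup E] [NormedSpace ℝ E]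
variable {E' : Type*} [NormedAddCommGroup E'] [NormedSpace ℝ E']

lemma RoughPath.pathSeminorm_nonneg (𝓦 : RoughPath V α) : 0 ≤ 𝓦.pathSeminorm :=
  holderSeminormTwo_nonneg _ _

lemma RoughPath.areaSeminorm_nonneg (𝓦 : RoughPath V α) : 0 ≤ 𝓦.areaSeminorm :=
  holderSeminormTwo_nonneg _ _

lemma RoughPath.norm_path_sub_le (𝓦 : RoughPath V α) {s t : I} (h : s ≤ t) :
    ‖𝓦.path t - 𝓦.path s‖ ≤ 𝓦.pathSeminorm * ((t : ℝ) - s) ^ α := by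
  obtain ⟨C, hC⟩ := 𝓦.path_holder 1
  exact IsHolderTwo.norm_le (R := incr fun t : I => 𝓦.path t)
    ⟨C, fun s t h => hC s t (by linarith [s.2.1]) h t.2.2⟩ h

lemma RoughPath.norm_area_le (𝓦 : RoughPath V α) {s t : I} (h : s ≤ t) :
    ‖𝓦.area s t‖ ≤ 𝓦.areaSeminorm * ((t : ℝ) - s) ^ (2 * α) := by
  obtain ⟨C, hC⟩ := 𝓦.area_holder 1
  exact IsHolderTwo.norm_le (R := fun s t : I => 𝓦.area s t)
    ⟨C, fun s t h => hC s t (by linarith [s.2.1]) h t.2.2⟩ h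

/-- All parts of the norm of the controlled rough path `Y` are at most `c`. -/
structure ControlledBy (𝓦 : RoughPath V α) (Y : PathPair V E) (c : ℝ) : Prop where
  sup : ∀ t, ‖Y.1 t‖ ≤ c
  deriv_sup : ∀ t, ‖Y.2 t‖ ≤ c
  deriv_incr : ∀ s t : I, s ≤ t → ‖Y.2 t - Y.2 s‖ ≤ c * ((t : ℝ) - s) ^ α
  remainder : ∀ s t : I, s ≤ t → ‖remainder 𝓦 Y s t‖ ≤ c * ((t : ℝ) - s) ^ (2 * α)

variable {𝓦 : RoughPath V α} {Y Z : PathPair V E} {c c' : ℝ}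

lemma remainder_add (𝓦 : RoughPath V α) (Y Z : PathPair V E) (s t : I) :
    remainder 𝓦 (Y + Z) s t = remainder 𝓦 Y s t + remainder 𝓦 Z s t := by
  simp [remainder]; abel

lemma remainder_sub (𝓦 : RoughPath V α) (Y Z : PathPair V E) (s t : I) :
    remainder 𝓦 (Y - Z) s t = remainder 𝓦 Y s t - remainder 𝓦 Z s t := by
  simp [remainder]; abel

lemma remainder_smul (𝓦 : RoughPath V α) (r : ℝ) (Y : PathPair V E) (s t : I) :
    remainder 𝓦 (r • Y) s t = r • remainder 𝓦 Y s t := by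
  simp [remainder, smul_sub]

lemma ControlledBy.nonneg (h : ControlledBy 𝓦 Y c) : 0 ≤ c := (norm_nonneg _).trans (h.sup 0)

lemma ControlledBy.mono (h : ControlledBy 𝓦 Y c) (hc : c ≤ c') : ControlledBy 𝓦 Y c' where
  sup t := (h.sup t).trans hc
  deriv_sup t := (h.deriv_sup t).trans hc
  deriv_incr s t hst := (h.deriv_incr s t hst).trans
    (mul_le_mul_of_nonneg_right hc (sub_rpow_nonneg hst _))
  remainder s t hst := (h.remainder s t hst).trans
    (mul_le_mul_of_nonneg_right hc (sub_rpow_nonneg hst _))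

lemma ControlledBy.add (h : ControlledBy 𝓦 Y c) (h' : ControlledBy 𝓦 Z c') :
    ControlledBy 𝓦 (Y + Z) (c + c') where
  sup t := (norm_add_le _ _).trans (add_le_add (h.sup t) (h'.sup t))
  deriv_sup t := (norm_add_le _ _).trans (add_le_add (h.deriv_sup t) (h'.deriv_sup t))
  deriv_incr s t hst := by
    have : (Y + Z).2 t - (Y + Z).2 s = (Y.2 t - Y.2 s) + (Z.2 t - Z.2 s) := by
      simp; abel
    rw [this, add_mul]
    exact (norm_add_le _ _).trans (add_le_add (h.deriv_incr s t hst) (h'.deriv_incr s t hst))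
  remainder s t hst := by
    rw [remainder_add, add_mul]
    exact (norm_add_le _ _).trans (add_le_add (h.remainder s t hst) (h'.remainder s t hst))

lemma ControlledBy.smul (r : ℝ) (h : ControlledBy 𝓦 Y c) :
    ControlledBy 𝓦 (r • Y) (|r| * c) where
  sup t := by
    simpa [norm_smul] using mul_le_mul_of_nonneg_left (h.sup t) (abs_nonneg r)
  deriv_sup t := by
    simpa [norm_smul] using mul_le_mul_of_nonneg_left (h.deriv_sup t) (abs_nonneg r)
  deriv_incr s t hst := by
    have := mul_le_mul_of_nonneg_left (h.deriv_incr s t hst) (abs_nonneg r)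
    simpa [← smul_sub, norm_smul, mul_assoc] using this
  remainder s t hst := by
    have := mul_le_mul_of_nonneg_left (h.remainder s t hst) (abs_nonneg r)
    simpa [remainder_smul, norm_smul, mul_assoc] using this

lemma ControlledBy.sub (h : ControlledBy 𝓦 Y c) (h' : ControlledBy 𝓦 Z c') :
    ControlledBy 𝓦 (Y - Z) (c + c') := by
  have := h.add (h'.smul (-1))
  simpa [← sub_eq_add_neg] using this

lemma ControlledBy.norm_incr_le (h : ControlledBy 𝓦 Y c) (hα : 0 < α) {s t : I} (hst : s ≤ t) :
    ‖Y.1 t - Y.1 s‖ ≤ c * (1 + 𝓦.pathSeminorm) * ((t : ℝ) - s) ^ α := by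
  have h1 : Y.1 t - Y.1 s = RoughCenter.remainder 𝓦 Y s t + Y.2 s (𝓦.path t - 𝓦.path s) := by
    simp [RoughCenter.remainder]
  have h2 := (Y.2 s).le_of_opNorm_le_of_le (h.deriv_sup s) (𝓦.norm_path_sub_le hst)
  have h3 := (h.remainder s t hst).trans (mul_le_mul_of_nonneg_left
    (sub_rpow_le_rpow hst hα (by linarith : α ≤ 2 * α)) h.nonneg)
  rw [h1]
  refine (norm_add_le _ _).trans ((add_le_add h3 h2).trans (le_of_eq (by ring)))

lemma ControlledBy.isControlled (h : ControlledBy 𝓦 Y c) (hα : 0 < α) : IsControlled 𝓦 Y where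
  holder := ⟨_, fun _ _ hst => h.norm_incr_le hα hst⟩
  deriv_holder := ⟨c, h.deriv_incr⟩
  remainder_holder := ⟨c, h.remainder⟩

lemma ControlledBy.controlledNorm_le (h : ControlledBy 𝓦 Y c) : controlledNorm 𝓦 Y ≤ 4 * c := by
  have h1 := supNorm_le h.sup
  have h2 := supNorm_le h.deriv_sup
  have h3 := holderSeminormTwo_le h.nonneg h.deriv_incr
  have h4 := holderSeminormTwo_le h.nonneg h.remainder
  change supNorm Y.1 + supNorm Y.2 + holderSeminormTwo α (fun s t => Y.2 t - Y.2 s) + _ ≤ _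
  linarith

lemma controlledNorm_nonneg (𝓦 : RoughPath V α) (Y : PathPair V E) : 0 ≤ controlledNorm 𝓦 Y :=
  add_nonneg (add_nonneg (add_nonneg (supNorm_nonneg _) (supNorm_nonneg _))
    (holderSeminormTwo_nonneg _ _)) (holderSeminormTwo_nonneg _ _)

lemma IsControlled.controlledBy (h : IsControlled 𝓦 Y) (hα : 0 < α) :
    ControlledBy 𝓦 Y (controlledNorm 𝓦 Y) := by
  have h1 := supNorm_nonneg Y.1
  have h2 := supNorm_nonneg Y.2
  have h3 := holderSeminormTwo_nonneg α (incr Y.2)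
  have h4 := holderSeminormTwo_nonneg (2 * α) (remainder 𝓦 Y)
  refine ⟨fun t => (h.holder.norm_le_supNorm hα t).trans ?_,
    fun t => (h.deriv_holder.norm_le_supNorm hα t).trans ?_,
    fun s t hst => (h.deriv_holder.norm_le hst).trans
      (mul_le_mul_of_nonneg_right ?_ (sub_rpow_nonneg hst _)),
    fun s t hst => (h.remainder_holder.norm_le hst).trans
      (mul_le_mul_of_nonneg_right ?_ (sub_rpow_nonneg hst _))⟩ <;>
  · unfold controlledNorm
    linarith

lemma IsControlled.sub (h : IsControlled 𝓦 Y) (h' : IsControlled 𝓦 Z) (hα : 0 < α) :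
    IsControlled 𝓦 (Y - Z) :=
  ((h.controlledBy hα).sub (h'.controlledBy hα)).isControlled hα

lemma IsControlled.controlledNorm_le_add_sub (h : IsControlled 𝓦 Y) (h' : IsControlled 𝓦 Z)
    (hα : 0 < α) : controlledNorm 𝓦 Y ≤ controlledNorm 𝓦 Z + controlledNorm 𝓦 (Y - Z) := by
  have hd := h.sub h' hα
  have h1 : supNorm Y.1 ≤ supNorm Z.1 + supNorm (Y - Z).1 := supNorm_le fun t => by
    have : Y.1 t = Z.1 t + (Y - Z).1 t := by simp
    rw [this]
    exact (norm_add_le _ _).trans (add_le_add (h'.holder.norm_le_supNorm hα t)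
      (hd.holder.norm_le_supNorm hα t))
  have h2 : supNorm Y.2 ≤ supNorm Z.2 + supNorm (Y - Z).2 := supNorm_le fun t => by
    have : Y.2 t = Z.2 t + (Y - Z).2 t := by simp
    rw [this]
    exact (norm_add_le _ _).trans (add_le_add (h'.deriv_holder.norm_le_supNorm hα t)
      (hd.deriv_holder.norm_le_supNorm hα t))
  have h3 : holderSeminormTwo α (incr Y.2)
      ≤ holderSeminormTwo α (incr Z.2) + holderSeminormTwo α (incr (Y - Z).2) :=
    holderSeminormTwo_le
      (add_nonneg (holderSeminormTwo_nonneg _ _) (holderSeminormTwo_nonneg _ _)) fun s t hst => by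
      have : incr Y.2 s t = incr Z.2 s t + incr (Y - Z).2 s t := by simp [incr]; abel
      rw [this, add_mul]
      exact (norm_add_le _ _).trans (add_le_add (h'.deriv_holder.norm_le hst)
        (hd.deriv_holder.norm_le hst))
  have h4 : holderSeminormTwo (2 * α) (remainder 𝓦 Y)
      ≤ holderSeminormTwo (2 * α) (remainder 𝓦 Z)
        + holderSeminormTwo (2 * α) (remainder 𝓦 (Y - Z)) :=
    holderSeminormTwo_le
      (add_nonneg (holderSeminormTwo_nonneg _ _) (holderSeminormTwo_nonneg _ _)) fun s t hst => by
      have : remainder 𝓦 Y s t = remainder 𝓦 Z s t + remainder 𝓦 (Y - Z) s t := by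
        rw [remainder_sub]; abel
      rw [this, add_mul]
      exact (norm_add_le _ _).trans (add_le_add (h'.remainder_holder.norm_le hst)
        (hd.remainder_holder.norm_le hst))
  unfold controlledNorm
  linarith

lemma controlledNorm_sub_comm (𝓦 : RoughPath V α) (Y Z : PathPair V E) :
    controlledNorm 𝓦 (Y - Z) = controlledNorm 𝓦 (Z - Y) := by
  have h (s t : I) : ‖remainder 𝓦 (Y - Z) s t‖ = ‖remainder 𝓦 (Z - Y) s t‖ := by
    rw [remainder_sub, remainder_sub, norm_sub_rev]
  have h' (s t : I) : ‖incr (Y - Z).2 s t‖ = ‖incr (Z - Y).2 s t‖ := by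
    rw [← norm_neg]; congr 1; simp [incr]; abel
  have h1 (t : I) : ‖(Y - Z).1 t‖ = ‖(Z - Y).1 t‖ := by simpa using norm_sub_rev _ _
  have h2 (t : I) : ‖(Y - Z).2 t‖ = ‖(Z - Y).2 t‖ := by simpa using norm_sub_rev _ _
  simp only [controlledNorm, supNorm, holderSeminormTwo, h, h', h1, h2]

lemma IsControlled.abs_controlledNorm_sub_le (h : IsControlled 𝓦 Y) (h' : IsControlled 𝓦 Z)
    (hα : 0 < α) :
    |controlledNorm 𝓦 Y - controlledNorm 𝓦 Z| ≤ controlledNorm 𝓦 (Y - Z) := by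
  rw [abs_le]
  have h1 := h.controlledNorm_le_add_sub h' hα
  have h2 := h'.controlledNorm_le_add_sub h hα
  rw [controlledNorm_sub_comm 𝓦 Z Y] at h2
  constructor <;> linarith

/-- A path of bounded operators acts on controlled rough paths. -/
def opMul (M : I → E →L[ℝ] E') (Y : PathPair V E) : PathPair V E' :=
  (fun t => M t (Y.1 t), fun t => (M t).comp (Y.2 t))

lemma opMul_sub (M : I → E →L[ℝ] E') (Y Z : PathPair V E) :
    opMul M (Y - Z) = opMul M Y - opMul M Z := by
  ext <;> simp [opMul]

lemma ControlledBy.opMul (h : ControlledBy 𝓦 Y c) (hα : 0 < α) (hα2 : α ≤ 1 / 2)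
    {M : I → E →L[ℝ] E'} {m : ℝ} (hM : ∀ t, ‖M t‖ ≤ m)
    (hM' : ∀ s t : I, s ≤ t → ‖M t - M s‖ ≤ m * ((t : ℝ) - s)) :
    ControlledBy 𝓦 (opMul M Y) (2 * m * c) := by
  have hm : 0 ≤ m := (norm_nonneg _).trans (hM 0)
  have hc := h.nonneg
  have hmc : 0 ≤ m * c := mul_nonneg hm hc
  refine ⟨fun t => ?_, fun t => ?_, fun s t hst => ?_, fun s t hst => ?_⟩
  · have := (M t).le_of_opNorm_le_of_le (hM t) (h.sup t)
    simp only [RoughCenter.opMul]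
    linarith
  · have := (ContinuousLinearMap.opNorm_comp_le (M t) (Y.2 t)).trans
      (mul_le_mul (hM t) (h.deriv_sup t) (norm_nonneg _) hm)
    simp only [RoughCenter.opMul]
    linarith
  · have e : (RoughCenter.opMul M Y).2 t - (RoughCenter.opMul M Y).2 s
        = (M t - M s).comp (Y.2 t) + (M s).comp (Y.2 t - Y.2 s) := by
      ext x; simp [RoughCenter.opMul]
    have h1 := (ContinuousLinearMap.opNorm_comp_le (M t - M s) (Y.2 t)).trans
      (mul_le_mul (hM' s t hst) (h.deriv_sup t) (norm_nonneg _)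
        (mul_nonneg hm (sub_nonneg.2 hst)))
    have h2 := (ContinuousLinearMap.opNorm_comp_le (M s) (Y.2 t - Y.2 s)).trans
      (mul_le_mul (hM s) (h.deriv_incr s t hst) (norm_nonneg _) hm)
    have h3 := mul_le_mul_of_nonneg_left
      (sub_le_sub_rpow hst hα (by linarith)) hmc
    rw [e]
    refine (norm_add_le _ _).trans ?_
    linarith
  · have e : RoughCenter.remainder 𝓦 (RoughCenter.opMul M Y) s t
        = (M t - M s) (Y.1 t) + (M s) (RoughCenter.remainder 𝓦 Y s t) := by
      simp [RoughCenter.opMul, RoughCenter.remainder]; abel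
    have h1 := (M t - M s).le_of_opNorm_le_of_le (hM' s t hst) (h.sup t)
    have h2 := (M s).le_of_opNorm_le_of_le (hM s) (h.remainder s t hst)
    have h3 := mul_le_mul_of_nonneg_left
      (sub_le_sub_rpow hst (by linarith : 0 < 2 * α) (by linarith)) hmc
    rw [e]
    refine (norm_add_le _ _).trans ?_
    linarith

/-- A Lipschitz path is controlled with vanishing Gubinelli derivative. -/
lemma controlledBy_of_lipschitz (hα : 0 < α) (hα2 : α ≤ 1 / 2) {y : I → E} (hy : ∀ t, ‖y t‖ ≤ c)
    (hy' : ∀ s t : I, s ≤ t → ‖y t - y s‖ ≤ c * ((t : ℝ) - s)) :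
    ControlledBy 𝓦 ((y, 0) : PathPair V E) c := by
  have hc : 0 ≤ c := (norm_nonneg _).trans (hy 0)
  refine ⟨hy, fun t => by simpa using hc, fun s t hst => ?_, fun s t hst => ?_⟩
  · simpa using mul_nonneg hc (sub_rpow_nonneg hst α)
  · have h3 := mul_le_mul_of_nonneg_left
      (sub_le_sub_rpow hst (by linarith : 0 < 2 * α) (by linarith)) hc
    simpa [RoughCenter.remainder] using (hy' s t hst).trans h3

/-- Bounds pass to pointwise limits. -/
lemma ControlledBy.of_tendsto {ι : Type*} {l : Filter ι} [l.NeBot] {y : ι → PathPair V E}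
    (h : ∀ᶠ k in l, ControlledBy 𝓦 (y k) c)
    (h1 : ∀ t, Tendsto (fun k => (y k).1 t) l (𝓝 (Y.1 t)))
    (h2 : ∀ t, Tendsto (fun k => (y k).2 t) l (𝓝 (Y.2 t))) : ControlledBy 𝓦 Y c where
  sup t := le_of_tendsto (h1 t).norm (h.mono fun _ hk => hk.sup t)
  deriv_sup t := le_of_tendsto (h2 t).norm (h.mono fun _ hk => hk.deriv_sup t)
  deriv_incr s t hst := le_of_tendsto ((h2 t).sub (h2 s)).norm
    (h.mono fun _ hk => hk.deriv_incr s t hst)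
  remainder s t hst := by
    have : Tendsto (fun k => RoughCenter.remainder 𝓦 (y k) s t) l
        (𝓝 (RoughCenter.remainder 𝓦 Y s t)) :=
      ((h1 t).sub (h1 s)).sub
        (((ContinuousLinearMap.apply ℝ E (𝓦.path t - 𝓦.path s)).continuous.tendsto _).comp (h2 s))
    exact le_of_tendsto this.norm (h.mono fun _ hk => hk.remainder s t hst)

end Controlled

/-! ### The sewing lemma on the unit interval -/

section Sewing

variable {E : Type*} [NormedAddCommGroup E] {A : I → I → E} {K θ : ℝ}

/-- The constant in the sewing lemma with exponent `θ`. -/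
def sewingConst (θ : ℝ) : ℝ := 2 / (1 - 2 ^ (1 - θ))

lemma two_rpow_lt_one (hθ : 1 < θ) : (2 : ℝ) ^ (1 - θ) < 1 :=
  Real.rpow_lt_one_of_one_lt_of_neg one_lt_two (by linarith)

lemma sewingConst_pos (hθ : 1 < θ) : 0 < sewingConst θ :=
  div_pos two_pos (sub_pos.2 (two_rpow_lt_one hθ))

lemma norm_partition_sum_sub_le (hθ : 1 < θ) (hK : 0 ≤ K) (hA : ∀ s, A s s = 0)
    (hδ : ∀ s u t, s ≤ u → u ≤ t → ‖A s t - A s u - A u t‖ ≤ K * ((t : ℝ) - s) ^ θ)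
    (N : ℕ) (p : ℕ → I) (hp : Monotone p) :
    ‖∑ j ∈ Finset.range N, A (p j) (p (j + 1)) - A (p 0) (p N)‖
      ≤ sewingConst θ * K * ((p N : ℝ) - p 0) ^ θ := by
  induction N using Nat.strong_induction_on generalizing p with
  | _ N ih =>
  have h0N := hp (Nat.zero_le N)
  rcases h0N.eq_or_lt with heq | hlt
  · have hz : ∑ j ∈ Finset.range N, A (p j) (p (j + 1)) = 0 := by
      refine Finset.sum_eq_zero fun j hj => ?_
      have hj := Finset.mem_range.1 hj
      have e1 : p j = p 0 := le_antisymm ((hp hj.le).trans heq.ge) (hp (Nat.zero_le _))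
      have e2 : p (j + 1) = p 0 := le_antisymm ((hp hj).trans heq.ge) (hp (Nat.zero_le _))
      rw [e1, e2, hA]
    rw [hz, ← heq, hA]
    have := (sewingConst_pos hθ).le
    simp only [sub_self, norm_zero]
    positivity
  · set h : ℝ := (p N : ℝ) - p 0 with hh
    have hlt' : (p 0 : ℝ) < p N := hlt
    have hh0 : 0 < h := sub_pos.2 hlt'
    have hex : ∃ k, (p 0 : ℝ) + h / 2 < p k := ⟨N, by rw [hh]; linarith⟩
    classical
    obtain ⟨k, hk, hmin⟩ : ∃ k, ((p 0 : ℝ) + h / 2 < p k) ∧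
        ∀ m < k, ¬ ((p 0 : ℝ) + h / 2 < p m) :=
      ⟨Nat.find hex, Nat.find_spec hex, fun m hm => Nat.find_min hex hm⟩
    have hkN : k ≤ N := by
      by_contra hc
      exact hmin N (not_le.1 hc) (by rw [hh]; linarith)
    obtain ⟨j, rfl⟩ : ∃ j, k = j + 1 := by
      refine Nat.exists_eq_succ_of_ne_zero ?_
      rintro rfl
      linarith
    obtain ⟨r, rfl⟩ := Nat.exists_eq_add_of_le hkN
    have hj : (p j : ℝ) - p 0 ≤ h / 2 := by
      have := not_lt.1 (hmin j (Nat.lt_succ_self j))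
      linarith
    have hr : (p (j + 1 + r) : ℝ) - p (j + 1) ≤ h / 2 := by
      rw [hh] at hk ⊢
      linarith
    have hC : 0 ≤ sewingConst θ * K := mul_nonneg (sewingConst_pos hθ).le hK
    have b1 := ih j (by omega) p hp
    have b2 := ih r (by omega) (fun i => p (j + 1 + i)) (fun a b hab => hp (by omega))
    have b3 := hδ (p 0) (p j) (p (j + 1 + r)) (hp (Nat.zero_le _)) (hp (by omega))
    have b4 := hδ (p j) (p (j + 1)) (p (j + 1 + r)) (hp (by omega)) (hp (by omega))
    have hjr : (0 : ℝ) ≤ (p j : ℝ) - p 0 := sub_nonneg.2 (hp (Nat.zero_le _))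
    have hrr : (0 : ℝ) ≤ (p (j + 1 + r) : ℝ) - p (j + 1) := sub_nonneg.2 (hp (by omega))
    have hjj : (0 : ℝ) ≤ (p (j + 1 + r) : ℝ) - p j := sub_nonneg.2 (hp (by omega))
    have hhalf : 2 * (h / 2) ^ θ = 2 ^ (1 - θ) * h ^ θ := by
      rw [Real.div_rpow hh0.le two_pos.le, Real.rpow_sub two_pos, Real.rpow_one]
      ring
    have c1 := b1.trans (mul_le_mul_of_nonneg_left
      (Real.rpow_le_rpow hjr hj (by linarith : 0 ≤ θ)) hC)
    have c2 := b2.trans (mul_le_mul_of_nonneg_left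
      (Real.rpow_le_rpow hrr hr (by linarith : 0 ≤ θ)) hC)
    have c4 := b4.trans (mul_le_mul_of_nonneg_left
      (Real.rpow_le_rpow hjj (by rw [hh]; linarith : _ ≤ h) (by linarith : 0 ≤ θ)) hK)
    have hsplit : ∑ i ∈ Finset.range (j + 1 + r), A (p i) (p (i + 1)) - A (p 0) (p (j + 1 + r))
        = (∑ i ∈ Finset.range j, A (p i) (p (i + 1)) - A (p 0) (p j))
          + (∑ i ∈ Finset.range r, A (p (j + 1 + i)) (p (j + 1 + (i + 1)))
              - A (p (j + 1 + 0)) (p (j + 1 + r)))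
          - (A (p 0) (p (j + 1 + r)) - A (p 0) (p j) - A (p j) (p (j + 1 + r)))
          - (A (p j) (p (j + 1 + r)) - A (p j) (p (j + 1)) - A (p (j + 1)) (p (j + 1 + r))) := by
      rw [Finset.sum_range_add, Finset.sum_range_succ]
      simp only [add_zero, add_assoc]
      abel
    have hfin : sewingConst θ * K * (2 ^ (1 - θ) * h ^ θ) + 2 * (K * h ^ θ)
        = sewingConst θ * K * h ^ θ := by
      have : 1 - (2 : ℝ) ^ (1 - θ) ≠ 0 := (sub_pos.2 (two_rpow_lt_one hθ)).ne'
      unfold sewingConst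
      field_simp
      ring
    rw [hsplit]
    refine (norm_sub_le _ _).trans ?_
    refine (add_le_add_left (norm_sub_le _ _) _).trans ?_
    refine (add_le_add_left (add_le_add_left (norm_add_le _ _) _) _).trans ?_
    rw [← hfin, ← hhalf]
    linarith

/-- The dyadic grid of level `n`. -/
def dyadicGrid (n k : ℕ) : I := projIcc 0 1 zero_le_one ((k : ℝ) / 2 ^ n)

lemma dyadicGrid_mono (n : ℕ) : Monotone (dyadicGrid n) := fun a b hab =>
  monotone_projIcc _ (by gcongr)

lemma dyadicGrid_zero (n : ℕ) : dyadicGrid n 0 = 0 := by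
  simp [dyadicGrid]

lemma dyadicGrid_last (n : ℕ) : dyadicGrid n (2 ^ n) = 1 := by
  simp [dyadicGrid]

lemma dyadicGrid_succ_two_mul (n k : ℕ) : dyadicGrid (n + 1) (2 * k) = dyadicGrid n k := by
  unfold dyadicGrid
  congr 1
  push_cast
  field_simp
  ring

lemma dyadicGrid_sub_le (n k : ℕ) :
    (dyadicGrid n (k + 1) : ℝ) - dyadicGrid n k ≤ (1 / 2) ^ n := by
  have h := abs_projIcc_sub_projIcc (a := (0 : ℝ)) (b := 1) zero_le_one
    (c := ((k + 1 : ℕ) : ℝ) / 2 ^ n) (d := (k : ℝ) / 2 ^ n)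
  refine (le_abs_self _).trans (h.trans (le_of_eq ?_))
  rw [← sub_div]
  push_cast
  simp

/-- Projection of a time to the interval `[s, t]`. -/
def clamp (s t x : I) : I := max s (min x t)

lemma clamp_mono (s t : I) : Monotone (clamp s t) := fun _ _ h =>
  max_le_max le_rfl (min_le_min h le_rfl)

lemma clamp_sub_le (s t : I) {x y : I} (h : x ≤ y) :
    (clamp s t y : ℝ) - clamp s t x ≤ (y : ℝ) - x := by
  have h' : (x : ℝ) ≤ y := h
  have e (z : I) : (clamp s t z : ℝ) = max (s : ℝ) (min (z : ℝ) t) := by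
    simp [clamp]
  rw [e, e]
  rcases max_cases (s : ℝ) (min (y : ℝ) t) with h1 | h1 <;>
  rcases max_cases (s : ℝ) (min (x : ℝ) t) with h2 | h2 <;>
  rcases min_cases (y : ℝ) t with h3 | h3 <;>
  rcases min_cases (x : ℝ) t with h4 | h4 <;> linarith

lemma clamp_dyadicGrid_sub_le (s t : I) (n k : ℕ) :
    (clamp s t (dyadicGrid n (k + 1)) : ℝ) - clamp s t (dyadicGrid n k) ≤ (1 / 2) ^ n :=
  (clamp_sub_le s t (dyadicGrid_mono n (Nat.le_succ k))).trans (dyadicGrid_sub_le n k)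

/-- The sum of `A` over the dyadic partition of level `n`, restricted to `[s, t]`. -/
def dyadicSum (A : I → I → E) (n : ℕ) (s t : I) : E :=
  ∑ k ∈ Finset.range (2 ^ n), A (clamp s t (dyadicGrid n k)) (clamp s t (dyadicGrid n (k + 1)))

lemma sum_range_two_mul (f : ℕ → E) (m : ℕ) :
    ∑ k ∈ Finset.range (2 * m), f k = ∑ k ∈ Finset.range m, (f (2 * k) + f (2 * k + 1)) := by
  induction m with
  | zero => simp
  | succ m ih =>
    rw [show 2 * (m + 1) = 2 * m + 1 + 1 by ring, Finset.sum_range_succ, Finset.sum_range_succ,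
      Finset.sum_range_succ, ih, add_assoc]

lemma two_pow_mul_half_rpow (θ : ℝ) (n : ℕ) (K : ℝ) :
    ((2 ^ n : ℕ) : ℝ) * (K * ((1 / 2 : ℝ) ^ n) ^ θ) = K * ((2 : ℝ) ^ (1 - θ)) ^ n := by
  have h : (2 : ℝ) ^ (1 - θ) = 2 * (1 / 2) ^ θ := by
    rw [Real.rpow_sub two_pos, Real.rpow_one, Real.div_rpow one_pos.le two_pos.le, Real.one_rpow]
    ring
  have h2 : ((1 / 2 : ℝ) ^ n) ^ θ = ((1 / 2 : ℝ) ^ θ) ^ n := by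
    rw [← Real.rpow_natCast, ← Real.rpow_natCast, ← Real.rpow_mul (by norm_num),
      ← Real.rpow_mul (by norm_num), mul_comm]
  rw [h, h2, mul_pow]
  push_cast
  ring

lemma norm_dyadicSum_succ_sub_le (hθ : 1 < θ) (hK : 0 ≤ K)
    (hδ : ∀ s u t, s ≤ u → u ≤ t → ‖A s t - A s u - A u t‖ ≤ K * ((t : ℝ) - s) ^ θ)
    (s t : I) (n : ℕ) :
    ‖dyadicSum A n s t - dyadicSum A (n + 1) s t‖ ≤ K * ((2 : ℝ) ^ (1 - θ)) ^ n := by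
  unfold dyadicSum
  rw [pow_succ' 2 n, sum_range_two_mul, ← Finset.sum_sub_distrib, ← two_pow_mul_half_rpow]
  refine (norm_sum_le_of_le _ (n := fun _ => K * ((1 / 2 : ℝ) ^ n) ^ θ) fun k _ => ?_).trans
    (le_of_eq (by simp))
  rw [show 2 * k + 1 + 1 = 2 * (k + 1) by ring, dyadicGrid_succ_two_mul, dyadicGrid_succ_two_mul,
    ← sub_sub]
  have m1 : dyadicGrid n k ≤ dyadicGrid (n + 1) (2 * k + 1) := by
    rw [← dyadicGrid_succ_two_mul]
    exact dyadicGrid_mono _ (by omega)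
  have m2 : dyadicGrid (n + 1) (2 * k + 1) ≤ dyadicGrid n (k + 1) := by
    rw [← dyadicGrid_succ_two_mul n (k + 1)]
    exact dyadicGrid_mono _ (by omega)
  refine (hδ _ _ _ (clamp_mono s t m1) (clamp_mono s t m2)).trans
    (mul_le_mul_of_nonneg_left (Real.rpow_le_rpow
      (sub_nonneg.2 (clamp_mono s t (m1.trans m2))) (clamp_dyadicGrid_sub_le s t n k)
      (by linarith)) hK)

lemma norm_dyadicSum_add_sub_le (hθ : 1 < θ) (hK : 0 ≤ K) (hA : ∀ s, A s s = 0)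
    (hδ : ∀ s u t, s ≤ u → u ≤ t → ‖A s t - A s u - A u t‖ ≤ K * ((t : ℝ) - s) ^ θ)
    {s u t : I} (hsu : s ≤ u) (hut : u ≤ t) (n : ℕ) :
    ‖dyadicSum A n s t - dyadicSum A n s u - dyadicSum A n u t‖
      ≤ K * ((2 : ℝ) ^ (1 - θ)) ^ n := by
  unfold dyadicSum
  rw [← Finset.sum_sub_distrib, ← Finset.sum_sub_distrib, ← two_pow_mul_half_rpow]
  refine (norm_sum_le_of_le _ (n := fun _ => K * ((1 / 2 : ℝ) ^ n) ^ θ) fun k _ => ?_).trans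
    (le_of_eq (by simp))
  set x := dyadicGrid n k
  set y := dyadicGrid n (k + 1)
  have hxy : x ≤ y := dyadicGrid_mono n (Nat.le_succ k)
  have hpos : 0 ≤ K * ((1 / 2 : ℝ) ^ n) ^ θ := by positivity
  have c1 (z : I) (hz : z ≤ u) : clamp s t z = clamp s u z := by
    simp [clamp, min_eq_left hz, min_eq_left (hz.trans hut)]
  have c2 (z : I) (hz : z ≤ u) : clamp u t z = u := by
    simp [clamp, min_eq_left (hz.trans hut), max_eq_left hz]
  have c3 (z : I) (hz : u ≤ z) : clamp s t z = clamp u t z := by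
    have : u ≤ min z t := le_min hz hut
    simp [clamp, max_eq_right this, max_eq_right (hsu.trans this)]
  have c4 (z : I) (hz : u ≤ z) : clamp s u z = u := by
    simp [clamp, min_eq_right hz, max_eq_right hsu]
  rcases le_total y u with hy | hy
  · rw [c1 x (hxy.trans hy), c1 y hy, c2 x (hxy.trans hy), c2 y hy, hA]
    simpa using hpos
  rcases le_total u x with hx | hx
  · rw [c3 x hx, c3 y (hx.trans hxy), c4 x hx, c4 y (hx.trans hxy), hA]
    simpa using hpos
  · rw [c2 x hx, c4 y hy, ← c1 x hx, ← c3 y hy]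
    have m1 : clamp s t x ≤ u := by rw [c1 x hx]; exact max_le hsu (min_le_right _ _)
    have m2 : u ≤ clamp s t y := by rw [c3 y hy]; exact le_max_left _ _
    exact (hδ _ _ _ m1 m2).trans (mul_le_mul_of_nonneg_left (Real.rpow_le_rpow
      (sub_nonneg.2 (m1.trans m2)) (clamp_dyadicGrid_sub_le s t n k) (by linarith)) hK)

/-- The sewing lemma. -/
theorem exists_sewing [CompleteSpace E] (hθ : 1 < θ) (hK : 0 ≤ K) (hA : ∀ s, A s s = 0)
    (hδ : ∀ s u t, s ≤ u → u ≤ t → ‖A s t - A s u - A u t‖ ≤ K * ((t : ℝ) - s) ^ θ) :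
    ∃ Φ : I → I → E, (∀ s u t, s ≤ u → u ≤ t → Φ s t = Φ s u + Φ u t) ∧
      ∀ s t, s ≤ t → ‖Φ s t - A s t‖ ≤ sewingConst θ * K * ((t : ℝ) - s) ^ θ := by
  have hcau (s t : I) : ∃ x, Tendsto (fun n => dyadicSum A n s t) atTop (𝓝 x) := by
    refine cauchySeq_tendsto_of_complete
      (cauchySeq_of_le_geometric ((2 : ℝ) ^ (1 - θ)) K (two_rpow_lt_one hθ) fun n => ?_)
    rw [dist_eq_norm]
    exact norm_dyadicSum_succ_sub_le hθ hK hδ s t n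
  choose Φ hΦ using hcau
  refine ⟨Φ, fun s u t hsu hut => ?_, fun s t hst => ?_⟩
  · have h1 : Tendsto (fun n => dyadicSum A n s t - dyadicSum A n s u - dyadicSum A n u t) atTop
        (𝓝 (Φ s t - Φ s u - Φ u t)) := ((hΦ s t).sub (hΦ s u)).sub (hΦ u t)
    have h2 : Tendsto (fun n : ℕ => K * ((2 : ℝ) ^ (1 - θ)) ^ n) atTop (𝓝 0) := by
      simpa using (tendsto_pow_atTop_nhds_zero_of_lt_one
        (Real.rpow_nonneg two_pos.le _) (two_rpow_lt_one hθ)).const_mul K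
    have h3 := squeeze_zero_norm (norm_dyadicSum_add_sub_le hθ hK hA hδ hsu hut) h2
    have h4 := tendsto_nhds_unique h1 h3
    rw [sub_sub, sub_eq_zero] at h4
    exact h4
  · refine le_of_tendsto ((hΦ s t).sub_const (A s t)).norm (Eventually.of_forall fun n => ?_)
    have := norm_partition_sum_sub_le hθ hK hA hδ (2 ^ n) (fun k => clamp s t (dyadicGrid n k))
      ((clamp_mono s t).comp (dyadicGrid_mono n))
    simp only [dyadicGrid_zero, dyadicGrid_last] at this
    have e1 : clamp s t 0 = s := by
      rw [clamp, min_eq_left (show (0 : I) ≤ t from t.2.1)]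
      exact max_eq_left s.2.1
    have e2 : clamp s t 1 = t := by
      rw [clamp, min_eq_right (show t ≤ (1 : I) from t.2.2), max_eq_right hst]
    rwa [e1, e2] at this

lemma partition_mono {N : ℕ} {p : ℕ → I} (hp : ∀ j < N, p j ≤ p (j + 1)) :
    ∀ i ≤ N, p 0 ≤ p i := by
  intro i
  induction i with
  | zero => exact fun _ => le_rfl
  | succ i ih => exact fun h => (ih (by omega)).trans (hp i (by omega))

/-- Riemann sums of `A` converge to the sewing of `A` as the mesh tends to zero. -/
theorem riemann_sums_tendsto {C : ℝ} (hθ : 1 < θ) (hC : 0 ≤ C) {Φ : I → I → E}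
    (hΦ : ∀ s u t, s ≤ u → u ≤ t → Φ s t = Φ s u + Φ u t)
    (hΦA : ∀ s t, s ≤ t → ‖Φ s t - A s t‖ ≤ C * ((t : ℝ) - s) ^ θ) (a b : I)
    {ε : ℝ} (hε : 0 < ε) : ∃ δ : ℝ, 0 < δ ∧ ∀ (N : ℕ) (p : ℕ → I), p 0 = a → p N = b →
      (∀ j < N, p j ≤ p (j + 1)) → (∀ j < N, (p (j + 1) : ℝ) - p j < δ) →
      ‖(∑ j ∈ Finset.range N, A (p j) (p (j + 1))) - Φ a b‖ < ε := by
  have hθ' : 0 < θ - 1 := by linarith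
  have hC1 : 0 < C + 1 := by linarith
  have hq : 0 < ε / (C + 1) := by positivity
  refine ⟨(ε / (C + 1)) ^ (1 / (θ - 1)), by positivity, ?_⟩
  rintro N p rfl rfl hmono hmesh
  have hsum : ∀ i ≤ N, Φ (p 0) (p i) = ∑ j ∈ Finset.range i, Φ (p j) (p (j + 1)) := by
    intro i
    induction i with
    | zero =>
      intro _
      have := hΦ (p 0) (p 0) (p 0) le_rfl le_rfl
      simpa using this
    | succ i ih =>
      intro hi
      rw [Finset.sum_range_succ, ← ih (by omega)]
      exact hΦ _ _ _ (partition_mono hmono i (by omega)) (hmono i (by omega))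
  rw [hsum N le_rfl, ← Finset.sum_sub_distrib]
  have hterm : ∀ j ∈ Finset.range N, ‖A (p j) (p (j + 1)) - Φ (p j) (p (j + 1))‖
      ≤ C * (ε / (C + 1)) * ((p (j + 1) : ℝ) - p j) := by
    intro j hj
    have hj := Finset.mem_range.1 hj
    rw [norm_sub_rev]
    refine (hΦA _ _ (hmono j hj)).trans ?_
    have hnn : (0 : ℝ) ≤ (p (j + 1) : ℝ) - p j := sub_nonneg.2 (hmono j hj)
    have e1 : ((p (j + 1) : ℝ) - p j) ^ θ
        = ((p (j + 1) : ℝ) - p j) ^ (θ - 1) * ((p (j + 1) : ℝ) - p j) := by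
      conv_lhs => rw [show θ = (θ - 1) + 1 by ring]
      rw [Real.rpow_add_of_nonneg hnn hθ'.le zero_le_one, Real.rpow_one]
    have e2 : ((p (j + 1) : ℝ) - p j) ^ (θ - 1) ≤ ε / (C + 1) := by
      refine (Real.rpow_le_rpow hnn (hmesh j hj).le hθ'.le).trans (le_of_eq ?_)
      rw [← Real.rpow_mul hq.le, one_div_mul_cancel hθ'.ne', Real.rpow_one]
    rw [e1, mul_assoc C]
    exact mul_le_mul_of_nonneg_left (mul_le_mul_of_nonneg_right e2 hnn) hC
  refine (norm_sum_le_of_le _ hterm).trans_lt ?_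
  rw [← Finset.mul_sum, Finset.sum_range_sub (fun j => (p j : ℝ)) N]
  have h1 : (p N : ℝ) - p 0 ≤ 1 := by linarith [(p N).2.2, (p 0).2.1]
  have h2 : C * (ε / (C + 1)) * ((p N : ℝ) - p 0) ≤ C * (ε / (C + 1)) := by
    have : 0 ≤ C * (ε / (C + 1)) := by positivity
    nlinarith
  refine h2.trans_lt ?_
  rw [← mul_div_assoc, div_lt_iff₀ hC1]
  nlinarith

end Sewing

/-! ### The rough integral of a controlled rough path -/

section Pairing

variable {V : Type*} [NormedAddCommGroup V] [InnerProductSpace ℝ V]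
variable {E : Type*} [NormedAddCommGroup E] [NormedSpace ℝ E]
variable {E' : Type*} [NormedAddCommGroup E'] [NormedSpace ℝ E']

@[simp]
lemma pairing_tmul (B : V →L[ℝ] V →L[ℝ] E) (v w : V) : pairing B (v ⊗ₜ[ℝ] w) = B v w := by
  simp [pairing]

lemma pairing_sub (B B' : V →L[ℝ] V →L[ℝ] E) (x : V ⊗[ℝ] V) :
    pairing (B - B') x = pairing B x - pairing B' x := by
  induction x using TensorProduct.induction_on with
  | zero => simp
  | tmul v w => simp
  | add x y hx hy => rw [map_add, map_add, map_add, hx, hy]; abel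

lemma pairing_compL (L : E →L[ℝ] E') (B : V →L[ℝ] V →L[ℝ] E) (x : V ⊗[ℝ] V) :
    pairing ((ContinuousLinearMap.compL ℝ V E E' L).comp B) x = L (pairing B x) := by
  induction x using TensorProduct.induction_on with
  | zero => simp
  | tmul v w => simp
  | add x y hx hy => rw [map_add, map_add, map_add, hx, hy]

/-- A bound for the pairing of `L(V, L(V, E))` with `V ⊗ V`. -/
def pairingConst (V : Type*) [NormedAddCommGroup V] [InnerProductSpace ℝ V]
    [FiniteDimensional ℝ V] : ℝ :=
  ∑ p : Fin (Module.finrank ℝ V) × Fin (Module.finrank ℝ V),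
    ‖LinearMap.toContinuousLinearMap
      (((Module.finBasis ℝ V).tensorProduct (Module.finBasis ℝ V)).coord p)‖
      * (‖Module.finBasis ℝ V p.1‖ * ‖Module.finBasis ℝ V p.2‖)

variable [FiniteDimensional ℝ V]

lemma pairingConst_nonneg : 0 ≤ pairingConst V := Finset.sum_nonneg fun _ _ => by positivity

lemma norm_pairing_le (B : V →L[ℝ] V →L[ℝ] E) (x : V ⊗[ℝ] V) :
    ‖pairing B x‖ ≤ pairingConst V * ‖B‖ * ‖x‖ := by
  set b := (Module.finBasis ℝ V).tensorProduct (Module.finBasis ℝ V) with hb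
  have hx : pairing B x = ∑ p, b.coord p x • pairing B (b p) := by
    conv_lhs => rw [← b.sum_repr x, map_sum]
    simp only [map_smul, Module.Basis.coord_apply]
  rw [hx, pairingConst, Finset.sum_mul, Finset.sum_mul]
  refine norm_sum_le_of_le _ fun p _ => ?_
  have h1 : ‖b.coord p x‖ ≤ ‖LinearMap.toContinuousLinearMap (b.coord p)‖ * ‖x‖ :=
    (LinearMap.toContinuousLinearMap (b.coord p)).le_opNorm x
  have h2 : ‖pairing B (b p)‖ ≤ ‖B‖ * ‖Module.finBasis ℝ V p.1‖ * ‖Module.finBasis ℝ V p.2‖ := by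
    rw [hb, Module.Basis.tensorProduct_apply, pairing_tmul]
    exact B.le_opNorm₂ _ _
  rw [norm_smul]
  refine (mul_le_mul h1 h2 (norm_nonneg _) (by positivity)).trans (le_of_eq ?_)
  ring

end Pairing

section Integral

variable {V : Type*} [NormedAddCommGroup V] [InnerProductSpace ℝ V] {α : ℝ}
variable {E : Type*} [NormedAddCommGroup E] [NormedSpace ℝ E]
variable {E' : Type*} [NormedAddCommGroup E'] [NormedSpace ℝ E']
variable {𝓦 : RoughPath V α} {Z Z' : PathPair V (V →L[ℝ] E)} {c : ℝ}

/-- The local approximation `Z_s W_{s,t} + Z'_s 𝕎_{s,t}` of the rough integral. -/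
def germ (𝓦 : RoughPath V α) (Z : PathPair V (V →L[ℝ] E)) (s t : I) : E :=
  Z.1 s (𝓦.path t - 𝓦.path s) + pairing (Z.2 s) (𝓦.area s t)

lemma RoughPath.area_self (hα : 0 < α) (𝓦 : RoughPath V α) (s : I) : 𝓦.area s s = 0 := by
  have := 𝓦.norm_area_le (le_refl s)
  rw [sub_self, Real.zero_rpow (by positivity), mul_zero] at this
  exact norm_le_zero_iff.1 this

lemma germ_self (hα : 0 < α) (s : I) : germ 𝓦 Z s s = 0 := by
  simp [germ, 𝓦.area_self hα]

lemma germ_sub (𝓦 : RoughPath V α) (Z Z' : PathPair V (V →L[ℝ] E)) (s t : I) :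
    germ 𝓦 (Z - Z') s t = germ 𝓦 Z s t - germ 𝓦 Z' s t := by
  simp only [germ, Prod.fst_sub, Prod.snd_sub, Pi.sub_apply, sub_apply,
    pairing_sub]
  abel

lemma germ_compL (L : E →L[ℝ] E') (s t : I) :
    germ 𝓦 (opMul (fun _ => ContinuousLinearMap.compL ℝ V E E' L) Z) s t = L (germ 𝓦 Z s t) := by
  simp [germ, opMul, pairing_compL]

lemma germ_defect {s u t : I} (hsu : s ≤ u) (hut : u ≤ t) :
    germ 𝓦 Z s t - germ 𝓦 Z s u - germ 𝓦 Z u t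
      = -(remainder 𝓦 Z s u (𝓦.path t - 𝓦.path u)
          + pairing (Z.2 u - Z.2 s) (𝓦.area u t)) := by
  have h : 𝓦.area s t
      = 𝓦.area s u + 𝓦.area u t + (𝓦.path u - 𝓦.path s) ⊗ₜ[ℝ] (𝓦.path t - 𝓦.path u) := by
    rw [← 𝓦.chen s u t hsu hut]; abel
  simp only [germ, h, pairing_sub, map_add, pairing_tmul, remainder, map_sub,
    sub_apply]
  abel

lemma IsRoughIntegral.map {a b : I} {J : E} (h : IsRoughIntegral 𝓦 Z a b J) (L : E →L[ℝ] E') :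
    IsRoughIntegral 𝓦 (opMul (fun _ => ContinuousLinearMap.compL ℝ V E E' L) Z) a b (L J) := by
  intro ε hε
  obtain ⟨δ, hδ, H⟩ := h (ε / (‖L‖ + 1)) (by positivity)
  refine ⟨δ, hδ, fun N p h0 hN hp hm => ?_⟩
  have h1 := H N p h0 hN hp hm
  change ‖(∑ j ∈ Finset.range N, germ 𝓦 _ (p j) (p (j + 1))) - L J‖ < ε
  change ‖(∑ j ∈ Finset.range N, germ 𝓦 Z (p j) (p (j + 1))) - J‖ < _ at h1
  simp only [germ_compL]
  rw [← map_sum, ← map_sub]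
  have hL : 0 < ‖L‖ + 1 := by positivity
  rw [lt_div_iff₀ hL] at h1
  refine (L.le_opNorm _).trans_lt (lt_of_le_of_lt ?_ h1)
  have := norm_nonneg ((∑ j ∈ Finset.range N, germ 𝓦 Z (p j) (p (j + 1))) - J)
  linarith

lemma IsRoughIntegral.sub {a b : I} {J J' : E} (h : IsRoughIntegral 𝓦 Z a b J)
    (h' : IsRoughIntegral 𝓦 Z' a b J') : IsRoughIntegral 𝓦 (Z - Z') a b (J - J') := by
  intro ε hε
  obtain ⟨δ, hδ, H⟩ := h (ε / 2) (by positivity)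
  obtain ⟨δ', hδ', H'⟩ := h' (ε / 2) (by positivity)
  refine ⟨min δ δ', lt_min hδ hδ', fun N p h0 hN hp hm => ?_⟩
  have h1 := H N p h0 hN hp fun j hj => (hm j hj).trans_le (min_le_left _ _)
  have h2 := H' N p h0 hN hp fun j hj => (hm j hj).trans_le (min_le_right _ _)
  change ‖(∑ j ∈ Finset.range N, germ 𝓦 _ (p j) (p (j + 1))) - _‖ < ε
  change ‖(∑ j ∈ Finset.range N, germ 𝓦 Z (p j) (p (j + 1))) - J‖ < _ at h1
  change ‖(∑ j ∈ Finset.range N, germ 𝓦 Z' (p j) (p (j + 1))) - J'‖ < _ at h2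
  simp only [germ_sub]
  rw [Finset.sum_sub_distrib, sub_sub_sub_comm]
  linarith [norm_sub_le ((∑ j ∈ Finset.range N, germ 𝓦 Z (p j) (p (j + 1))) - J)
    ((∑ j ∈ Finset.range N, germ 𝓦 Z' (p j) (p (j + 1))) - J')]

lemma exists_partition (a b : I) (hab : a ≤ b) {δ : ℝ} (hδ : 0 < δ) :
    ∃ (N : ℕ) (p : ℕ → I), p 0 = a ∧ p N = b ∧ (∀ j < N, p j ≤ p (j + 1)) ∧
      ∀ j < N, (p (j + 1) : ℝ) - p j < δ := by
  obtain ⟨n, hn⟩ := exists_pow_lt_of_lt_one hδ (by norm_num : (1 / 2 : ℝ) < 1)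
  refine ⟨2 ^ n, fun k => clamp a b (dyadicGrid n k), ?_, ?_,
    fun j _ => clamp_mono a b (dyadicGrid_mono n (Nat.le_succ j)),
    fun j _ => (clamp_dyadicGrid_sub_le a b n j).trans_lt hn⟩
  · simp only [dyadicGrid_zero]
    rw [clamp, min_eq_left (show (0 : I) ≤ b from b.2.1)]
    exact max_eq_left a.2.1
  · simp only [dyadicGrid_last]
    rw [clamp, min_eq_right (show b ≤ (1 : I) from b.2.2), max_eq_right hab]

lemma IsRoughIntegral.unique {a b : I} (hab : a ≤ b) {J J' : E} (h : IsRoughIntegral 𝓦 Z a b J)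
    (h' : IsRoughIntegral 𝓦 Z a b J') : J = J' := by
  by_contra hne
  have hpos : 0 < ‖J - J'‖ := norm_pos_iff.2 (sub_ne_zero.2 hne)
  obtain ⟨δ, hδ, H⟩ := h (‖J - J'‖ / 2) (by positivity)
  obtain ⟨δ', hδ', H'⟩ := h' (‖J - J'‖ / 2) (by positivity)
  obtain ⟨N, p, h0, hN, hp, hm⟩ := exists_partition a b hab (lt_min hδ hδ')
  have h1 := H N p h0 hN hp fun j hj => (hm j hj).trans_le (min_le_left _ _)
  have h2 := H' N p h0 hN hp fun j hj => (hm j hj).trans_le (min_le_right _ _)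
  rw [norm_sub_rev] at h1
  have h3 := (norm_add_le _ _).trans_lt (add_lt_add h1 h2)
  rw [sub_add_sub_cancel] at h3
  linarith

lemma IsRoughIntegral.roughIntegral_eq {a b : I} (hab : a ≤ b) {J : E}
    (h : IsRoughIntegral 𝓦 Z a b J) : roughIntegral 𝓦 Z a b = J :=
  (Classical.epsilon_spec (p := IsRoughIntegral 𝓦 Z a b) ⟨J, h⟩).unique hab h

variable [FiniteDimensional ℝ V]

lemma norm_germ_defect_le (hα : 0 < α) (hZ : ControlledBy 𝓦 Z c) {s u t : I} (hsu : s ≤ u)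
    (hut : u ≤ t) : ‖germ 𝓦 Z s t - germ 𝓦 Z s u - germ 𝓦 Z u t‖
      ≤ c * (𝓦.pathSeminorm + pairingConst V * 𝓦.areaSeminorm) * ((t : ℝ) - s) ^ (3 * α) := by
  have hsu' : (s : ℝ) ≤ u := hsu
  have hut' : (u : ℝ) ≤ t := hut
  have ha := 𝓦.pathSeminorm_nonneg
  have hb := 𝓦.areaSeminorm_nonneg
  have hP := pairingConst_nonneg (V := V)
  have hc := hZ.nonneg
  set τ := (t : ℝ) - s with hτ
  have hτ0 : 0 ≤ τ := by rw [hτ]; linarith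
  have e1 (q : ℝ) (hq : 0 ≤ q) : ((u : ℝ) - s) ^ q ≤ τ ^ q :=
    Real.rpow_le_rpow (by linarith) (by rw [hτ]; linarith) hq
  have e2 (q : ℝ) (hq : 0 ≤ q) : ((t : ℝ) - u) ^ q ≤ τ ^ q :=
    Real.rpow_le_rpow (by linarith) (by rw [hτ]; linarith) hq
  have e3 : τ ^ (3 * α) = τ ^ (2 * α) * τ ^ α := by
    rw [← Real.rpow_add_of_nonneg hτ0 (by positivity) hα.le]; ring_nf
  have h1 : ‖remainder 𝓦 Z s u (𝓦.path t - 𝓦.path u)‖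
      ≤ c * τ ^ (2 * α) * (𝓦.pathSeminorm * τ ^ α) :=
    (remainder 𝓦 Z s u).le_of_opNorm_le_of_le
      ((hZ.remainder s u hsu).trans (mul_le_mul_of_nonneg_left (e1 _ (by positivity)) hc))
      ((𝓦.norm_path_sub_le hut).trans (mul_le_mul_of_nonneg_left (e2 _ hα.le) ha))
  have h2 : ‖pairing (Z.2 u - Z.2 s) (𝓦.area u t)‖
      ≤ pairingConst V * (c * τ ^ α) * (𝓦.areaSeminorm * τ ^ (2 * α)) := by
    refine (norm_pairing_le _ _).trans (mul_le_mul (mul_le_mul_of_nonneg_left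
      ((hZ.deriv_incr s u hsu).trans (mul_le_mul_of_nonneg_left (e1 _ hα.le) hc)) hP)
      ((𝓦.norm_area_le hut).trans (mul_le_mul_of_nonneg_left (e2 _ (by positivity)) hb))
      (norm_nonneg _) (by positivity))
  rw [germ_defect hsu hut, norm_neg]
  refine (norm_add_le_of_le h1 h2).trans (le_of_eq ?_)
  rw [e3]
  ring

variable [CompleteSpace E]

theorem IsControlled.exists_roughIntegral (hα : 1 / 3 < α) (hZ : IsControlled 𝓦 Z) :
    ∃ Φ : I → I → E, (∀ s u t, s ≤ u → u ≤ t → Φ s t = Φ s u + Φ u t) ∧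
      (∀ c, ControlledBy 𝓦 Z c → ∀ s t, s ≤ t → ‖Φ s t - germ 𝓦 Z s t‖
        ≤ sewingConst (3 * α) * (c * (𝓦.pathSeminorm + pairingConst V * 𝓦.areaSeminorm))
          * ((t : ℝ) - s) ^ (3 * α)) ∧
      ∀ a b, IsRoughIntegral 𝓦 Z a b (Φ a b) := by
  have hα0 : 0 < α := by linarith
  have hθ : 1 < 3 * α := by linarith
  have ha := 𝓦.pathSeminorm_nonneg
  have hb := 𝓦.areaSeminorm_nonneg
  have hP := pairingConst_nonneg (V := V)
  have key (c : ℝ) (hc : ControlledBy 𝓦 Z c) : ∃ Φ : I → I → E,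
      (∀ s u t, s ≤ u → u ≤ t → Φ s t = Φ s u + Φ u t) ∧
      (∀ s t, s ≤ t → ‖Φ s t - germ 𝓦 Z s t‖
        ≤ sewingConst (3 * α) * (c * (𝓦.pathSeminorm + pairingConst V * 𝓦.areaSeminorm))
          * ((t : ℝ) - s) ^ (3 * α)) ∧
      ∀ a b, IsRoughIntegral 𝓦 Z a b (Φ a b) := by
    have hc0 := hc.nonneg
    obtain ⟨Φ, h1, h2⟩ := exists_sewing (A := germ 𝓦 Z) hθ
      (by positivity : 0 ≤ c * (𝓦.pathSeminorm + pairingConst V * 𝓦.areaSeminorm))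
      (germ_self hα0) (fun s u t hsu hut => norm_germ_defect_le hα0 hc hsu hut)
    have := (sewingConst_pos hθ).le
    exact ⟨Φ, h1, h2, fun a b ε hε => riemann_sums_tendsto hθ (by positivity) h1 h2 a b hε⟩
  obtain ⟨Φ, h1, -, h3⟩ := key _ (hZ.controlledBy hα0)
  refine ⟨Φ, h1, fun c hc s t hst => ?_, h3⟩
  obtain ⟨Ψ, -, g2, g3⟩ := key c hc
  rw [(h3 s t).unique hst (g3 s t)]
  exact g2 s t hst

lemma IsControlled.isRoughIntegral (hα : 1 / 3 < α) (hZ : IsControlled 𝓦 Z) {a b : I}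
    (hab : a ≤ b) : IsRoughIntegral 𝓦 Z a b (roughIntegral 𝓦 Z a b) := by
  obtain ⟨Φ, -, -, h⟩ := hZ.exists_roughIntegral hα
  rw [(h a b).roughIntegral_eq hab]
  exact h a b

lemma IsControlled.roughIntegral_add_adjacent (hα : 1 / 3 < α) (hZ : IsControlled 𝓦 Z)
    {s u t : I} (hsu : s ≤ u) (hut : u ≤ t) :
    roughIntegral 𝓦 Z s t = roughIntegral 𝓦 Z s u + roughIntegral 𝓦 Z u t := by
  obtain ⟨Φ, h1, -, h⟩ := hZ.exists_roughIntegral hα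
  rw [(h s t).roughIntegral_eq (hsu.trans hut), (h s u).roughIntegral_eq hsu,
    (h u t).roughIntegral_eq hut, h1 s u t hsu hut]

lemma IsControlled.roughIntegral_sub (hα : 1 / 3 < α) (hZ : IsControlled 𝓦 Z)
    (hZ' : IsControlled 𝓦 Z') {a b : I} (hab : a ≤ b) :
    roughIntegral 𝓦 (Z - Z') a b = roughIntegral 𝓦 Z a b - roughIntegral 𝓦 Z' a b :=
  ((hZ.isRoughIntegral hα hab).sub (hZ'.isRoughIntegral hα hab)).roughIntegral_eq hab

lemma IsControlled.roughIntegral_compL (hα : 1 / 3 < α) (hZ : IsControlled 𝓦 Z)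
    (L : E →L[ℝ] E') {a b : I} (hab : a ≤ b) :
    roughIntegral 𝓦 (opMul (fun _ => ContinuousLinearMap.compL ℝ V E E' L) Z) a b
      = L (roughIntegral 𝓦 Z a b) :=
  ((hZ.isRoughIntegral hα hab).map L).roughIntegral_eq hab

lemma IsControlled.roughIntegral_self (hα : 1 / 3 < α) (hZ : IsControlled 𝓦 Z) (s : I) :
    roughIntegral 𝓦 Z s s = 0 := by
  have := hZ.roughIntegral_add_adjacent hα (le_refl s) (le_refl s)
  simpa using this

/-- The constant in the bound for the indefinite rough integral. -/
def integralConst (V : Type*) [NormedAddCommGroup V] [InnerProductSpace ℝ V]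
    [FiniteDimensional ℝ V] (α : ℝ) : ℝ := (1 + sewingConst (3 * α)) * (1 + pairingConst V)

lemma one_le_integralConst (hα : 1 / 3 < α) : 1 ≤ integralConst V α := by
  have h1 := sewingConst_pos (θ := 3 * α) (by linarith)
  have h2 := pairingConst_nonneg (V := V)
  unfold integralConst
  nlinarith

/-- The indefinite rough integral is a controlled rough path. -/
theorem ControlledBy.indefiniteIntegral (hα : 1 / 3 < α) (hZ : ControlledBy 𝓦 Z c) :
    ControlledBy 𝓦 ((fun t => roughIntegral 𝓦 Z 0 t, Z.1) : PathPair V E)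
      (integralConst V α * (1 + 𝓦.pathSeminorm + 𝓦.areaSeminorm) * c) := by
  have hα0 : 0 < α := by linarith
  have hc := hZ.nonneg
  have hZ' := hZ.isControlled hα0
  obtain ⟨Φ, h1, h2, h3⟩ := hZ'.exists_roughIntegral hα
  have h2 := h2 c hZ
  have ha := 𝓦.pathSeminorm_nonneg
  have hb := 𝓦.areaSeminorm_nonneg
  have hP := pairingConst_nonneg (V := V)
  have hS := (sewingConst_pos (θ := 3 * α) (by linarith)).le
  set a := 𝓦.pathSeminorm
  set b := 𝓦.areaSeminorm
  set P := pairingConst V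
  set S := sewingConst (3 * α)
  set B := integralConst V α * (1 + a + b) * c with hB
  have hΦ (t : I) : roughIntegral 𝓦 Z 0 t = Φ 0 t :=
    (h3 0 t).roughIntegral_eq (show (0 : I) ≤ t from t.2.1)
  have hBexp : B = (1 + S) * (1 + P) * (1 + a + b) * c := rfl
  have hcB : c * (1 + a) ≤ B := by
    have : 0 ≤ (1 + S) * (1 + P) * b * c + (S + P + S * P) * (1 + a) * c := by positivity
    rw [hBexp]; linarith
  have hcB' : c ≤ B := by
    refine le_trans ?_ hcB
    have : 0 ≤ c * a := by positivity
    linarith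
  have hmain : S * (c * (a + P * b)) + c * a + P * c * b ≤ B := by
    have : 0 ≤ (1 + S) * c * ((1 + P) + P * a + b) := by positivity
    rw [hBexp]; linarith
  have harea (s t : I) (hst : s ≤ t) : ‖pairing (Z.2 s) (𝓦.area s t)‖
      ≤ P * c * b * ((t : ℝ) - s) ^ (2 * α) := by
    refine (norm_pairing_le _ _).trans ((mul_le_mul (mul_le_mul_of_nonneg_left
      (hZ.deriv_sup s) hP) (𝓦.norm_area_le hst) (norm_nonneg _) (by positivity)).trans
      (le_of_eq (by ring)))
  refine ⟨fun t => ?_, fun t => (hZ.sup t).trans hcB', fun s t hst => ?_, fun s t hst => ?_⟩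
  · have h0t : (0 : I) ≤ t := t.2.1
    have hle1 (q : ℝ) (hq : 0 ≤ q) : ((t : ℝ) - (0 : I)) ^ q ≤ 1 :=
      Real.rpow_le_one (by simpa using t.2.1) (by simpa using t.2.2) hq
    have g1 := (h2 0 t h0t).trans (mul_le_of_le_one_right (by positivity) (hle1 _ (by positivity)))
    have g2 := (harea 0 t h0t).trans
      (mul_le_of_le_one_right (by positivity) (hle1 _ (by positivity)))
    have g3 : ‖Z.1 0 (𝓦.path t - 𝓦.path (0 : I))‖ ≤ c * a :=
      (Z.1 0).le_of_opNorm_le_of_le (hZ.sup 0) ((𝓦.norm_path_sub_le h0t).trans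
        (mul_le_of_le_one_right ha (hle1 _ hα0.le)))
    have e : Φ 0 t = (Φ 0 t - germ 𝓦 Z 0 t) + (Z.1 0 (𝓦.path t - 𝓦.path (0 : I))
        + pairing (Z.2 0) (𝓦.area (0 : I) t)) := by
      simp [germ]
    simp only [hΦ]
    rw [e]
    refine (norm_add_le_of_le g1 (norm_add_le_of_le g3 g2)).trans (le_trans (le_of_eq ?_) hmain)
    ring
  · exact (hZ.norm_incr_le hα0 hst).trans
      (mul_le_mul_of_nonneg_right hcB (sub_rpow_nonneg hst _))
  · have e : RoughCenter.remainder 𝓦 ((fun t => roughIntegral 𝓦 Z 0 t, Z.1) : PathPair V E) s t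
        = (Φ s t - germ 𝓦 Z s t) + pairing (Z.2 s) (𝓦.area s t) := by
      simp only [RoughCenter.remainder, hΦ, germ, h1 0 s t s.2.1 hst]
      abel
    have g1 := (h2 s t hst).trans (mul_le_mul_of_nonneg_left
      (sub_rpow_le_rpow hst (by positivity : 0 < 2 * α) (by linarith : 2 * α ≤ 3 * α))
      (by positivity))
    rw [e]
    refine (norm_add_le_of_le g1 (harea s t hst)).trans ?_
    rw [← add_mul]
    refine mul_le_mul_of_nonneg_right (le_trans ?_ hmain) (sub_rpow_nonneg hst _)
    have : 0 ≤ c * a := by positivity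
    linarith

end Integral

/-! ### Convolutions with a one-parameter group -/

section Group

variable {X : Type*} [NormedAddCommGroup X] [NormedSpace ℝ X]

/-- `S` is a one-parameter group of operators which is bounded and Lipschitz on `[-1,1]`, with
constant `m`. -/
structure IsLipschitzGroup (S : ℝ → X →L[ℝ] X) (m : ℝ) : Prop where
  zero : S 0 = ContinuousLinearMap.id ℝ X
  add : ∀ s t, S (s + t) = S s ∘L S t
  norm_le : ∀ t ∈ Icc (-1 : ℝ) 1, ‖S t‖ ≤ m
  norm_sub_le : ∀ s ∈ Icc (-1 : ℝ) 1, ∀ t ∈ Icc (-1 : ℝ) 1, ‖S t - S s‖ ≤ m * |t - s|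

lemma exists_isLipschitzGroup_expGroup [CompleteSpace X] (B : X →L[ℝ] X) :
    ∃ m, IsLipschitzGroup (expGroup B) m := by
  have hd (t : ℝ) : HasDerivAt (expGroup B) (expGroup B t * B) t :=
    hasDerivAt_exp_smul_const B t
  have hc : Continuous (expGroup B) := continuous_iff_continuousAt.2 fun t => (hd t).continuousAt
  obtain ⟨m₁, h₁⟩ := (isCompact_Icc (a := (-1 : ℝ)) (b := 1)).exists_bound_of_continuousOn
    hc.continuousOn
  obtain ⟨m₂, h₂⟩ := (isCompact_Icc (a := (-1 : ℝ)) (b := 1)).exists_bound_of_continuousOn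
    (hc.mul continuous_const : Continuous fun t => expGroup B t * B).continuousOn
  refine ⟨max m₁ m₂, ?_, fun s t => ?_, fun t ht => (h₁ t ht).trans (le_max_left _ _),
    fun s hs t ht => ?_⟩
  · simp [expGroup]
    rfl
  · unfold expGroup
    rw [add_smul]
    let _ : NormedAlgebra ℚ (X →L[ℝ] X) := NormedAlgebra.restrictScalars ℚ ℝ _
    exact NormedSpace.exp_add_of_commute (((Commute.refl B).smul_left s).smul_right t)
  · have := (convex_Icc (-1 : ℝ) 1).norm_image_sub_le_of_norm_hasDerivWithin_le
      (fun x _ => (hd x).hasDerivWithinAt) (fun x hx => (h₂ x hx).trans (le_max_right m₁ m₂)) hs ht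
    simpa using this

variable {S : ℝ → X →L[ℝ] X} {m : ℝ}

lemma IsLipschitzGroup.nonneg (hS : IsLipschitzGroup S m) : 0 ≤ m :=
  (norm_nonneg _).trans (hS.norm_le 0 (by simp))

lemma IsLipschitzGroup.add_apply (hS : IsLipschitzGroup S m) (s t : ℝ) (x : X) :
    S (s + t) x = S s (S t x) := by rw [hS.add]; rfl

lemma IsLipschitzGroup.neg_cancel (hS : IsLipschitzGroup S m) (t : ℝ) (x : X) :
    S t (S (-t) x) = x := by
  rw [← hS.add_apply, add_neg_cancel, hS.zero]; rfl

lemma IsLipschitzGroup.cancel_neg (hS : IsLipschitzGroup S m) (t : ℝ) (x : X) :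
    S (-t) (S t x) = x := by
  rw [← hS.add_apply, neg_add_cancel, hS.zero]; rfl

lemma IsLipschitzGroup.continuousOn (hS : IsLipschitzGroup S m) :
    ContinuousOn S (Icc (-1) 1) := by
  have : LipschitzOnWith m.toNNReal S (Icc (-1) 1) :=
    LipschitzOnWith.of_dist_le_mul fun s hs t ht => by
      rw [dist_eq_norm, Real.dist_eq, Real.coe_toNNReal _ hS.nonneg]
      exact hS.norm_sub_le t ht s hs
  exact this.continuousOn

lemma IsLipschitzGroup.commute_all (hS : IsLipschitzGroup S m) {P : X →L[ℝ] X}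
    (h : ∀ t, 0 ≤ t → P ∘L S t = S t ∘L P) (t : ℝ) (x : X) : P (S t x) = S t (P x) := by
  have h' (t : ℝ) (ht : 0 ≤ t) (x : X) : P (S t x) = S t (P x) := congrArg (fun L => L x) (h t ht)
  rcases le_total 0 t with ht | ht
  · exact h' t ht x
  · have h1 := h' (-t) (by linarith) (S t x)
    rw [hS.cancel_neg] at h1
    rw [h1, hS.neg_cancel]

end Group

section Convolution

variable {V : Type*} [NormedAddCommGroup V] [InnerProductSpace ℝ V] {α : ℝ}
variable {X : Type*} [NormedAddCommGroup X] [NormedSpace ℝ X]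
variable {S : ℝ → X →L[ℝ] X} {m : ℝ} {P : X →L[ℝ] X} {𝓦 : RoughPath V α}
variable {y y' : I → X} {Z Z' : PathPair V (V →L[ℝ] X)} {c c' : ℝ}

/-- `∫_a^b S(c - r) P y_r dr + ∫_a^b S(c - r) P Z_r d𝓦_r`. -/
def pathConvolution (S : ℝ → X →L[ℝ] X) (P : X →L[ℝ] X) (𝓦 : RoughPath V α) (y : I → X)
    (Z : PathPair V (V →L[ℝ] X)) (a b : I) (c : ℝ) : X :=
  (∫ r in (a : ℝ)..b, S (c - r) (P (IccExtend zero_le_one y r)))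
    + roughIntegral 𝓦 (convolved S P c Z) a b

lemma convolved_eq_opMul (S : ℝ → X →L[ℝ] X) (P : X →L[ℝ] X) (c : ℝ)
    (Z : PathPair V (V →L[ℝ] X)) : convolved S P c Z
      = opMul (fun r : I => ContinuousLinearMap.compL ℝ V X X (S (c - r) ∘L P)) Z := rfl

lemma convolved_shift (hS : IsLipschitzGroup S m) (P : X →L[ℝ] X) (c : ℝ)
    (Z : PathPair V (V →L[ℝ] X)) : convolved S P c Z
      = opMul (fun _ => ContinuousLinearMap.compL ℝ V X X (S c)) (convolved S P 0 Z) := by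
  have h (r : ℝ) (x : X) : S (c - r) x = S c (S (0 - r) x) := by
    rw [← hS.add_apply]; congr 2; ring
  ext <;> simp [convolved, opMul, h]

lemma convolved_proj (hP : ∀ x, P (P x) = P x) (hPS : ∀ t x, P (S t x) = S t (P x)) (c : ℝ)
    (Z : PathPair V (V →L[ℝ] X)) :
    opMul (fun _ => ContinuousLinearMap.compL ℝ V X X P) (convolved S P c Z)
      = convolved S P c Z := by
  ext <;> simp [convolved, opMul, hP, hPS]

lemma ControlledBy.convolved (hα : 0 < α) (hα2 : α ≤ 1 / 2) (hS : IsLipschitzGroup S m)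
    (P : X →L[ℝ] X) (hZ : ControlledBy 𝓦 Z c) :
    ControlledBy 𝓦 (convolved S P 0 Z) (2 * (m * ‖P‖) * c) := by
  have hm := hS.nonneg
  have hbd (L : X →L[ℝ] X) : ‖ContinuousLinearMap.compL ℝ V X X L‖ ≤ ‖L‖ :=
    ContinuousLinearMap.opNorm_le_bound _ (norm_nonneg _)
      fun T => ContinuousLinearMap.opNorm_comp_le L T
  have hmem (r : I) : (0 - (r : ℝ)) ∈ Icc (-1 : ℝ) 1 :=
    ⟨by linarith [r.2.2], by linarith [r.2.1]⟩
  rw [convolved_eq_opMul]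
  refine hZ.opMul hα hα2 (fun t => ?_) (fun s t hst => ?_)
  · exact (hbd _).trans ((ContinuousLinearMap.opNorm_comp_le _ _).trans
      (mul_le_mul_of_nonneg_right (hS.norm_le _ (hmem t)) (norm_nonneg _)))
  · rw [← map_sub, ← ContinuousLinearMap.sub_comp]
    have h := hS.norm_sub_le _ (hmem s) _ (hmem t)
    have hst' : (s : ℝ) ≤ t := hst
    have e : |0 - (t : ℝ) - (0 - s)| = (t : ℝ) - s := by
      rw [show 0 - (t : ℝ) - (0 - s) = -((t : ℝ) - s) by ring, abs_neg, abs_of_nonneg (by linarith)]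
    rw [e] at h
    refine (hbd _).trans ((ContinuousLinearMap.opNorm_comp_le _ _).trans
      ((mul_le_mul_of_nonneg_right h (norm_nonneg _)).trans (le_of_eq (by ring))))

lemma convolved_sub (S : ℝ → X →L[ℝ] X) (P : X →L[ℝ] X) (c : ℝ)
    (Z Z' : PathPair V (V →L[ℝ] X)) :
    convolved S P c (Z - Z') = convolved S P c Z - convolved S P c Z' := by
  simp only [convolved_eq_opMul, opMul_sub]

lemma continuous_driftIntegrand (hS : IsLipschitzGroup S m) (P : X →L[ℝ] X) (hy : Continuous y) :
    ContinuousOn (fun r : ℝ => S (0 - r) (P (IccExtend zero_le_one y r))) (Icc 0 1) := by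
  have h1 : Continuous (IccExtend (zero_le_one (α := ℝ)) y) := hy.Icc_extend'
  have h2 : ContinuousOn (fun r : ℝ => S (0 - r)) (Icc 0 1) :=
    hS.continuousOn.comp (by fun_prop) fun r hr => ⟨by linarith [hr.2], by linarith [hr.1]⟩
  exact h2.clm_apply (P.continuous.comp h1).continuousOn

lemma intervalIntegrable_drift (hS : IsLipschitzGroup S m) (P : X →L[ℝ] X) (hy : Continuous y)
    (a b : I) : IntervalIntegrable (fun r : ℝ => S (0 - r) (P (IccExtend zero_le_one y r)))
      MeasureTheory.volume a b :=
  ((continuous_driftIntegrand hS P hy).mono (uIcc_subset_Icc a.2 b.2)).intervalIntegrable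

variable [FiniteDimensional ℝ V] [CompleteSpace X]

lemma pathConvolution_zero_self (hα : 1 / 3 < α) (hα2 : α ≤ 1 / 2) (hS : IsLipschitzGroup S m)
    (P : X →L[ℝ] X) (hZ : IsControlled 𝓦 Z) (a : I) : pathConvolution S P 𝓦 y Z a a 0 = 0 := by
  have hα0 : 0 < α := by linarith
  have hcZ := (((hZ.controlledBy hα0).convolved hα0 hα2 hS P)).isControlled hα0
  simp [pathConvolution, hcZ.roughIntegral_self hα]

lemma IsControlled.isRoughIntegral_convolved (hα : 1 / 3 < α) (hα2 : α ≤ 1 / 2)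
    (hS : IsLipschitzGroup S m) (P : X →L[ℝ] X) (hZ : IsControlled 𝓦 Z) {a b : I} (hab : a ≤ b)
    (c : ℝ) : IsRoughIntegral 𝓦 (RoughCenter.convolved S P c Z) a b
      (S c (roughIntegral 𝓦 (RoughCenter.convolved S P 0 Z) a b)) := by
  have hα0 : 0 < α := by linarith
  have hcZ := (((hZ.controlledBy hα0).convolved hα0 hα2 hS P)).isControlled hα0
  rw [convolved_shift hS P c]
  exact (hcZ.isRoughIntegral hα hab).map (S c)

/-- Every convolution is an increment of the basic one, moved by the group. -/
lemma pathConvolution_eq (hα : 1 / 3 < α) (hα2 : α ≤ 1 / 2) (hS : IsLipschitzGroup S m)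
    (P : X →L[ℝ] X) (hy : Continuous y) (hZ : IsControlled 𝓦 Z) {a b : I} (hab : a ≤ b) (c : ℝ) :
    pathConvolution S P 𝓦 y Z a b c
      = S c (pathConvolution S P 𝓦 y Z 0 b 0 - pathConvolution S P 𝓦 y Z 0 a 0) := by
  have hα0 : 0 < α := by linarith
  have hcZ := (((hZ.controlledBy hα0).convolved hα0 hα2 hS P)).isControlled hα0
  have h1 := hcZ.roughIntegral_add_adjacent hα (show (0 : I) ≤ a from a.2.1) hab
  have h2 := intervalIntegral.integral_add_adjacent_intervals
    (intervalIntegrable_drift hS P hy 0 a) (intervalIntegrable_drift hS P hy a b)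
  have h3 : (∫ r in (a : ℝ)..b, S (c - r) (P (IccExtend zero_le_one y r)))
      = S c (∫ r in (a : ℝ)..b, S (0 - r) (P (IccExtend zero_le_one y r))) := by
    rw [← ContinuousLinearMap.intervalIntegral_comp_comm _ (intervalIntegrable_drift hS P hy a b)]
    refine intervalIntegral.integral_congr fun r _ => ?_
    change S (c - r) _ = S c (S (0 - r) _)
    rw [← hS.add_apply]
    congr 2; ring
  simp only [pathConvolution]
  rw [(hZ.isRoughIntegral_convolved hα hα2 hS P hab c).roughIntegral_eq hab, h1, h3, ← h2,
    ← map_add]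
  congr 1
  abel

lemma proj_pathConvolution (hα : 1 / 3 < α) (hα2 : α ≤ 1 / 2) (hS : IsLipschitzGroup S m)
    (hP : ∀ x, P (P x) = P x) (hPS : ∀ t x, P (S t x) = S t (P x)) (hy : Continuous y)
    (hZ : IsControlled 𝓦 Z) (t : I) :
    P (pathConvolution S P 𝓦 y Z 0 t 0) = pathConvolution S P 𝓦 y Z 0 t 0 := by
  have hα0 : 0 < α := by linarith
  have hcZ := (((hZ.controlledBy hα0).convolved hα0 hα2 hS P)).isControlled hα0
  have h0t : (0 : I) ≤ t := t.2.1
  have h1 := hcZ.roughIntegral_compL hα P h0t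
  rw [convolved_proj hP hPS] at h1
  have h2 := ContinuousLinearMap.intervalIntegral_comp_comm P (intervalIntegrable_drift hS P hy 0 t)
  simp only [hPS, hP] at h2
  rw [pathConvolution, map_add, ← h1, ← h2]

lemma pathConvolution_sub (hα : 1 / 3 < α) (hα2 : α ≤ 1 / 2) (hS : IsLipschitzGroup S m)
    (P : X →L[ℝ] X) (hy : Continuous y) (hy' : Continuous y') (hZ : IsControlled 𝓦 Z)
    (hZ' : IsControlled 𝓦 Z') (t : I) :
    pathConvolution S P 𝓦 (y - y') (Z - Z') 0 t 0
      = pathConvolution S P 𝓦 y Z 0 t 0 - pathConvolution S P 𝓦 y' Z' 0 t 0 := by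
  have hα0 : 0 < α := by linarith
  have hcZ := (((hZ.controlledBy hα0).convolved hα0 hα2 hS P)).isControlled hα0
  have hcZ' := (((hZ'.controlledBy hα0).convolved hα0 hα2 hS P)).isControlled hα0
  have h0t : (0 : I) ≤ t := t.2.1
  have h1 := hcZ.roughIntegral_sub hα hcZ' h0t
  have h2 := intervalIntegral.integral_sub
    (intervalIntegrable_drift hS P hy 0 t) (intervalIntegrable_drift hS P hy' 0 t)
  have h3 (r : ℝ) : IccExtend zero_le_one (y - y') r
      = IccExtend zero_le_one y r - IccExtend zero_le_one y' r := rfl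
  simp only [pathConvolution, convolved_sub, h1, h3, map_sub, h2]
  abel

/-- The basic convolution is a controlled rough path. -/
theorem controlledBy_pathConvolution (hα : 1 / 3 < α) (hα2 : α ≤ 1 / 2)
    (hS : IsLipschitzGroup S m) (P : X →L[ℝ] X) (hy : Continuous y) (hyc : ∀ t, ‖y t‖ ≤ c)
    (hZ : ControlledBy 𝓦 Z c') :
    ControlledBy 𝓦 ((fun t => pathConvolution S P 𝓦 y Z 0 t 0,
        fun t => (S (0 - (t : ℝ)) ∘L P) ∘L Z.1 t) : PathPair V X)
      (m * ‖P‖ * (c + 2 * integralConst V α * (1 + 𝓦.pathSeminorm + 𝓦.areaSeminorm) * c')) := by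
  have hα0 : 0 < α := by linarith
  have hm := hS.nonneg
  have hc : 0 ≤ c := (norm_nonneg _).trans (hyc 0)
  have hbd (r : ℝ) (hr : r ∈ Icc (0 : ℝ) 1) :
      ‖S (0 - r) (P (IccExtend zero_le_one y r))‖ ≤ m * ‖P‖ * c := by
    have h1 := (S (0 - r)).le_of_opNorm_le_of_le
      (hS.norm_le (0 - r) ⟨by linarith [hr.2], by linarith [hr.1]⟩)
      (P.le_of_opNorm_le_of_le le_rfl (hyc (projIcc 0 1 zero_le_one r)))
    rw [mul_assoc]
    exact h1
  have hint (s t : I) (hst : s ≤ t) :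
      ‖∫ r in (s : ℝ)..t, S (0 - r) (P (IccExtend zero_le_one y r))‖
        ≤ m * ‖P‖ * c * ((t : ℝ) - s) := by
    have hst' : (s : ℝ) ≤ t := hst
    have := intervalIntegral.norm_integral_le_of_norm_le_const (a := (s : ℝ)) (b := t)
      (f := fun r => S (0 - r) (P (IccExtend zero_le_one y r))) (C := m * ‖P‖ * c)
      fun r hr => by
        rw [uIoc_of_le hst'] at hr
        exact hbd r ⟨s.2.1.trans hr.1.le, hr.2.trans t.2.2⟩
    rwa [abs_of_nonneg (sub_nonneg.2 hst')] at this
  have h1 : ControlledBy 𝓦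
      ((fun t : I => ∫ r in ((0 : I) : ℝ)..t, S (0 - r) (P (IccExtend zero_le_one y r)), 0) :
        PathPair V X) (m * ‖P‖ * c) := by
    refine controlledBy_of_lipschitz hα0 hα2 (fun t => ?_) (fun s t hst => ?_)
    · refine (hint 0 t t.2.1).trans (mul_le_of_le_one_right (by positivity) ?_)
      simpa using t.2.2
    · rw [intervalIntegral.integral_interval_sub_left (intervalIntegrable_drift hS P hy 0 t)
        (intervalIntegrable_drift hS P hy 0 s)]
      exact hint s t hst
  have h2 := (hZ.convolved hα0 hα2 hS P).indefiniteIntegral hα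
  have h3 := h1.add h2
  have e : m * ‖P‖ * c + integralConst V α * (1 + 𝓦.pathSeminorm + 𝓦.areaSeminorm)
        * (2 * (m * ‖P‖) * c')
      = m * ‖P‖ * (c + 2 * integralConst V α * (1 + 𝓦.pathSeminorm + 𝓦.areaSeminorm) * c') := by
    ring
  rw [e] at h3
  convert h3 using 1
  ext <;> simp [pathConvolution, convolved]

end Convolution

/-! ### Composition with a map that vanishes to third order at the origin -/

section Composition

variable {X : Type*} [NormedAddCommGroup X] [NormedSpace ℝ X]
variable {E : Type*} [NormedAddCommGroup E] [NormedSpace ℝ E]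

/-- `G` has first and second derivatives `D` and `D₂`, all vanishing at the origin, and `D₂` is
Lipschitz with constant `M`. -/
structure IsCubicFlat (G : X → E) (D : X → X →L[ℝ] E) (D₂ : X → X →L[ℝ] X →L[ℝ] E) (M : ℝ) :
    Prop where
  hasFDerivAt : ∀ x, HasFDerivAt G (D x) x
  hasFDerivAt_deriv : ∀ x, HasFDerivAt D (D₂ x) x
  lipschitz : ∀ x y, ‖D₂ x - D₂ y‖ ≤ M * ‖x - y‖
  zero : G 0 = 0
  deriv_zero : D 0 = 0
  deriv₂_zero : D₂ 0 = 0

variable {G : X → E} {D : X → X →L[ℝ] E} {D₂ : X → X →L[ℝ] X →L[ℝ] E} {M R Δ : ℝ}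
variable {x y x' y' : X}

lemma norm_sub_le_of_iteratedFDeriv_one {H : X → E} (hH : ContDiff ℝ 1 H)
    (hM : ∀ x, ‖iteratedFDeriv ℝ 1 H x‖ ≤ M) (x y : X) : ‖H x - H y‖ ≤ M * ‖x - y‖ :=
  convex_univ.norm_image_sub_le_of_norm_fderiv_le
    (fun z _ => hH.differentiable (by norm_num) z)
    (fun z _ => by rw [← norm_iteratedFDeriv_one]; exact hM z) (mem_univ y) (mem_univ x)

lemma exists_isCubicFlat (hG : HasBoundedDerivs 3 G) (h0 : G 0 = 0) (h1 : fderiv ℝ G 0 = 0)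
    (h2 : fderiv ℝ (fderiv ℝ G) 0 = 0) :
    ∃ M, 0 ≤ M ∧ IsCubicFlat G (fderiv ℝ G) (fderiv ℝ (fderiv ℝ G)) M := by
  obtain ⟨hs, hb⟩ := hG
  obtain ⟨M, hM⟩ := hb 3 (by norm_num) le_rfl
  have hs1 : ContDiff ℝ 2 (fderiv ℝ G) := hs.fderiv_right (by norm_num)
  have hs2 : ContDiff ℝ 1 (fderiv ℝ (fderiv ℝ G)) := hs1.fderiv_right (by norm_num)
  have hM' (x : X) : ‖iteratedFDeriv ℝ 1 (fderiv ℝ (fderiv ℝ G)) x‖ ≤ M := by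
    rw [norm_iteratedFDeriv_fderiv, norm_iteratedFDeriv_fderiv]
    exact hM x
  refine ⟨M, (norm_nonneg _).trans (hM 0),
    fun x => (hs.differentiable (by norm_num) x).hasFDerivAt,
    fun x => (hs1.differentiable (by norm_num) x).hasFDerivAt, norm_sub_le_of_iteratedFDeriv_one hs2 hM', h0, h1, h2⟩

lemma IsCubicFlat.norm_deriv₂_le (h : IsCubicFlat G D D₂ M) (x : X) : ‖D₂ x‖ ≤ M * ‖x‖ := by
  simpa [h.deriv₂_zero] using h.lipschitz x 0

lemma IsCubicFlat.norm_deriv_sub_le (h : IsCubicFlat G D D₂ M) (hM : 0 ≤ M) (hx : ‖x‖ ≤ R)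
    (hy : ‖y‖ ≤ R) : ‖D x - D y‖ ≤ M * R * ‖x - y‖ :=
  (convex_closedBall (0 : X) R).norm_image_sub_le_of_norm_hasFDerivWithin_le
    (fun z _ => (h.hasFDerivAt_deriv z).hasFDerivWithinAt)
    (fun z hz => (h.norm_deriv₂_le z).trans
      (mul_le_mul_of_nonneg_left (mem_closedBall_zero_iff.1 hz) hM))
    (mem_closedBall_zero_iff.2 hy) (mem_closedBall_zero_iff.2 hx)

lemma IsCubicFlat.norm_deriv_le (h : IsCubicFlat G D D₂ M) (hM : 0 ≤ M) (hx : ‖x‖ ≤ R) :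
    ‖D x‖ ≤ M * R ^ 2 := by
  have hR : 0 ≤ R := (norm_nonneg _).trans hx
  have h1 := h.norm_deriv_sub_le hM hx (y := 0) (by simpa using hR)
  rw [h.deriv_zero, sub_zero, sub_zero] at h1
  have : M * R * ‖x‖ ≤ M * R * R := mul_le_mul_of_nonneg_left hx (by positivity)
  linarith

lemma IsCubicFlat.norm_sub_le (h : IsCubicFlat G D D₂ M) (hM : 0 ≤ M) (hx : ‖x‖ ≤ R)
    (hy : ‖y‖ ≤ R) : ‖G x - G y‖ ≤ M * R ^ 2 * ‖x - y‖ :=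
  (convex_closedBall (0 : X) R).norm_image_sub_le_of_norm_hasFDerivWithin_le
    (fun z _ => (h.hasFDerivAt z).hasFDerivWithinAt)
    (fun _ hz => h.norm_deriv_le hM (mem_closedBall_zero_iff.1 hz))
    (mem_closedBall_zero_iff.2 hy) (mem_closedBall_zero_iff.2 hx)

lemma norm_segment_le (hx : ‖x‖ ≤ R) (hy : ‖y‖ ≤ R) {θ : ℝ} (hθ : θ ∈ Icc (0 : ℝ) 1) :
    ‖x + θ • (y - x)‖ ≤ R := by
  have h := (convex_closedBall (0 : X) R).add_smul_sub_mem (mem_closedBall_zero_iff.2 hx)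
    (mem_closedBall_zero_iff.2 hy) hθ
  exact mem_closedBall_zero_iff.1 h

lemma hasDerivAt_segment (x y : X) (θ : ℝ) :
    HasDerivAt (fun θ : ℝ => x + θ • (y - x)) (y - x) θ := by
  simpa using ((hasDerivAt_id θ).smul_const (y - x)).const_add x

lemma IsCubicFlat.norm_deriv_sub_sub_le (h : IsCubicFlat G D D₂ M) (hM : 0 ≤ M)
    (hx : ‖x‖ ≤ R) (hx' : ‖x'‖ ≤ R) (hy' : ‖y'‖ ≤ R) (hxx : ‖x - x'‖ ≤ Δ)
    (hyy : ‖y - y'‖ ≤ Δ) {θ : ℝ} (hθ : θ ∈ Icc (0 : ℝ) 1) :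
    ‖D (x + θ • (y - x)) - D x - (D (x' + θ • (y' - x')) - D x')‖
      ≤ M * (Δ * ‖y - x‖ + R * ‖(y - x) - (y' - x')‖) := by
  have hR : 0 ≤ R := (norm_nonneg _).trans hx
  have hΔ : 0 ≤ Δ := (norm_nonneg _).trans hxx
  have hd (τ : ℝ) : HasDerivAt (fun τ : ℝ => D (x + τ • (y - x)) - D (x' + τ • (y' - x')))
      (D₂ (x + τ • (y - x)) (y - x) - D₂ (x' + τ • (y' - x')) (y' - x')) τ :=
    ((h.hasFDerivAt_deriv _).comp_hasDerivAt τ (hasDerivAt_segment x y τ)).sub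
      ((h.hasFDerivAt_deriv _).comp_hasDerivAt τ (hasDerivAt_segment x' y' τ))
  have hb (τ : ℝ) (hτ : τ ∈ Icc (0 : ℝ) 1) :
      ‖D₂ (x + τ • (y - x)) (y - x) - D₂ (x' + τ • (y' - x')) (y' - x')‖
        ≤ M * (Δ * ‖y - x‖ + R * ‖(y - x) - (y' - x')‖) := by
    have e : D₂ (x + τ • (y - x)) (y - x) - D₂ (x' + τ • (y' - x')) (y' - x')
        = (D₂ (x + τ • (y - x)) - D₂ (x' + τ • (y' - x'))) (y - x)
          + D₂ (x' + τ • (y' - x')) ((y - x) - (y' - x')) := by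
      simp only [sub_apply, map_sub]; abel
    have e1 : (x + τ • (y - x)) - (x' + τ • (y' - x'))
        = (x - x') + τ • ((y - y') - (x - x')) := by
      simp only [smul_sub]; abel
    have b1 : ‖D₂ (x + τ • (y - x)) - D₂ (x' + τ • (y' - x'))‖ ≤ M * Δ := by
      refine (h.lipschitz _ _).trans (mul_le_mul_of_nonneg_left ?_ hM)
      rw [e1]
      exact norm_segment_le hxx hyy hτ
    have b2 : ‖D₂ (x' + τ • (y' - x'))‖ ≤ M * R :=
      (h.norm_deriv₂_le _).trans (mul_le_mul_of_nonneg_left (norm_segment_le hx' hy' hτ) hM)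
    rw [e]
    refine (norm_add_le_of_le (ContinuousLinearMap.le_of_opNorm_le _ b1 _)
      (ContinuousLinearMap.le_of_opNorm_le _ b2 _)).trans (le_of_eq (by ring))
  have key := (convex_Icc (0 : ℝ) 1).norm_image_sub_le_of_norm_hasDerivWithin_le
    (fun τ _ => (hd τ).hasDerivWithinAt) hb (left_mem_Icc.2 zero_le_one) hθ
  simp only [zero_smul, add_zero] at key
  have e2 : D (x + θ • (y - x)) - D x - (D (x' + θ • (y' - x')) - D x')
      = D (x + θ • (y - x)) - D (x' + θ • (y' - x')) - (D x - D x') := by abel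
  rw [e2]
  refine key.trans (mul_le_of_le_one_right (by positivity) ?_)
  rw [sub_zero, Real.norm_of_nonneg hθ.1]
  exact hθ.2

/-- The second order Taylor remainder is locally Lipschitz. -/
lemma IsCubicFlat.norm_taylor_sub_le (h : IsCubicFlat G D D₂ M) (hM : 0 ≤ M)
    (hx : ‖x‖ ≤ R) (hx' : ‖x'‖ ≤ R) (hy' : ‖y'‖ ≤ R) (hxx : ‖x - x'‖ ≤ Δ)
    (hyy : ‖y - y'‖ ≤ Δ) :
    ‖G y - G x - D x (y - x) - (G y' - G x' - D x' (y' - x'))‖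
      ≤ M * (Δ * ‖y - x‖ + R * ‖(y - x) - (y' - x')‖) * ‖y - x‖
        + M * R * ‖y' - x'‖ * ‖(y - x) - (y' - x')‖ := by
  have hd (τ : ℝ) : HasDerivAt
      (fun τ : ℝ => G (x + τ • (y - x)) - G (x' + τ • (y' - x'))
        - τ • (D x (y - x) - D x' (y' - x')))
      (D (x + τ • (y - x)) (y - x) - D (x' + τ • (y' - x')) (y' - x')
        - (1 : ℝ) • (D x (y - x) - D x' (y' - x'))) τ :=
    (((h.hasFDerivAt _).comp_hasDerivAt τ (hasDerivAt_segment x y τ)).sub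
      ((h.hasFDerivAt _).comp_hasDerivAt τ (hasDerivAt_segment x' y' τ))).sub
      ((hasDerivAt_id τ).smul_const _)
  have hR : 0 ≤ R := (norm_nonneg _).trans hx
  have hb (τ : ℝ) (hτ : τ ∈ Icc (0 : ℝ) 1) :
      ‖D (x + τ • (y - x)) (y - x) - D (x' + τ • (y' - x')) (y' - x')
        - (1 : ℝ) • (D x (y - x) - D x' (y' - x'))‖
        ≤ M * (Δ * ‖y - x‖ + R * ‖(y - x) - (y' - x')‖) * ‖y - x‖
          + M * R * ‖y' - x'‖ * ‖(y - x) - (y' - x')‖ := by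
    have e : D (x + τ • (y - x)) (y - x) - D (x' + τ • (y' - x')) (y' - x')
        - (1 : ℝ) • (D x (y - x) - D x' (y' - x'))
        = (D (x + τ • (y - x)) - D x - (D (x' + τ • (y' - x')) - D x')) (y - x)
          + (D (x' + τ • (y' - x')) - D x') ((y - x) - (y' - x')) := by
      simp only [sub_apply, map_sub, one_smul]; abel
    have b1 := h.norm_deriv_sub_sub_le hM hx hx' hy' hxx hyy hτ
    have b2 : ‖D (x' + τ • (y' - x')) - D x'‖ ≤ M * R * ‖y' - x'‖ := by
      refine (h.norm_deriv_sub_le hM (norm_segment_le hx' hy' hτ) hx').trans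
        (mul_le_mul_of_nonneg_left ?_ (by positivity))
      rw [add_sub_cancel_left, norm_smul, Real.norm_of_nonneg hτ.1]
      exact mul_le_of_le_one_left (norm_nonneg _) hτ.2
    rw [e]
    exact norm_add_le_of_le (ContinuousLinearMap.le_of_opNorm_le _ b1 _)
      (ContinuousLinearMap.le_of_opNorm_le _ b2 _)
  have key := (convex_Icc (0 : ℝ) 1).norm_image_sub_le_of_norm_hasDerivWithin_le
    (fun τ _ => (hd τ).hasDerivWithinAt) hb (left_mem_Icc.2 zero_le_one)
    (right_mem_Icc.2 zero_le_one)
  simp only [zero_smul, add_zero, one_smul, add_sub_cancel, sub_zero, norm_one, mul_one] at key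
  refine le_trans (le_of_eq ?_) key
  congr 1
  abel

variable {V : Type*} [NormedAddCommGroup V] [InnerProductSpace ℝ V] {α : ℝ} {𝓦 : RoughPath V α}

/-- The composition of a controlled rough path with `G`, whose derivative is `D`. -/
def compose (G : X → E) (D : X → X →L[ℝ] E) (Y : PathPair V X) : PathPair V E :=
  (fun t => G (Y.1 t), fun t => (D (Y.1 t)).comp (Y.2 t))

lemma IsCubicFlat.compose_zero (h : IsCubicFlat G D D₂ M) :
    compose G D (0 : PathPair V X) = 0 := by
  ext <;> simp [compose, h.zero]

/-- Composition with `G` is Lipschitz on small balls of controlled rough paths. -/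
theorem IsCubicFlat.controlledBy_compose_sub (h : IsCubicFlat G D D₂ M) (hM : 0 ≤ M) (hα : 0 < α)
    {Y Y' : PathPair V X} (hY : ControlledBy 𝓦 Y R) (hY' : ControlledBy 𝓦 Y' R)
    (hΔ : ControlledBy 𝓦 (Y - Y') Δ) :
    ControlledBy 𝓦 (compose G D Y - compose G D Y')
      (5 * M * R ^ 2 * (1 + 𝓦.pathSeminorm) ^ 2 * Δ) := by
  have hR0 := hY.nonneg
  have hΔ0 := hΔ.nonneg
  have ha := 𝓦.pathSeminorm_nonneg
  set a := 𝓦.pathSeminorm with ha'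
  have hd1 (t : I) : ‖Y.1 t - Y'.1 t‖ ≤ Δ := hΔ.sup t
  have hd2 (t : I) : ‖Y.2 t - Y'.2 t‖ ≤ Δ := hΔ.deriv_sup t
  have hb0 : 0 ≤ M * R ^ 2 * Δ := by positivity
  have ha2 : 1 ≤ (1 + a) ^ 2 := by nlinarith
  have ha3 : 1 + a ≤ (1 + a) ^ 2 := by nlinarith
  have hbig1 : M * R ^ 2 * Δ ≤ M * R ^ 2 * Δ * (1 + a) ^ 2 := le_mul_of_one_le_right hb0 ha2
  have hbig2 : M * R ^ 2 * Δ * (1 + a) ≤ M * R ^ 2 * Δ * (1 + a) ^ 2 :=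
    mul_le_mul_of_nonneg_left ha3 hb0
  have hbig3 : M * R ^ 2 * Δ ≤ M * R ^ 2 * Δ * (1 + a) :=
    le_mul_of_one_le_right hb0 (by linarith)
  have hDD (t : I) : ‖D (Y.1 t) - D (Y'.1 t)‖ ≤ M * R * Δ :=
    (h.norm_deriv_sub_le hM (hY.sup t) (hY'.sup t)).trans
      (mul_le_mul_of_nonneg_left (hd1 t) (by positivity))
  have hD' (t : I) : ‖D (Y'.1 t)‖ ≤ M * R ^ 2 := h.norm_deriv_le hM (hY'.sup t)
  refine ⟨fun t => ?_, fun t => ?_, fun s t hst => ?_, fun s t hst => ?_⟩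
  · have := (h.norm_sub_le hM (hY.sup t) (hY'.sup t)).trans
      (mul_le_mul_of_nonneg_left (hd1 t) (by positivity))
    simp only [compose, Prod.fst_sub, Pi.sub_apply]
    linarith
  · have e : (compose G D Y - compose G D Y').2 t
        = (D (Y.1 t) - D (Y'.1 t)).comp (Y.2 t) + (D (Y'.1 t)).comp (Y.2 t - Y'.2 t) := by
      ext v; simp [compose]
    have b1 := (ContinuousLinearMap.opNorm_comp_le (D (Y.1 t) - D (Y'.1 t)) (Y.2 t)).trans
      (mul_le_mul (hDD t) (hY.deriv_sup t) (norm_nonneg _) (by positivity))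
    have b2 := (ContinuousLinearMap.opNorm_comp_le (D (Y'.1 t)) (Y.2 t - Y'.2 t)).trans
      (mul_le_mul (hD' t) (hd2 t) (norm_nonneg _) (by positivity))
    rw [e]
    refine (norm_add_le_of_le b1 b2).trans ?_
    linarith
  · set τ := ((t : ℝ) - s) ^ α
    have hτ : 0 ≤ τ := sub_rpow_nonneg hst _
    have e : (compose G D Y - compose G D Y').2 t - (compose G D Y - compose G D Y').2 s
        = ((D (Y.1 t) - D (Y.1 s) - (D (Y'.1 t) - D (Y'.1 s))).comp (Y.2 t)
          + (D (Y'.1 t) - D (Y'.1 s)).comp (Y.2 t - Y'.2 t))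
          + ((D (Y.1 s) - D (Y'.1 s)).comp (Y.2 t - Y.2 s)
          + (D (Y'.1 s)).comp ((Y - Y').2 t - (Y - Y').2 s)) := by
      ext v; simp [compose]; abel
    have i1 : ‖Y.1 t - Y.1 s‖ ≤ R * (1 + a) * τ := hY.norm_incr_le hα hst
    have i2 : ‖Y'.1 t - Y'.1 s‖ ≤ R * (1 + a) * τ := hY'.norm_incr_le hα hst
    have i3 : ‖(Y.1 t - Y.1 s) - (Y'.1 t - Y'.1 s)‖ ≤ Δ * (1 + a) * τ := by
      have := hΔ.norm_incr_le hα hst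
      rw [← ha'] at this
      rwa [sub_sub_sub_comm]
    have c1 : ‖D (Y.1 t) - D (Y.1 s) - (D (Y'.1 t) - D (Y'.1 s))‖
        ≤ M * (Δ * (R * (1 + a) * τ) + R * (Δ * (1 + a) * τ)) := by
      have := h.norm_deriv_sub_sub_le hM (hY.sup s) (hY'.sup s) (hY'.sup t)
        (hd1 s) (hd1 t) (right_mem_Icc.2 zero_le_one)
      simp only [one_smul, add_sub_cancel] at this
      exact this.trans (mul_le_mul_of_nonneg_left (add_le_add
        (mul_le_mul_of_nonneg_left i1 hΔ0) (mul_le_mul_of_nonneg_left i3 hR0)) hM)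
    have b1 := (ContinuousLinearMap.opNorm_comp_le _ (Y.2 t)).trans
      (mul_le_mul c1 (hY.deriv_sup t) (norm_nonneg _) (by positivity))
    have b2 := (ContinuousLinearMap.opNorm_comp_le (D (Y'.1 t) - D (Y'.1 s))
      (Y.2 t - Y'.2 t)).trans
      (mul_le_mul ((h.norm_deriv_sub_le hM (hY'.sup t) (hY'.sup s)).trans
        (mul_le_mul_of_nonneg_left i2 (by positivity))) (hd2 t) (norm_nonneg _) (by positivity))
    have b3 := (ContinuousLinearMap.opNorm_comp_le (D (Y.1 s) - D (Y'.1 s))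
      (Y.2 t - Y.2 s)).trans
      (mul_le_mul (hDD s) (hY.deriv_incr s t hst) (norm_nonneg _) (by positivity))
    have b4 := (ContinuousLinearMap.opNorm_comp_le (D (Y'.1 s))
      ((Y - Y').2 t - (Y - Y').2 s)).trans
      (mul_le_mul (hD' s) (hΔ.deriv_incr s t hst) (norm_nonneg _) (by positivity))
    rw [e]
    refine (norm_add_le_of_le (norm_add_le_of_le b1 b2) (norm_add_le_of_le b3 b4)).trans ?_
    have q1 := mul_le_mul_of_nonneg_right hbig2 hτ
    have q2 := mul_le_mul_of_nonneg_right hbig1 hτ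
    change _ + (_ * _ * (R * τ) + _ * (Δ * τ)) ≤ _
    linarith
  · set τ := ((t : ℝ) - s) ^ α
    have hτ : 0 ≤ τ := sub_rpow_nonneg hst _
    have hττ : ((t : ℝ) - s) ^ (2 * α) = τ * τ := by
      have h0 : (0 : ℝ) ≤ (t : ℝ) - s := sub_nonneg.2 (show (s : ℝ) ≤ t from hst)
      rw [two_mul, Real.rpow_add_of_nonneg h0 hα.le hα.le]
    have e : remainder 𝓦 (compose G D Y - compose G D Y') s t
        = (G (Y.1 t) - G (Y.1 s) - D (Y.1 s) (Y.1 t - Y.1 s)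
            - (G (Y'.1 t) - G (Y'.1 s) - D (Y'.1 s) (Y'.1 t - Y'.1 s)))
          + ((D (Y.1 s) - D (Y'.1 s)) (remainder 𝓦 Y s t)
            + D (Y'.1 s) (remainder 𝓦 (Y - Y') s t)) := by
      simp only [remainder, compose, Prod.fst_sub, Prod.snd_sub, Pi.sub_apply, map_sub,
        sub_apply, ContinuousLinearMap.comp_apply]
      abel
    have i1 : ‖Y.1 t - Y.1 s‖ ≤ R * (1 + a) * τ := hY.norm_incr_le hα hst
    have i2 : ‖Y'.1 t - Y'.1 s‖ ≤ R * (1 + a) * τ := hY'.norm_incr_le hα hst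
    have i3 : ‖(Y.1 t - Y.1 s) - (Y'.1 t - Y'.1 s)‖ ≤ Δ * (1 + a) * τ := by
      have := hΔ.norm_incr_le hα hst
      rw [← ha'] at this
      rwa [sub_sub_sub_comm]
    have b1 : ‖G (Y.1 t) - G (Y.1 s) - D (Y.1 s) (Y.1 t - Y.1 s)
            - (G (Y'.1 t) - G (Y'.1 s) - D (Y'.1 s) (Y'.1 t - Y'.1 s))‖
        ≤ M * (Δ * (R * (1 + a) * τ) + R * (Δ * (1 + a) * τ)) * (R * (1 + a) * τ)
          + M * R * (R * (1 + a) * τ) * (Δ * (1 + a) * τ) := by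
      refine (h.norm_taylor_sub_le hM (hY.sup s) (hY'.sup s) (hY'.sup t)
        (hd1 s) (hd1 t)).trans ?_
      gcongr
    have b2 := (D (Y.1 s) - D (Y'.1 s)).le_of_opNorm_le_of_le (hDD s) (hY.remainder s t hst)
    have b3 := (D (Y'.1 s)).le_of_opNorm_le_of_le (hD' s) (hΔ.remainder s t hst)
    rw [e]
    refine (norm_add_le_of_le b1 (norm_add_le_of_le b2 b3)).trans ?_
    rw [hττ]
    have q2 := mul_le_mul_of_nonneg_right hbig1 (mul_nonneg hτ hτ)
    linarith

end Composition

/-! ### The cut-off -/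

section Cutoff

variable {V : Type*} [NormedAddCommGroup V] [InnerProductSpace ℝ V] {α : ℝ} {𝓦 : RoughPath V α}
variable {X : Type*} [NormedAddCommGroup X] [NormedSpace ℝ X] {f : ℝ → ℝ} {r L : ℝ}
variable {Y Y' : PathPair V X}

lemma IsCutoff.exists_lipschitz (hf : IsCutoff f) :
    ∃ L, 0 ≤ L ∧ ∀ x y : ℝ, 0 ≤ x → 0 ≤ y → |f x - f y| ≤ L * |x - y| := by
  have hs : ContDiffOn ℝ 3 f (Icc 0 1) := hf.smooth.mono Icc_subset_Ici_self
  have hu := uniqueDiffOn_Icc (zero_lt_one (α := ℝ))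
  obtain ⟨L, hL⟩ := (isCompact_Icc (a := (0 : ℝ)) (b := 1)).exists_bound_of_continuousOn
    (hs.continuousOn_derivWithin hu (by norm_num))
  have h1 (x y : ℝ) (hx : x ∈ Icc (0 : ℝ) 1) (hy : y ∈ Icc (0 : ℝ) 1) :
      |f x - f y| ≤ L * |x - y| :=
    (convex_Icc (0 : ℝ) 1).norm_image_sub_le_of_norm_derivWithin_le
      (hs.differentiableOn (by norm_num)) hL hy hx
  have hL0 : 0 ≤ L := (norm_nonneg _).trans (hL 0 (by simp))
  have h2 (x y : ℝ) (hx : x ∈ Icc (0 : ℝ) 1) (hy : 1 ≤ y) : |f x - f y| ≤ L * |x - y| := by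
    rw [hf.eq_zero y hy, ← hf.eq_zero 1 le_rfl]
    refine (h1 x 1 hx (by simp)).trans (mul_le_mul_of_nonneg_left ?_ hL0)
    rw [abs_of_nonpos (by linarith [hx.2]), abs_of_nonpos (by linarith [hx.2])]
    linarith
  refine ⟨L, hL0, fun x y hx hy => ?_⟩
  rcases le_total x 1 with hx1 | hx1 <;> rcases le_total y 1 with hy1 | hy1
  · exact h1 x y ⟨hx, hx1⟩ ⟨hy, hy1⟩
  · exact h2 x y ⟨hx, hx1⟩ hy1
  · rw [abs_sub_comm, abs_sub_comm x]
    exact h2 y x ⟨hy, hy1⟩ hx1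
  · rw [hf.eq_zero x hx1, hf.eq_zero y hy1]
    simpa using by positivity

lemma truncate_eq (f : ℝ → ℝ) (r : ℝ) (𝓦 : RoughPath V α) (Y : PathPair V X) :
    truncate f r 𝓦 Y = f (controlledNorm 𝓦 Y / r) • Y := rfl

lemma ControlledBy.truncate (hf : IsCutoff f) (hr : 0 < r) (hα : 0 < α) (hY : IsControlled 𝓦 Y) :
    ControlledBy 𝓦 (truncate f r 𝓦 Y) r := by
  have h := (hY.controlledBy hα).smul (f (controlledNorm 𝓦 Y / r))
  have hN := controlledNorm_nonneg 𝓦 Y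
  have hm := hf.mem_Icc _ (div_nonneg hN hr.le)
  refine h.mono ?_
  rw [abs_of_nonneg hm.1]
  rcases le_total (controlledNorm 𝓦 Y) r with h1 | h1
  · exact (mul_le_of_le_one_left hN hm.2).trans h1
  · rw [hf.eq_zero _ ((one_le_div hr).2 h1), zero_mul]
    exact hr.le

/-- The cut-off is Lipschitz, with a constant that does not depend on the radius. -/
lemma ControlledBy.truncate_sub (hf : IsCutoff f)
    (hL : ∀ x y : ℝ, 0 ≤ x → 0 ≤ y → |f x - f y| ≤ L * |x - y|) (hL0 : 0 ≤ L) (hr : 0 < r)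
    (hα : 0 < α) (hY : IsControlled 𝓦 Y) (hY' : IsControlled 𝓦 Y') :
    ControlledBy 𝓦 (RoughCenter.truncate f r 𝓦 Y - RoughCenter.truncate f r 𝓦 Y')
      ((1 + L) * controlledNorm 𝓦 (Y - Y')) := by
  have hN := controlledNorm_nonneg 𝓦 Y
  have hN' := controlledNorm_nonneg 𝓦 Y'
  have hΔ := controlledNorm_nonneg 𝓦 (Y - Y')
  have hm := hf.mem_Icc _ (div_nonneg hN hr.le)
  have hm' := hf.mem_Icc _ (div_nonneg hN' hr.le)
  have habs := hY.abs_controlledNorm_sub_le hY' hα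
  have hlip : |f (controlledNorm 𝓦 Y / r) - f (controlledNorm 𝓦 Y' / r)| * r
      ≤ L * controlledNorm 𝓦 (Y - Y') := by
    have h1 := hL _ _ (div_nonneg hN hr.le) (div_nonneg hN' hr.le)
    rw [← sub_div, abs_div, abs_of_pos hr] at h1
    have h2 := mul_le_mul_of_nonneg_right h1 hr.le
    rw [mul_assoc, div_mul_cancel₀ _ hr.ne'] at h2
    exact h2.trans (mul_le_mul_of_nonneg_left habs hL0)
  have hD := (hY.sub hY' hα).controlledBy hα
  simp only [truncate_eq]
  set p := f (controlledNorm 𝓦 Y / r) with hp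
  set q := f (controlledNorm 𝓦 Y' / r) with hq
  rcases le_total (controlledNorm 𝓦 Y') r with h1 | h1
  · have e : p • Y - q • Y' = p • (Y - Y') + (p - q) • Y' := by
      rw [smul_sub, sub_smul]; abel
    rw [e]
    refine ((hD.smul p).add ((hY'.controlledBy hα).smul (p - q))).mono ?_
    have h2 : |p - q| * controlledNorm 𝓦 Y' ≤ |p - q| * r :=
      mul_le_mul_of_nonneg_left h1 (abs_nonneg _)
    have h3 : |p| * controlledNorm 𝓦 (Y - Y') ≤ controlledNorm 𝓦 (Y - Y') := by
      rw [abs_of_nonneg hm.1]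
      exact mul_le_of_le_one_left hΔ hm.2
    linarith
  · have hq0 : q = 0 := hf.eq_zero _ ((one_le_div hr).2 h1)
    rcases le_total (controlledNorm 𝓦 Y) r with h2 | h2
    · have e : p • Y - q • Y' = (p - q) • Y := by rw [hq0]; simp
      rw [e]
      refine ((hY.controlledBy hα).smul (p - q)).mono ?_
      have h2 : |p - q| * controlledNorm 𝓦 Y ≤ |p - q| * r :=
        mul_le_mul_of_nonneg_left h2 (abs_nonneg _)
      linarith
    · have hp0 : p = 0 := hf.eq_zero _ ((one_le_div hr).2 h2)
      have e : p • Y - q • Y' = (0 : ℝ) • (Y - Y') := by rw [hq0, hp0]; simp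
      rw [e]
      refine (hD.smul 0).mono ?_
      simp only [abs_zero, zero_mul]
      positivity

end Cutoff

/-! ### The local estimate on one unit interval -/

section Radius

variable {V : Type*} [NormedAddCommGroup V] [InnerProductSpace ℝ V] {α : ℝ}
variable {K C₀ C₁ C₂ : ℝ}

lemma cutoffRadius_pos (hK : 0 < K) (h0 : 0 < C₀) (h1 : C₀ ≤ C₁) (h2 : C₀ ≤ C₂)
    (𝓦 : RoughPath V α) : 0 < cutoffRadius C₁ C₂ K 𝓦 := by
  have ha := 𝓦.pathSeminorm_nonneg
  have hb := 𝓦.areaSeminorm_nonneg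
  have h1' : 0 < C₁ := h0.trans_le h1
  have h2' : 0 < C₂ := h0.trans_le h2
  unfold cutoffRadius
  positivity

lemma cutoffRadius_mul_le (hK : 0 < K) (h0 : 0 < C₀) (h1 : C₀ ≤ C₁) (h2 : C₀ ≤ C₂)
    (𝓦 : RoughPath V α) : cutoffRadius C₁ C₂ K 𝓦
      * (1 + (1 + 𝓦.pathSeminorm) * (𝓦.pathSeminorm + 𝓦.areaSeminorm)) ≤ K / C₀ := by
  have ha := 𝓦.pathSeminorm_nonneg
  have hb := 𝓦.areaSeminorm_nonneg
  have hX : 0 ≤ (1 + 𝓦.pathSeminorm) * (𝓦.pathSeminorm + 𝓦.areaSeminorm) := by positivity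
  unfold cutoffRadius
  set x := (1 + 𝓦.pathSeminorm) * (𝓦.pathSeminorm + 𝓦.areaSeminorm)
  have hden : C₀ * (1 + x) ≤ C₁ + C₂ * x := by
    have := mul_le_mul_of_nonneg_right h2 hX
    linarith
  have hden0 : 0 < C₀ * (1 + x) := by positivity
  have : min (K / (C₁ + C₂ * x)) 1 ≤ K / (C₀ * (1 + x)) :=
    (min_le_left _ _).trans (div_le_div_of_nonneg_left hK.le hden0 hden)
  refine (mul_le_mul_of_nonneg_right this (by positivity)).trans (le_of_eq ?_)
  have : 1 + x ≠ 0 := by positivity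
  field_simp

lemma cutoffRadius_le (hK : 0 < K) (h0 : 0 < C₀) (h1 : C₀ ≤ C₁) (h2 : C₀ ≤ C₂)
    (𝓦 : RoughPath V α) : cutoffRadius C₁ C₂ K 𝓦 ≤ K / C₀ := by
  have ha := 𝓦.pathSeminorm_nonneg
  have hb := 𝓦.areaSeminorm_nonneg
  refine le_trans ?_ (cutoffRadius_mul_le hK h0 h1 h2 𝓦)
  refine le_mul_of_one_le_right (cutoffRadius_pos hK h0 h1 h2 𝓦).le ?_
  have : 0 ≤ (1 + 𝓦.pathSeminorm) * (𝓦.pathSeminorm + 𝓦.areaSeminorm) := by positivity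
  linarith

lemma cutoffRadius_sq_mul_le (hK : 0 < K) (h0 : 0 < C₀) (hK0 : K ≤ C₀) (h1 : C₀ ≤ C₁)
    (h2 : C₀ ≤ C₂) (𝓦 : RoughPath V α) :
    (1 + 𝓦.pathSeminorm + 𝓦.areaSeminorm)
      * (cutoffRadius C₁ C₂ K 𝓦 ^ 2 * (1 + 𝓦.pathSeminorm) ^ 2) ≤ 2 * (K / C₀) := by
  have ha := 𝓦.pathSeminorm_nonneg
  have hb := 𝓦.areaSeminorm_nonneg
  have hr := (cutoffRadius_pos hK h0 h1 h2 𝓦).le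
  have h := cutoffRadius_mul_le hK h0 h1 h2 𝓦
  set r := cutoffRadius C₁ C₂ K 𝓦
  set a := 𝓦.pathSeminorm
  set b := 𝓦.areaSeminorm
  have e1 : r * (1 + a) ≤ 1 := by
    have h3 : r * (1 + a) ≤ r * (1 + (1 + a) * (a + b)) :=
      mul_le_mul_of_nonneg_left (by nlinarith) hr
    exact h3.trans (h.trans ((div_le_one h0).2 hK0))
  have e2 : r * (1 + a) * (1 + a + b) ≤ 2 * (K / C₀) := by
    have h3 : r * ((1 + a) * (1 + a + b)) ≤ r * (2 * (1 + (1 + a) * (a + b))) :=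
      mul_le_mul_of_nonneg_left (by nlinarith) hr
    linarith
  have e3 : 0 ≤ r * (1 + a) * (1 + a + b) := by positivity
  calc (1 + a + b) * (r ^ 2 * (1 + a) ^ 2) = (r * (1 + a)) * (r * (1 + a) * (1 + a + b)) := by ring
    _ ≤ r * (1 + a) * (1 + a + b) := mul_le_of_le_one_left e3 e1
    _ ≤ _ := e2

end Radius

section Drift

variable {n : ℕ} {F : Sp n → Sp n}

lemma DriftHypothesis.norm_sub_le (hF : DriftHypothesis F) {ρ ω : ℝ}
    (h : ∀ x, ‖x‖ ≤ ρ → ‖fderiv ℝ F x‖ ≤ ω) {x y : Sp n} (hx : ‖x‖ ≤ ρ) (hy : ‖y‖ ≤ ρ) :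
    ‖F x - F y‖ ≤ ω * ‖x - y‖ :=
  (convex_closedBall (0 : Sp n) ρ).norm_image_sub_le_of_norm_fderiv_le
    (fun z _ => hF.smooth.1.differentiable (by norm_num) z)
    (fun z hz => h z (mem_closedBall_zero_iff.1 hz))
    (mem_closedBall_zero_iff.2 hy) (mem_closedBall_zero_iff.2 hx)

/-- The drift has a small Lipschitz constant on small balls; the scale is uniform when the
derivative of the drift is Lipschitz. -/
lemma DriftHypothesis.exists_scale (hF : DriftHypothesis F) {ν : ℝ} (hν : 0 < ν) (b : ℝ) :
    ∃ C₀ : ℝ → ℝ, (∀ K, 0 < C₀ K ∧ b ≤ C₀ K) ∧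
      ((∃ L, LipschitzWith L (fderiv ℝ F)) → ∀ K K', C₀ K = C₀ K') ∧
      ∀ K, 0 < K → ∀ x y, ‖x‖ ≤ K / C₀ K → ‖y‖ ≤ K / C₀ K → ‖F x - F y‖ ≤ ν * K * ‖x - y‖ := by
  by_cases hL : ∃ L, LipschitzWith L (fderiv ℝ F)
  · obtain ⟨L, hL⟩ := hL
    have hpos : 0 < max (max b (L / ν)) 1 := lt_max_of_lt_right one_pos
    refine ⟨fun _ => max (max b (L / ν)) 1,
      fun K => ⟨hpos, (le_max_left _ _).trans (le_max_left _ _)⟩, fun _ _ _ => rfl,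
      fun K hK x y hx hy => hF.norm_sub_le (fun z hz => ?_) hx hy⟩
    have h1 : ‖fderiv ℝ F z‖ ≤ L * ‖z‖ := by
      simpa [hF.fderiv_zero] using hL.norm_sub_le z 0
    have h2 : (L : ℝ) ≤ ν * max (max b (L / ν)) 1 := by
      rw [mul_comm, ← div_le_iff₀ hν]
      exact (le_max_right _ _).trans (le_max_left _ _)
    calc ‖fderiv ℝ F z‖ ≤ L * (K / max (max b (L / ν)) 1) :=
          h1.trans (mul_le_mul_of_nonneg_left hz L.2)
      _ ≤ (ν * max (max b (L / ν)) 1) * (K / max (max b (L / ν)) 1) :=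
          mul_le_mul_of_nonneg_right h2 (by positivity)
      _ = ν * K := by field_simp
  · have hc : Continuous (fderiv ℝ F) := hF.smooth.1.continuous_fderiv (by norm_num)
    have hex (K : ℝ) : ∃ ρ, 0 < ρ ∧ (0 < K → ∀ x, ‖x‖ ≤ ρ → ‖fderiv ℝ F x‖ ≤ ν * K) := by
      by_cases hK : 0 < K
      · obtain ⟨δ, hδ, h⟩ := Metric.continuousAt_iff.1 hc.continuousAt (ν * K) (by positivity)
        refine ⟨δ / 2, by positivity, fun _ x hx => ?_⟩
        have := h (x := x) (by rw [dist_zero_right]; linarith)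
        rw [hF.fderiv_zero, dist_zero_right] at this
        exact this.le
      · exact ⟨1, one_pos, fun h => absurd h hK⟩
    choose ρ hρ hb using hex
    refine ⟨fun K => max (max b (K / ρ K)) 1,
      fun K => ⟨lt_max_of_lt_right one_pos, (le_max_left _ _).trans (le_max_left _ _)⟩,
      fun h => absurd h hL, fun K hK x y hx hy => ?_⟩
    have hle : K / max (max b (K / ρ K)) 1 ≤ ρ K := by
      rw [div_le_iff₀ (lt_max_of_lt_right one_pos), mul_comm, ← div_le_iff₀ (hρ K)]
      exact (le_max_right _ _).trans (le_max_left _ _)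
    exact hF.norm_sub_le (hb K hK) (hx.trans hle) (hy.trans hle)

end Drift

section Local

variable {V : Type*} [NormedAddCommGroup V] [InnerProductSpace ℝ V] {α : ℝ}
variable {X : Type*} [NormedAddCommGroup X] [NormedSpace ℝ X]
variable {S : ℝ → X →L[ℝ] X} {m : ℝ} {P : X →L[ℝ] X} {𝓦 : RoughPath V α}
variable {F : X → X} {G : X → V →L[ℝ] X} {D₂ : X → X →L[ℝ] X →L[ℝ] V →L[ℝ] X}
variable {f : ℝ → ℝ} {r L M ω : ℝ} {Y Y' : PathPair V X}

/-- The basic convolution of the truncated coefficients along `Y`, as a controlled rough path. -/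
def localPair (S : ℝ → X →L[ℝ] X) (F : X → X) (G : X → V →L[ℝ] X) (f : ℝ → ℝ) (r : ℝ)
    (P : X →L[ℝ] X) (𝓦 : RoughPath V α) (Y : PathPair V X) : PathPair V X :=
  (fun t => convolution S F G f r P 𝓦 Y 0 t 0,
    fun t => (S (0 - (t : ℝ)) ∘L P) ∘L (truncDiffusion G f r 𝓦 Y).1 t)

lemma convolution_eq_pathConvolution (a b : I) (c : ℝ) : convolution S F G f r P 𝓦 Y a b c
    = pathConvolution S P 𝓦 (truncDrift F f r 𝓦 Y) (truncDiffusion G f r 𝓦 Y) a b c := rfl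

lemma truncDiffusion_eq_compose : truncDiffusion G f r 𝓦 Y
    = compose G (fderiv ℝ G) (truncate f r 𝓦 Y) := rfl

lemma truncate_zero : truncate f r 𝓦 (0 : PathPair V X) = 0 := by
  ext <;> simp [truncate]

lemma truncDiffusion_zero (hG : IsCubicFlat G (fderiv ℝ G) D₂ M) :
    truncDiffusion G f r 𝓦 (0 : PathPair V X) = 0 := by
  rw [truncDiffusion_eq_compose, truncate_zero, hG.compose_zero]

lemma truncDrift_zero (hF : F 0 = 0) : truncDrift F f r 𝓦 (0 : PathPair V X) = 0 := by
  ext t; simp [truncDrift, truncate_zero, hF]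

lemma isControlled_zero : IsControlled 𝓦 (0 : PathPair V X) :=
  ⟨⟨0, by simp [incr]⟩, ⟨0, by simp [incr]⟩, ⟨0, by simp [remainder]⟩⟩

lemma controlledNorm_zero : controlledNorm 𝓦 (0 : PathPair V X) = 0 := by
  have h : ControlledBy 𝓦 (0 : PathPair V X) 0 :=
    ⟨by simp, by simp, by simp, by simp [remainder]⟩
  exact le_antisymm (by simpa using h.controlledNorm_le) (controlledNorm_nonneg _ _)

lemma continuous_truncDrift (hf : IsCutoff f) (hr : 0 < r) (hα : 0 < α) (hF : Continuous F)
    (hY : IsControlled 𝓦 Y) : Continuous (truncDrift F f r 𝓦 Y) :=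
  hF.comp (continuous_of_norm_sub_le hα fun _ _ hst =>
    (ControlledBy.truncate hf hr hα hY).norm_incr_le hα hst)

lemma controlledBy_truncDiffusion_sub (hG : IsCubicFlat G (fderiv ℝ G) D₂ M) (hM : 0 ≤ M)
    (hf : IsCutoff f) (hL : ∀ x y : ℝ, 0 ≤ x → 0 ≤ y → |f x - f y| ≤ L * |x - y|) (hL0 : 0 ≤ L)
    (hr : 0 < r) (hα : 0 < α) (hY : IsControlled 𝓦 Y) (hY' : IsControlled 𝓦 Y') :
    ControlledBy 𝓦 (truncDiffusion G f r 𝓦 Y - truncDiffusion G f r 𝓦 Y')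
      (5 * M * r ^ 2 * (1 + 𝓦.pathSeminorm) ^ 2 * ((1 + L) * controlledNorm 𝓦 (Y - Y'))) :=
  hG.controlledBy_compose_sub hM hα (ControlledBy.truncate hf hr hα hY)
    (ControlledBy.truncate hf hr hα hY') (ControlledBy.truncate_sub hf hL hL0 hr hα hY hY')

lemma isControlled_truncDiffusion (hG : IsCubicFlat G (fderiv ℝ G) D₂ M) (hM : 0 ≤ M)
    (hf : IsCutoff f) (hr : 0 < r) (hα : 0 < α) (hY : IsControlled 𝓦 Y) :
    IsControlled 𝓦 (truncDiffusion G f r 𝓦 Y) := by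
  obtain ⟨L, hL0, hL⟩ := hf.exists_lipschitz
  have := controlledBy_truncDiffusion_sub hG hM hf hL hL0 hr hα hY isControlled_zero
  rw [truncDiffusion_zero hG, sub_zero] at this
  exact this.isControlled hα

variable [FiniteDimensional ℝ V] [CompleteSpace X]

theorem controlledBy_localPair_sub (hα : 1 / 3 < α) (hα2 : α ≤ 1 / 2) (hS : IsLipschitzGroup S m)
    (P : X →L[ℝ] X) (hFc : Continuous F)
    (hF : ∀ x y, ‖x‖ ≤ r → ‖y‖ ≤ r → ‖F x - F y‖ ≤ ω * ‖x - y‖) (hω : 0 ≤ ω)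
    (hG : IsCubicFlat G (fderiv ℝ G) D₂ M) (hM : 0 ≤ M) (hf : IsCutoff f)
    (hL : ∀ x y : ℝ, 0 ≤ x → 0 ≤ y → |f x - f y| ≤ L * |x - y|) (hL0 : 0 ≤ L)
    (hr : 0 < r) (hY : IsControlled 𝓦 Y) (hY' : IsControlled 𝓦 Y') :
    ControlledBy 𝓦 (localPair S F G f r P 𝓦 Y - localPair S F G f r P 𝓦 Y')
      (m * ‖P‖ * (1 + L) * (ω + 10 * M * integralConst V α
          * ((1 + 𝓦.pathSeminorm + 𝓦.areaSeminorm) * (r ^ 2 * (1 + 𝓦.pathSeminorm) ^ 2)))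
        * controlledNorm 𝓦 (Y - Y')) := by
  have hα0 : 0 < α := by linarith
  have hy := continuous_truncDrift hf hr hα0 hFc hY
  have hy' := continuous_truncDrift hf hr hα0 hFc hY'
  have hZ := isControlled_truncDiffusion hG hM hf hr hα0 hY
  have hZ' := isControlled_truncDiffusion hG hM hf hr hα0 hY'
  have hb := ControlledBy.truncate hf hr hα0 hY
  have hb' := ControlledBy.truncate hf hr hα0 hY'
  have hd := ControlledBy.truncate_sub hf hL hL0 hr hα0 hY hY'
  have hyc (t : I) : ‖(truncDrift F f r 𝓦 Y - truncDrift F f r 𝓦 Y') t‖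
      ≤ ω * ((1 + L) * controlledNorm 𝓦 (Y - Y')) :=
    (hF _ _ (hb.sup t) (hb'.sup t)).trans (mul_le_mul_of_nonneg_left (hd.sup t) hω)
  have key := controlledBy_pathConvolution hα hα2 hS P (hy.sub hy') hyc
    (controlledBy_truncDiffusion_sub hG hM hf hL hL0 hr hα0 hY hY')
  convert key using 1
  · refine Prod.ext ?_ ?_
    · funext t
      exact (pathConvolution_sub hα hα2 hS P hy hy' hZ hZ' t).symm
    · funext t
      ext v
      simp [localPair]
  · ring

lemma localPair_zero_right (hα : 1 / 3 < α) (hα2 : α ≤ 1 / 2) (hS : IsLipschitzGroup S m)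
    (P : X →L[ℝ] X) (hF0 : F 0 = 0) (hG : IsCubicFlat G (fderiv ℝ G) D₂ M) :
    localPair S F G f r P 𝓦 (0 : PathPair V X) = 0 := by
  have hα0 : 0 < α := by linarith
  have h1 := pathConvolution_sub (y := 0) (y' := 0) (Z := 0) (Z' := 0) (𝓦 := 𝓦) hα hα2 hS P
    continuous_zero continuous_zero isControlled_zero isControlled_zero
  simp only [sub_self] at h1
  refine Prod.ext ?_ ?_
  · funext t
    simp only [localPair, convolution_eq_pathConvolution, truncDiffusion_zero hG,
      truncDrift_zero hF0]
    exact h1 t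
  · funext t
    simp [localPair, truncDiffusion_zero hG]

end Local

/-! ### The sequence space and its fixed point theorem -/

section SequenceSpace

variable {V : Type*} [NormedAddCommGroup V] [InnerProductSpace ℝ V] {α : ℝ}
variable {X : Type*} [NormedAddCommGroup X] [NormedSpace ℝ X]
variable {η : ℝ} {𝓦 : RoughPath V α} {U U' : Seq V X} {c c' : ℝ}

/-- The weight `e^{η(i-1)}` at `i = -m`. -/
def weight (η : ℝ) (m : ℕ) : ℝ := Real.exp (η * (-(m : ℝ) - 1))

lemma weight_pos (η : ℝ) (m : ℕ) : 0 < weight η m := Real.exp_pos _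

lemma exp_neg_mul_weight (η : ℝ) (m : ℕ) : Real.exp (-η * (-(m : ℝ) - 1)) * weight η m = 1 := by
  rw [weight, ← Real.exp_add]
  simp

/-- Every entry `U m` is controlled, with bound `c` relative to the weight. -/
def SeqControlledBy (η : ℝ) (𝓦 : RoughPath V α) (U : Seq V X) (c : ℝ) : Prop :=
  ∀ m, ControlledBy (fibre 𝓦 m) (U m) (c * weight η m)

lemma bcNorm_nonneg (η : ℝ) (𝓦 : RoughPath V α) (U : Seq V X) : 0 ≤ bcNorm η 𝓦 U :=
  Real.iSup_nonneg fun _ => mul_nonneg (Real.exp_pos _).le (controlledNorm_nonneg _ _)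

lemma controlledNorm_le_bcNorm (hU : U ∈ bcSpace η 𝓦) (m : ℕ) :
    controlledNorm (fibre 𝓦 m) (U m) ≤ bcNorm η 𝓦 U * weight η m := by
  have h : Real.exp (-η * (-(m : ℝ) - 1)) * controlledNorm (fibre 𝓦 m) (U m) ≤ bcNorm η 𝓦 U :=
    le_ciSup (f := fun m : ℕ => Real.exp (-η * (-(m : ℝ) - 1)) * controlledNorm (fibre 𝓦 m) (U m))
      hU.2.2 m
  have h2 := mul_le_mul_of_nonneg_right h (weight_pos η m).le
  calc controlledNorm (fibre 𝓦 m) (U m)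
      = (Real.exp (-η * (-(m : ℝ) - 1)) * weight η m) * controlledNorm (fibre 𝓦 m) (U m) := by
        rw [exp_neg_mul_weight, one_mul]
    _ ≤ _ := by linarith

lemma seqControlledBy_bcNorm (hα : 0 < α) (hU : U ∈ bcSpace η 𝓦) :
    SeqControlledBy η 𝓦 U (bcNorm η 𝓦 U) := fun m =>
  ((hU.1 m).controlledBy hα).mono (controlledNorm_le_bcNorm hU m)

lemma SeqControlledBy.weighted_le (hU : SeqControlledBy η 𝓦 U c) (m : ℕ) :
    Real.exp (-η * (-(m : ℝ) - 1)) * controlledNorm (fibre 𝓦 m) (U m) ≤ 4 * c := by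
  have h := mul_le_mul_of_nonneg_left (hU m).controlledNorm_le
    (Real.exp_pos (-η * (-(m : ℝ) - 1))).le
  refine h.trans (le_of_eq ?_)
  calc _ = 4 * c * (Real.exp (-η * (-(m : ℝ) - 1)) * weight η m) := by ring
    _ = 4 * c := by rw [exp_neg_mul_weight, mul_one]

lemma SeqControlledBy.bcNorm_le (hU : SeqControlledBy η 𝓦 U c) : bcNorm η 𝓦 U ≤ 4 * c :=
  ciSup_le hU.weighted_le

lemma SeqControlledBy.mem_bcSpace (hα : 0 < α) (hU : SeqControlledBy η 𝓦 U c)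
    (h : ∀ m, (U m).1 0 = (U (m + 1)).1 1) : U ∈ bcSpace η 𝓦 :=
  ⟨fun m => (hU m).isControlled hα, h, ⟨4 * c, by rintro _ ⟨m, rfl⟩; exact hU.weighted_le m⟩⟩

lemma SeqControlledBy.add (hU : SeqControlledBy η 𝓦 U c) (hU' : SeqControlledBy η 𝓦 U' c') :
    SeqControlledBy η 𝓦 (U + U') (c + c') := fun m => by
  rw [add_mul]
  exact (hU m).add (hU' m)

lemma SeqControlledBy.mono (hU : SeqControlledBy η 𝓦 U c) (h : c ≤ c') :
    SeqControlledBy η 𝓦 U c' := fun m =>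
  (hU m).mono (mul_le_mul_of_nonneg_right h (weight_pos η m).le)

lemma zero_mem_bcSpace (hα : 0 < α) : (0 : Seq V X) ∈ bcSpace η 𝓦 :=
  SeqControlledBy.mem_bcSpace (c := 0) hα
    (fun m => by
      have := (isControlled_zero (𝓦 := fibre 𝓦 m) (X := X)).controlledBy hα
      rwa [controlledNorm_zero, ← zero_mul (weight η m)] at this) fun _ => rfl

lemma sub_mem_bcSpace (hα : 0 < α) (hU : U ∈ bcSpace η 𝓦) (hU' : U' ∈ bcSpace η 𝓦) :
    U - U' ∈ bcSpace η 𝓦 := by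
  refine SeqControlledBy.mem_bcSpace (c := bcNorm η 𝓦 U + bcNorm η 𝓦 U') hα (fun m => ?_)
    fun m => ?_
  · rw [add_mul]
    exact (seqControlledBy_bcNorm hα hU m).sub (seqControlledBy_bcNorm hα hU' m)
  · simp [hU.2.1 m, hU'.2.1 m]

variable [CompleteSpace X]

/-- Contractions of the sequence space have exactly one fixed point. -/
theorem existsUnique_fixedPoint (hα : 0 < α) (T : Seq V X → Seq V X)
    (hT : ∀ U ∈ bcSpace η 𝓦, T U ∈ bcSpace η 𝓦)
    (hc : ∀ U ∈ bcSpace η 𝓦, ∀ U' ∈ bcSpace η 𝓦,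
      bcNorm η 𝓦 (T U - T U') ≤ 1 / 4 * bcNorm η 𝓦 (U - U')) :
    ∃! Γ : Seq V X, Γ ∈ bcSpace η 𝓦 ∧ T Γ = Γ := by
  set u : ℕ → Seq V X := fun k => T^[k] 0 with hu
  have hu1 (k : ℕ) : u (k + 1) = T (u k) := Function.iterate_succ_apply' T k 0
  have hmem (k : ℕ) : u k ∈ bcSpace η 𝓦 := by
    induction k with
    | zero => exact zero_mem_bcSpace hα
    | succ k ih => rw [hu1]; exact hT _ ih
  set d := bcNorm η 𝓦 (u 1 - u 0) with hd
  have hd0 : 0 ≤ d := bcNorm_nonneg _ _ _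
  have hstep (k : ℕ) : bcNorm η 𝓦 (u (k + 1) - u k) ≤ d * (1 / 4) ^ k := by
    induction k with
    | zero => simp [hd]
    | succ k ih =>
      rw [hu1 (k + 1), hu1 k]
      rw [hu1 k] at ih
      have h := hc _ (hT _ (hmem k)) _ (hmem k)
      rw [pow_succ]
      rw [← hu1 k] at h ih ⊢
      linarith
  have hstep' (k : ℕ) : SeqControlledBy η 𝓦 (u (k + 1) - u k) (d * (1 / 4) ^ k) :=
    (seqControlledBy_bcNorm hα (sub_mem_bcSpace hα (hmem _) (hmem _))).mono (hstep k)
  have hdiff (k j : ℕ) : SeqControlledBy η 𝓦 (u (k + j) - u k)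
      (2 * d * ((1 / 4) ^ k - (1 / 4) ^ (k + j))) := by
    induction j with
    | zero =>
      have : SeqControlledBy η 𝓦 (0 : Seq V X) 0 := fun m => by
        have := (isControlled_zero (𝓦 := fibre 𝓦 m) (X := X)).controlledBy hα
        rwa [controlledNorm_zero, ← zero_mul (weight η m)] at this
      simpa using this
    | succ j ih =>
      have h := ih.add (hstep' (k + j))
      rw [show u (k + j) - u k + (u (k + j + 1) - u (k + j)) = u (k + (j + 1)) - u k by
        rw [← add_assoc]; abel] at h
      refine h.mono ?_
      rw [← add_assoc, pow_succ _ (k + j)]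
      have : 0 ≤ d * (1 / 4 : ℝ) ^ (k + j) := by positivity
      linarith
  have hlim1 (m : ℕ) (t : I) : ∃ x, Tendsto (fun k => (u k m).1 t) atTop (𝓝 x) := by
    refine cauchySeq_tendsto_of_complete
      (cauchySeq_of_le_geometric (1 / 4) (d * weight η m) (by norm_num) fun k => ?_)
    rw [dist_comm, dist_eq_norm]
    exact ((hstep' k m).sup t).trans (le_of_eq (by ring))
  have hlim2 (m : ℕ) (t : I) : ∃ x, Tendsto (fun k => (u k m).2 t) atTop (𝓝 x) := by
    refine cauchySeq_tendsto_of_complete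
      (cauchySeq_of_le_geometric (1 / 4) (d * weight η m) (by norm_num) fun k => ?_)
    rw [dist_comm, dist_eq_norm]
    exact ((hstep' k m).deriv_sup t).trans (le_of_eq (by ring))
  choose g1 hg1 using hlim1
  choose g2 hg2 using hlim2
  set Γ : Seq V X := fun m => (g1 m, g2 m) with hΓ
  have hΓu (k : ℕ) : SeqControlledBy η 𝓦 (Γ - u k) (2 * d * (1 / 4) ^ k) := by
    intro m
    refine ControlledBy.of_tendsto (l := atTop) (y := fun j => (u (k + j) - u k) m)
      (Eventually.of_forall fun j => (hdiff k j).mono ?_ m) (fun t => ?_) (fun t => ?_)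
    · have : (0 : ℝ) ≤ (1 / 4) ^ (k + j) := by positivity
      exact mul_le_mul_of_nonneg_left (by linarith) (by positivity)
    · have := (hg1 m t).comp (tendsto_add_atTop_nat k)
      simpa [Function.comp_def, add_comm] using this.sub_const ((u k m).1 t)
    · have := (hg2 m t).comp (tendsto_add_atTop_nat k)
      simpa [Function.comp_def, add_comm] using this.sub_const ((u k m).2 t)
  have hΓmem : Γ ∈ bcSpace η 𝓦 := by
    refine SeqControlledBy.mem_bcSpace hα (c := 2 * d * (1 / 4) ^ 0) ?_ fun m => ?_
    · have h0 : u 0 = 0 := rfl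
      have h := hΓu 0
      rwa [h0, sub_zero] at h
    · have h := hg1 m 0
      simp only [fun k => (hmem k).2.1 m] at h
      exact tendsto_nhds_unique h (hg1 (m + 1) 1)
  have hTΓ (k : ℕ) : SeqControlledBy η 𝓦 (T Γ - u (k + 1)) (2 * d * (1 / 4) ^ k) := by
    rw [hu1]
    refine (seqControlledBy_bcNorm hα
      (sub_mem_bcSpace hα (hT _ hΓmem) (hT _ (hmem k)))).mono ((hc _ hΓmem _ (hmem k)).trans ?_)
    have := (hΓu k).bcNorm_le
    linarith
  have hzero (m : ℕ) : Tendsto (fun k : ℕ => 2 * d * (1 / 4 : ℝ) ^ k * weight η m) atTop (𝓝 0) := by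
    have := ((tendsto_pow_atTop_nhds_zero_of_lt_one (by norm_num : (0 : ℝ) ≤ 1 / 4)
      (by norm_num)).const_mul (2 * d)).mul_const (weight η m)
    simpa using this
  have hfix : T Γ = Γ := by
    funext m
    refine Prod.ext (funext fun t => ?_) (funext fun t => ?_)
    · have h := squeeze_zero_norm (fun k => (hTΓ k m).sup t) (hzero m)
      have h2 := (hg1 m t).comp (tendsto_add_atTop_nat 1)
      have h3 := h.add h2
      refine tendsto_nhds_unique (l := atTop) (f := fun _ : ℕ => (T Γ m).1 t) tendsto_const_nhds ?_
      simpa [Function.comp_def] using h3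
    · have h := squeeze_zero_norm (fun k => (hTΓ k m).deriv_sup t) (hzero m)
      have h2 := (hg2 m t).comp (tendsto_add_atTop_nat 1)
      have h3 := h.add h2
      refine tendsto_nhds_unique (l := atTop) (f := fun _ : ℕ => (T Γ m).2 t) tendsto_const_nhds ?_
      simpa [Function.comp_def] using h3
  refine ⟨Γ, ⟨hΓmem, hfix⟩, ?_⟩
  rintro Γ' ⟨hΓ', hfix'⟩
  have h1 := hc _ hΓ' _ hΓmem
  rw [hfix, hfix'] at h1
  have h2 : bcNorm η 𝓦 (Γ' - Γ) = 0 := by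
    have := bcNorm_nonneg η 𝓦 (Γ' - Γ)
    linarith
  have h3 := seqControlledBy_bcNorm hα (sub_mem_bcSpace hα hΓ' hΓmem)
  rw [h2] at h3
  funext m
  refine Prod.ext (funext fun t => ?_) (funext fun t => ?_)
  · have := (h3 m).sup t
    rw [zero_mul] at this
    exact sub_eq_zero.1 (norm_le_zero_iff.1 this)
  · have := (h3 m).deriv_sup t
    rw [zero_mul] at this
    exact sub_eq_zero.1 (norm_le_zero_iff.1 this)

end SequenceSpace

/-! ### The Lyapunov-Perron map -/

section Sums

variable {X : Type*} [NormedAddCommGroup X] [NormedSpace ℝ X]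
variable {S : ℝ → X →L[ℝ] X} {m₀ η γ β Mc Ms c : ℝ} {u v : ℕ → X} {Pc : X →L[ℝ] X} {ξ : X}

/-- The sum of the center contributions. -/
def centerSum (S : ℝ → X →L[ℝ] X) (u : ℕ → X) (m : ℕ) : X :=
  ∑ j ∈ Finset.range (m + 1), S (-((m : ℝ) - j)) (u j)

/-- The sum of the stable contributions. -/
def stableSum (S : ℝ → X →L[ℝ] X) (v : ℕ → X) (m : ℕ) : X :=
  ∑' l : ℕ, S ((l : ℝ) + 1) (v (m + 1 + l))

lemma norm_centerSum_le (hγη : η < γ) (hMc : 0 ≤ Mc)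
    (h : ∀ t ≤ 0, ∀ j, ‖S t (u j)‖ ≤ Mc * Real.exp (γ * t) * ‖u j‖)
    (hu : ∀ j, ‖u j‖ ≤ c * weight η j) (m : ℕ) :
    ‖centerSum S u m‖ ≤ c * (Mc / (1 - Real.exp (-(γ - η)))) * weight η m := by
  set q := Real.exp (-(γ - η)) with hq
  have hq0 : 0 ≤ q := (Real.exp_pos _).le
  have hq1 : q < 1 := Real.exp_lt_one_iff.2 (by linarith)
  have hc : 0 ≤ c := by
    have := (norm_nonneg _).trans (hu 0)
    exact nonneg_of_mul_nonneg_left this (weight_pos η 0)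
  have hterm : ∀ j ∈ Finset.range (m + 1),
      ‖S (-((m : ℝ) - j)) (u j)‖ ≤ c * Mc * weight η m * q ^ (m + 1 - 1 - j) := by
    intro j hj
    have hjm : j ≤ m := Nat.lt_succ_iff.1 (Finset.mem_range.1 hj)
    have hjm' : (j : ℝ) ≤ m := by exact_mod_cast hjm
    have h1 := (h (-((m : ℝ) - j)) (by linarith) j).trans
      (mul_le_mul_of_nonneg_left (hu j) (by positivity))
    refine h1.trans (le_of_eq ?_)
    have e : Real.exp (γ * -((m : ℝ) - j)) * weight η j = weight η m * q ^ (m + 1 - 1 - j) := by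
      rw [hq, ← Real.exp_nat_mul, weight, weight, ← Real.exp_add, ← Real.exp_add, Nat.add_sub_cancel,
        Nat.cast_sub hjm]
      congr 1
      ring
    linear_combination c * Mc * e
  refine (norm_sum_le_of_le _ hterm).trans ?_
  rw [← Finset.mul_sum, Finset.sum_range_reflect (fun i => q ^ i) (m + 1)]
  have h2 : ∑ i ∈ Finset.range (m + 1), q ^ i ≤ (1 - q)⁻¹ := by
    rw [← tsum_geometric_of_lt_one hq0 hq1]
    exact (summable_geometric_of_lt_one hq0 hq1).sum_le_tsum _ fun i _ => pow_nonneg hq0 i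
  have hw := (weight_pos η m).le
  refine (mul_le_mul_of_nonneg_left h2 (by positivity)).trans (le_of_eq ?_)
  rw [div_eq_mul_inv]
  ring

lemma stable_term_le (hβη : -β < η) (hMs : 0 ≤ Ms)
    (h : ∀ t, 0 ≤ t → ∀ j, ‖S t (v j)‖ ≤ Ms * Real.exp (-β * t) * ‖v j‖)
    (hv : ∀ j, ‖v j‖ ≤ c * weight η j) (m l : ℕ) :
    ‖S ((l : ℝ) + 1) (v (m + 1 + l))‖
      ≤ c * Ms * weight η m * Real.exp (-(β + η)) ^ l := by
  have hc : 0 ≤ c := by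
    have := (norm_nonneg _).trans (hv 0)
    exact nonneg_of_mul_nonneg_left this (weight_pos η 0)
  have h1 := (h ((l : ℝ) + 1) (by positivity) (m + 1 + l)).trans
    (mul_le_mul_of_nonneg_left (hv (m + 1 + l)) (by positivity))
  have e : Real.exp (-β * ((l : ℝ) + 1)) * weight η (m + 1 + l)
      ≤ weight η m * Real.exp (-(β + η)) ^ l := by
    rw [← Real.exp_nat_mul, weight, weight, ← Real.exp_add, ← Real.exp_add]
    refine Real.exp_le_exp.2 ?_
    push_cast
    linarith
  have h2 := mul_le_mul_of_nonneg_left e (mul_nonneg hc hMs)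
  linarith

lemma summable_stable [CompleteSpace X] (hβη : -β < η) (hMs : 0 ≤ Ms)
    (h : ∀ t, 0 ≤ t → ∀ j, ‖S t (v j)‖ ≤ Ms * Real.exp (-β * t) * ‖v j‖)
    (hv : ∀ j, ‖v j‖ ≤ c * weight η j) (m : ℕ) :
    Summable fun l : ℕ => S ((l : ℝ) + 1) (v (m + 1 + l)) :=
  Summable.of_norm_bounded ((summable_geometric_of_lt_one (Real.exp_pos _).le
    (Real.exp_lt_one_iff.2 (by linarith : -(β + η) < 0))).mul_left _) (stable_term_le hβη hMs h hv m)

lemma norm_stableSum_le (hβη : -β < η) (hMs : 0 ≤ Ms)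
    (h : ∀ t, 0 ≤ t → ∀ j, ‖S t (v j)‖ ≤ Ms * Real.exp (-β * t) * ‖v j‖)
    (hv : ∀ j, ‖v j‖ ≤ c * weight η j) (m : ℕ) :
    ‖stableSum S v m‖ ≤ c * (Ms / (1 - Real.exp (-(β + η)))) * weight η m := by
  have hs := (hasSum_geometric_of_lt_one (Real.exp_pos _).le
    (Real.exp_lt_one_iff.2 (by linarith : -(β + η) < 0))).mul_left (c * Ms * weight η m)
  refine (tsum_of_norm_bounded hs (stable_term_le hβη hMs h hv m)).trans (le_of_eq ?_)
  rw [div_eq_mul_inv]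
  ring

lemma centerSum_sub (u u' : ℕ → X) (m : ℕ) :
    centerSum S (u - u') m = centerSum S u m - centerSum S u' m := by
  simp [centerSum, Finset.sum_sub_distrib]

lemma stableSum_sub {v v' : ℕ → X} {m : ℕ}
    (hv : Summable fun l : ℕ => S ((l : ℝ) + 1) (v (m + 1 + l)))
    (hv' : Summable fun l : ℕ => S ((l : ℝ) + 1) (v' (m + 1 + l))) :
    stableSum S (v - v') m = stableSum S v m - stableSum S v' m := by
  simp [stableSum, hv.tsum_sub hv']

/-- The value at time `0` of the `m`-th entry of the Lyapunov-Perron map. -/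
def entryPoint (S : ℝ → X →L[ℝ] X) (Pc : X →L[ℝ] X) (ξ : X) (u v : ℕ → X) (m : ℕ) : X :=
  S (-(m : ℝ) - 1) (Pc ξ) - centerSum S u m + stableSum S v m

lemma entryPoint_eq_succ (hS : IsLipschitzGroup S m₀)
    (hv : ∀ m : ℕ, Summable fun l : ℕ => S ((l : ℝ) + 1) (v (m + 1 + l))) (m : ℕ) :
    entryPoint S Pc ξ u v m
      = S 1 (entryPoint S Pc ξ u v (m + 1) + u (m + 1) + v (m + 1)) := by
  have h1 : S (-(m : ℝ) - 1) (Pc ξ) = S 1 (S (-((m + 1 : ℕ) : ℝ) - 1) (Pc ξ)) := by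
    rw [← hS.add_apply]
    congr 2
    push_cast
    ring
  have h2 : S 1 (centerSum S u (m + 1)) = centerSum S u m + S 1 (u (m + 1)) := by
    rw [centerSum, Finset.sum_range_succ, map_add, map_sum, centerSum]
    congr 1
    · refine Finset.sum_congr rfl fun j _ => ?_
      rw [← hS.add_apply]
      congr 2
      push_cast
      ring
    · rw [sub_self, neg_zero, hS.zero]
      rfl
  have h3 : stableSum S v m = S 1 (v (m + 1)) + S 1 (stableSum S v (m + 1)) := by
    rw [stableSum, (hv m).tsum_eq_zero_add, stableSum, ContinuousLinearMap.map_tsum _ (hv (m + 1))]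
    congr 1
    · simp
    · refine tsum_congr fun l => ?_
      rw [← hS.add_apply]
      congr 2
      · push_cast
        ring
      · ring
  simp only [entryPoint, map_add, map_sub]
  rw [h1, h2, h3]
  abel

end Sums

section LyapunovPerron

variable {V : Type*} [NormedAddCommGroup V] [InnerProductSpace ℝ V] {α : ℝ}
variable {X : Type*} [NormedAddCommGroup X] [NormedSpace ℝ X]

/-- The group `S` with its center and stable projections and exponential bounds. -/
structure IsSplitGroup (S : ℝ → X →L[ℝ] X) (m₀ : ℝ) (Pc Ps : X →L[ℝ] X) (β γ Mc Ms : ℝ) :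
    Prop where
  group : IsLipschitzGroup S m₀
  center_idem : ∀ x, Pc (Pc x) = Pc x
  stable_idem : ∀ x, Ps (Ps x) = Ps x
  center_comm : ∀ t x, Pc (S t x) = S t (Pc x)
  stable_comm : ∀ t x, Ps (S t x) = S t (Ps x)
  sum_eq : ∀ x, Pc x + Ps x = x
  gamma_nonneg : 0 ≤ γ
  center_nonneg : 0 ≤ Mc
  stable_nonneg : 0 ≤ Ms
  center_bound : ∀ t ≤ 0, ∀ x, Pc x = x → ‖S t x‖ ≤ Mc * Real.exp (γ * t) * ‖x‖
  stable_bound : ∀ t, 0 ≤ t → ∀ x, Ps x = x → ‖S t x‖ ≤ Ms * Real.exp (-β * t) * ‖x‖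

/-- The coefficients and the cut-off are regular enough for the convolutions to make sense. -/
structure IsAdmissible (F : X → X) (G : X → V →L[ℝ] X) (M : ℝ) (f : ℝ → ℝ) : Prop where
  drift_continuous : Continuous F
  drift_zero : F 0 = 0
  flat : IsCubicFlat G (fderiv ℝ G) (fderiv ℝ (fderiv ℝ G)) M
  nonneg : 0 ≤ M
  cutoff : IsCutoff f

variable {S : ℝ → X →L[ℝ] X} {m₀ β γ Mc Ms η M r κ : ℝ} {Pc Ps P : X →L[ℝ] X}
variable {F : X → X} {G : X → V →L[ℝ] X} {f : ℝ → ℝ} {R : RoughPath V α → ℝ}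
variable {𝓦 : RoughPath V α} {ξ : X} {U U' : Seq V X} {Y Y' : PathPair V X}

lemma controlledBy_const (hα : 0 < α) (hα2 : α ≤ 1 / 2) (x : X) :
    ControlledBy 𝓦 ((fun _ => x, 0) : PathPair V X) ‖x‖ :=
  controlledBy_of_lipschitz hα hα2 (fun _ => le_rfl) fun s t hst => by
    have : (0 : ℝ) ≤ (t : ℝ) - s := sub_nonneg.2 (show (s : ℝ) ≤ t from hst)
    simpa using by positivity

lemma IsLipschitzGroup.controlledBy_opMul (hS : IsLipschitzGroup S m₀) (hα : 0 < α)
    (hα2 : α ≤ 1 / 2) {c : ℝ} (hY : ControlledBy 𝓦 Y c) :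
    ControlledBy 𝓦 (opMul (fun t : I => S t) Y) (2 * m₀ * c) := by
  have hmem (t : I) : (t : ℝ) ∈ Icc (-1 : ℝ) 1 := ⟨by linarith [t.2.1], t.2.2⟩
  refine hY.opMul hα hα2 (fun t => hS.norm_le _ (hmem t)) fun s t hst => ?_
  have h := hS.norm_sub_le _ (hmem s) _ (hmem t)
  rwa [abs_of_nonneg (sub_nonneg.2 (show (s : ℝ) ≤ t from hst))] at h

/-- The increments over the unit intervals which enter the sums in the Lyapunov-Perron map. -/
def unitIncrements (S : ℝ → X →L[ℝ] X) (F : X → X) (G : X → V →L[ℝ] X) (f : ℝ → ℝ)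
    (R : RoughPath V α → ℝ) (P : X →L[ℝ] X) (𝓦 : RoughPath V α) (U : Seq V X) (j : ℕ) : X :=
  (localPair S F G f (R (fibre 𝓦 j)) P (fibre 𝓦 j) (U j)).1 1

/-- The convolutions with the coefficients are Lipschitz on each unit interval, with constant
`κ`. -/
def HasLocalBound (S : ℝ → X →L[ℝ] X) (F : X → X) (G : X → V →L[ℝ] X) (f : ℝ → ℝ)
    (R : RoughPath V α → ℝ) (P : X →L[ℝ] X) (𝓦 : RoughPath V α) (κ : ℝ) : Prop :=
  ∀ (j : ℕ) (Y Y' : PathPair V X), IsControlled (fibre 𝓦 j) Y → IsControlled (fibre 𝓦 j) Y' →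
    ControlledBy (fibre 𝓦 j) (localPair S F G f (R (fibre 𝓦 j)) P (fibre 𝓦 j) Y
      - localPair S F G f (R (fibre 𝓦 j)) P (fibre 𝓦 j) Y')
      (κ * controlledNorm (fibre 𝓦 j) (Y - Y'))

lemma HasLocalBound.seqControlledBy (hκ : HasLocalBound S F G f R P 𝓦 κ) (hκ0 : 0 ≤ κ)
    (hα : 0 < α) (hU : U ∈ bcSpace η 𝓦) (hU' : U' ∈ bcSpace η 𝓦) (m : ℕ) :
    ControlledBy (fibre 𝓦 m) (localPair S F G f (R (fibre 𝓦 m)) P (fibre 𝓦 m) (U m)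
      - localPair S F G f (R (fibre 𝓦 m)) P (fibre 𝓦 m) (U' m))
      (κ * bcNorm η 𝓦 (U - U') * weight η m) := by
  refine (hκ m _ _ (hU.1 m) (hU'.1 m)).mono ?_
  rw [mul_assoc]
  exact mul_le_mul_of_nonneg_left
    (controlledNorm_le_bcNorm (sub_mem_bcSpace hα hU hU') m) hκ0

lemma HasLocalBound.norm_unitIncrements_sub_le (hκ : HasLocalBound S F G f R P 𝓦 κ) (hκ0 : 0 ≤ κ)
    (hα : 0 < α) (hU : U ∈ bcSpace η 𝓦) (hU' : U' ∈ bcSpace η 𝓦) (j : ℕ) :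
    ‖(unitIncrements S F G f R P 𝓦 U - unitIncrements S F G f R P 𝓦 U') j‖
      ≤ κ * bcNorm η 𝓦 (U - U') * weight η j :=
  (hκ.seqControlledBy hκ0 hα hU hU' j).sup 1

variable [FiniteDimensional ℝ V] [CompleteSpace X]

lemma IsAdmissible.convolution_eq (h : IsAdmissible F G M f) (hS : IsLipschitzGroup S m₀)
    (hα : 1 / 3 < α) (hα2 : α ≤ 1 / 2) (hr : 0 < r) (hY : IsControlled 𝓦 Y) {a b : I}
    (hab : a ≤ b) (c : ℝ) : convolution S F G f r P 𝓦 Y a b c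
      = S c ((localPair S F G f r P 𝓦 Y).1 b - (localPair S F G f r P 𝓦 Y).1 a) :=
  pathConvolution_eq hα hα2 hS P
    (continuous_truncDrift h.cutoff hr (by linarith) h.drift_continuous hY)
    (isControlled_truncDiffusion h.flat h.nonneg h.cutoff hr (by linarith) hY) hab c

lemma IsAdmissible.localPair_at_zero (h : IsAdmissible F G M f) (hS : IsLipschitzGroup S m₀)
    (hα : 1 / 3 < α) (hα2 : α ≤ 1 / 2) (hr : 0 < r) (hY : IsControlled 𝓦 Y) :
    (localPair S F G f r P 𝓦 Y).1 0 = 0 :=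
  pathConvolution_zero_self hα hα2 hS P
    (isControlled_truncDiffusion h.flat h.nonneg h.cutoff hr (by linarith) hY) 0

lemma IsAdmissible.proj_localPair (h : IsAdmissible F G M f) (hS : IsLipschitzGroup S m₀)
    (hP : ∀ x, P (P x) = P x) (hPS : ∀ t x, P (S t x) = S t (P x))
    (hα : 1 / 3 < α) (hα2 : α ≤ 1 / 2) (hr : 0 < r) (hY : IsControlled 𝓦 Y) (t : I) :
    P ((localPair S F G f r P 𝓦 Y).1 t) = (localPair S F G f r P 𝓦 Y).1 t :=
  proj_pathConvolution hα hα2 hS hP hPS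
    (continuous_truncDrift h.cutoff hr (by linarith) h.drift_continuous hY)
    (isControlled_truncDiffusion h.flat h.nonneg h.cutoff hr (by linarith) hY) t

lemma IsAdmissible.unitIncrements_zero (h : IsAdmissible F G M f) (hS : IsLipschitzGroup S m₀)
    (hα : 1 / 3 < α) (hα2 : α ≤ 1 / 2) : unitIncrements S F G f R P 𝓦 (0 : Seq V X) = 0 := by
  funext j
  change (localPair S F G f (R (fibre 𝓦 j)) P (fibre 𝓦 j) (0 : PathPair V X)).1 1 = 0
  rw [localPair_zero_right hα hα2 hS P h.drift_zero h.flat]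
  rfl

lemma IsAdmissible.norm_unitIncrements_le (h : IsAdmissible F G M f)
    (hS : IsLipschitzGroup S m₀) (hα : 1 / 3 < α) (hα2 : α ≤ 1 / 2)
    (hκ : HasLocalBound S F G f R P 𝓦 κ) (hκ0 : 0 ≤ κ) (hU : U ∈ bcSpace η 𝓦) (j : ℕ) :
    ‖unitIncrements S F G f R P 𝓦 U j‖ ≤ κ * bcNorm η 𝓦 U * weight η j := by
  have hα0 : 0 < α := by linarith
  have := hκ.norm_unitIncrements_sub_le hκ0 hα0 hU (zero_mem_bcSpace hα0) j
  rwa [h.unitIncrements_zero hS hα hα2, sub_zero, sub_zero] at this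

lemma IsAdmissible.summable_unitIncrements (h : IsAdmissible F G M f)
    (hS : IsSplitGroup S m₀ Pc Ps β γ Mc Ms) (hα : 1 / 3 < α) (hα2 : α ≤ 1 / 2)
    (hR : ∀ 𝓥, 0 < R 𝓥) (hκ : HasLocalBound S F G f R Ps 𝓦 κ) (hκ0 : 0 ≤ κ) (hβη : -β < η)
    (hU : U ∈ bcSpace η 𝓦) (m : ℕ) :
    Summable fun l : ℕ => S ((l : ℝ) + 1) (unitIncrements S F G f R Ps 𝓦 U (m + 1 + l)) :=
  summable_stable hβη hS.stable_nonneg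
    (fun t ht j => hS.stable_bound t ht _
      (h.proj_localPair hS.group hS.stable_idem hS.stable_comm hα hα2 (hR _) (hU.1 j) 1))
    (h.norm_unitIncrements_le hS.group hα hα2 hκ hκ0 hU) m

lemma IsAdmissible.stable_series_eq (h : IsAdmissible F G M f) (hS : IsLipschitzGroup S m₀)
    (hα : 1 / 3 < α) (hα2 : α ≤ 1 / 2) (hR : ∀ 𝓥, 0 < R 𝓥) (hU : ∀ m, IsControlled (fibre 𝓦 m) (U m))
    (j : ℕ) (s : ℝ) : S s (convolution S F G f (R (fibre 𝓦 j)) P (fibre 𝓦 j) (U j) 0 1 1)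
      = S (s + 1) (unitIncrements S F G f R P 𝓦 U j) := by
  rw [h.convolution_eq hS hα hα2 (hR _) (hU j) zero_le_one,
    h.localPair_at_zero hS hα hα2 (hR _) (hU j), sub_zero, hS.add_apply]
  rfl

/-- The Lyapunov-Perron map in terms of the basic convolutions. -/
theorem IsAdmissible.lyapunovPerron_eq (h : IsAdmissible F G M f)
    (hS : IsSplitGroup S m₀ Pc Ps β γ Mc Ms) (hα : 1 / 3 < α) (hα2 : α ≤ 1 / 2)
    (hR : ∀ 𝓥, 0 < R 𝓥) (hκ : HasLocalBound S F G f R Ps 𝓦 κ) (hκ0 : 0 ≤ κ) (hβη : -β < η)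
    (hU : U ∈ bcSpace η 𝓦) (m : ℕ) :
    lyapunovPerron S Pc Ps F G f R 𝓦 ξ U m = opMul (fun t : I => S t)
      ((fun _ => entryPoint S Pc ξ (unitIncrements S F G f R Pc 𝓦 U)
            (unitIncrements S F G f R Ps 𝓦 U) m, 0)
        + (localPair S F G f (R (fibre 𝓦 m)) Pc (fibre 𝓦 m) (U m)
          + localPair S F G f (R (fibre 𝓦 m)) Ps (fibre 𝓦 m) (U m))) := by
  have hSg := hS.group
  refine Prod.ext (funext fun t => ?_) (funext fun t => ?_)
  · have h1 : S ((t : ℝ) - m - 1) (Pc ξ) = S t (S (-(m : ℝ) - 1) (Pc ξ)) := by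
      rw [← hSg.add_apply]; congr 2; ring
    have h2 : (∑ j ∈ Finset.range m, S ((t : ℝ) - m - 1 + j)
          (convolution S F G f (R (fibre 𝓦 j)) Pc (fibre 𝓦 j) (U j) 0 1 1))
        = S t (centerSum S (unitIncrements S F G f R Pc 𝓦 U) m)
          - S t (unitIncrements S F G f R Pc 𝓦 U m) := by
      rw [centerSum, Finset.sum_range_succ, map_add, sub_self, neg_zero, hSg.zero, map_sum]
      simp only [ContinuousLinearMap.id_apply, add_sub_cancel_right]
      refine Finset.sum_congr rfl fun j _ => ?_
      rw [h.stable_series_eq hSg hα hα2 hR hU.1, ← hSg.add_apply]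
      congr 2
      ring
    have h3 : convolution S F G f (R (fibre 𝓦 m)) Pc (fibre 𝓦 m) (U m) t 1 t
        = S t (unitIncrements S F G f R Pc 𝓦 U m)
          - S t ((localPair S F G f (R (fibre 𝓦 m)) Pc (fibre 𝓦 m) (U m)).1 t) := by
      rw [h.convolution_eq hSg hα hα2 (hR _) (hU.1 m) t.2.2, map_sub]
      rfl
    have h4 : (∑' l : ℕ, S ((t : ℝ) + l) (convolution S F G f (R (fibre 𝓦 (m + 1 + l))) Ps
          (fibre 𝓦 (m + 1 + l)) (U (m + 1 + l)) 0 1 1))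
        = S t (stableSum S (unitIncrements S F G f R Ps 𝓦 U) m) := by
      rw [stableSum, ContinuousLinearMap.map_tsum _
        (h.summable_unitIncrements hS hα hα2 hR hκ hκ0 hβη hU m)]
      refine tsum_congr fun l => ?_
      rw [h.stable_series_eq hSg hα hα2 hR hU.1, ← hSg.add_apply]
      congr 2
      ring
    have h5 : convolution S F G f (R (fibre 𝓦 m)) Ps (fibre 𝓦 m) (U m) 0 t t
        = S t ((localPair S F G f (R (fibre 𝓦 m)) Ps (fibre 𝓦 m) (U m)).1 t) := by
      rw [h.convolution_eq hSg hα hα2 (hR _) (hU.1 m) t.2.1,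
        h.localPair_at_zero hSg hα hα2 (hR _) (hU.1 m), sub_zero]
    simp only [lyapunovPerron, opMul, Prod.fst_add, Pi.add_apply, map_add]
    rw [h1, h2, h3, h4, h5]
    simp only [entryPoint, map_add, map_sub]
    abel
  · ext v
    simp [lyapunovPerron, opMul, localPair, hSg.neg_cancel, hS.sum_eq]

/-- The Lipschitz estimate for the Lyapunov-Perron map. -/
theorem IsAdmissible.seqControlledBy_lyapunovPerron_sub (h : IsAdmissible F G M f)
    (hS : IsSplitGroup S m₀ Pc Ps β γ Mc Ms) (hα : 1 / 3 < α) (hα2 : α ≤ 1 / 2)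
    (hR : ∀ 𝓥, 0 < R 𝓥) (hκc : HasLocalBound S F G f R Pc 𝓦 κ)
    (hκs : HasLocalBound S F G f R Ps 𝓦 κ) (hκ0 : 0 ≤ κ) (hβη : -β < η) (hη : η < 0)
    (hU : U ∈ bcSpace η 𝓦) (hU' : U' ∈ bcSpace η 𝓦) :
    SeqControlledBy η 𝓦
      (lyapunovPerron S Pc Ps F G f R 𝓦 ξ U - lyapunovPerron S Pc Ps F G f R 𝓦 ξ U')
      (2 * m₀ * (κ * bcNorm η 𝓦 (U - U') * (Mc / (1 - Real.exp (-(γ - η)))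
        + Ms / (1 - Real.exp (-(β + η))) + 2))) := by
  intro m
  have hα0 : 0 < α := by linarith
  have hSg := hS.group
  have hγη : η < γ := by linarith [hS.gamma_nonneg]
  set uc := unitIncrements S F G f R Pc 𝓦 U with huc
  set uc' := unitIncrements S F G f R Pc 𝓦 U' with huc'
  set us := unitIncrements S F G f R Ps 𝓦 U with hus
  set us' := unitIncrements S F G f R Ps 𝓦 U' with hus'
  set D := bcNorm η 𝓦 (U - U')
  have hcenter : ‖centerSum S (uc - uc') m‖
      ≤ κ * D * (Mc / (1 - Real.exp (-(γ - η)))) * weight η m := by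
    refine norm_centerSum_le hγη hS.center_nonneg (fun t ht j => hS.center_bound t ht _ ?_)
      (hκc.norm_unitIncrements_sub_le hκ0 hα0 hU hU') m
    rw [Pi.sub_apply, map_sub]
    congr 1
    · exact h.proj_localPair hSg hS.center_idem hS.center_comm hα hα2 (hR _) (hU.1 j) 1
    · exact h.proj_localPair hSg hS.center_idem hS.center_comm hα hα2 (hR _) (hU'.1 j) 1
  have hstable : ‖stableSum S (us - us') m‖
      ≤ κ * D * (Ms / (1 - Real.exp (-(β + η)))) * weight η m := by
    refine norm_stableSum_le hβη hS.stable_nonneg (fun t ht j => hS.stable_bound t ht _ ?_)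
      (hκs.norm_unitIncrements_sub_le hκ0 hα0 hU hU') m
    rw [Pi.sub_apply, map_sub]
    congr 1
    · exact h.proj_localPair hSg hS.stable_idem hS.stable_comm hα hα2 (hR _) (hU.1 j) 1
    · exact h.proj_localPair hSg hS.stable_idem hS.stable_comm hα hα2 (hR _) (hU'.1 j) 1
  have hentry : entryPoint S Pc ξ uc us m - entryPoint S Pc ξ uc' us' m
      = stableSum S (us - us') m - centerSum S (uc - uc') m := by
    rw [centerSum_sub, stableSum_sub (h.summable_unitIncrements hS hα hα2 hR hκs hκ0 hβη hU m)
      (h.summable_unitIncrements hS hα hα2 hR hκs hκ0 hβη hU' m)]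
    simp only [entryPoint]
    abel
  have hconst := controlledBy_const (𝓦 := fibre 𝓦 m) hα0 hα2
    (stableSum S (us - us') m - centerSum S (uc - uc') m)
  have hlc := hκc.seqControlledBy hκ0 hα0 hU hU' m
  have hls := hκs.seqControlledBy hκ0 hα0 hU hU' m
  have key := hSg.controlledBy_opMul hα0 hα2 (hconst.add (hlc.add hls))
  rw [Pi.sub_apply, h.lyapunovPerron_eq hS hα hα2 hR hκs hκ0 hβη hU,
    h.lyapunovPerron_eq hS hα hα2 hR hκs hκ0 hβη hU', ← opMul_sub]
  have e : ((fun _ => entryPoint S Pc ξ uc us m, 0)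
        + (localPair S F G f (R (fibre 𝓦 m)) Pc (fibre 𝓦 m) (U m)
          + localPair S F G f (R (fibre 𝓦 m)) Ps (fibre 𝓦 m) (U m)) : PathPair V X)
      - ((fun _ => entryPoint S Pc ξ uc' us' m, 0)
        + (localPair S F G f (R (fibre 𝓦 m)) Pc (fibre 𝓦 m) (U' m)
          + localPair S F G f (R (fibre 𝓦 m)) Ps (fibre 𝓦 m) (U' m)))
      = (fun _ => stableSum S (us - us') m - centerSum S (uc - uc') m, 0)
        + ((localPair S F G f (R (fibre 𝓦 m)) Pc (fibre 𝓦 m) (U m)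
            - localPair S F G f (R (fibre 𝓦 m)) Pc (fibre 𝓦 m) (U' m))
          + (localPair S F G f (R (fibre 𝓦 m)) Ps (fibre 𝓦 m) (U m)
            - localPair S F G f (R (fibre 𝓦 m)) Ps (fibre 𝓦 m) (U' m))) := by
    have : ((fun _ => stableSum S (us - us') m - centerSum S (uc - uc') m, 0) : PathPair V X)
        = (fun _ => entryPoint S Pc ξ uc us m, 0) - (fun _ => entryPoint S Pc ξ uc' us' m, 0) := by
      rw [← hentry]
      ext <;> simp
    rw [this]
    abel
  rw [e]
  refine key.mono ?_
  have hm₀ := hSg.nonneg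
  have hn := norm_sub_le (stableSum S (us - us') m) (centerSum S (uc - uc') m)
  rw [mul_assoc (2 * m₀)]
  refine mul_le_mul_of_nonneg_left ?_ (by positivity)
  linarith

lemma IsAdmissible.seqControlledBy_lyapunovPerron_zero (h : IsAdmissible F G M f)
    (hS : IsSplitGroup S m₀ Pc Ps β γ Mc Ms) (hα : 1 / 3 < α) (hα2 : α ≤ 1 / 2)
    (hR : ∀ 𝓥, 0 < R 𝓥) (hκs : HasLocalBound S F G f R Ps 𝓦 κ) (hκ0 : 0 ≤ κ) (hβη : -β < η)
    (hη : η < 0) :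
    SeqControlledBy η 𝓦 (lyapunovPerron S Pc Ps F G f R 𝓦 ξ 0) (2 * m₀ * (Mc * ‖Pc ξ‖)) := by
  intro m
  have hα0 : 0 < α := by linarith
  have hSg := hS.group
  have hm₀ := hSg.nonneg
  rw [h.lyapunovPerron_eq hS hα hα2 hR hκs hκ0 hβη (zero_mem_bcSpace hα0), Pi.zero_apply,
    h.unitIncrements_zero hSg hα hα2, h.unitIncrements_zero hSg hα hα2,
    localPair_zero_right hα hα2 hSg Pc h.drift_zero h.flat,
    localPair_zero_right hα hα2 hSg Ps h.drift_zero h.flat, add_zero, add_zero]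
  have e : entryPoint S Pc ξ 0 0 m = S (-(m : ℝ) - 1) (Pc ξ) := by
    simp [entryPoint, centerSum, stableSum]
  refine (hSg.controlledBy_opMul hα0 hα2 (controlledBy_const hα0 hα2 _)).mono ?_
  rw [e, mul_assoc (2 * m₀)]
  refine mul_le_mul_of_nonneg_left ?_ (by positivity)
  have hm : (0 : ℝ) ≤ m := Nat.cast_nonneg m
  refine (hS.center_bound _ (by linarith) _ (hS.center_idem ξ)).trans ?_
  have hw : Real.exp (γ * (-(m : ℝ) - 1)) ≤ weight η m := by
    refine Real.exp_le_exp.2 ?_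
    have := hS.gamma_nonneg
    nlinarith
  have := mul_le_mul_of_nonneg_left hw (mul_nonneg hS.center_nonneg (norm_nonneg (Pc ξ)))
  linarith

/-- The Lyapunov-Perron map preserves the sequence space. -/
theorem IsAdmissible.lyapunovPerron_mem (h : IsAdmissible F G M f)
    (hS : IsSplitGroup S m₀ Pc Ps β γ Mc Ms) (hα : 1 / 3 < α) (hα2 : α ≤ 1 / 2)
    (hR : ∀ 𝓥, 0 < R 𝓥) (hκc : HasLocalBound S F G f R Pc 𝓦 κ)
    (hκs : HasLocalBound S F G f R Ps 𝓦 κ) (hκ0 : 0 ≤ κ) (hβη : -β < η) (hη : η < 0)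
    (hU : U ∈ bcSpace η 𝓦) : lyapunovPerron S Pc Ps F G f R 𝓦 ξ U ∈ bcSpace η 𝓦 := by
  have hα0 : 0 < α := by linarith
  have hSg := hS.group
  have hb := (h.seqControlledBy_lyapunovPerron_sub (ξ := ξ) hS hα hα2 hR hκc hκs hκ0 hβη hη hU
    (zero_mem_bcSpace hα0)).add
    (h.seqControlledBy_lyapunovPerron_zero (ξ := ξ) hS hα hα2 hR hκs hκ0 hβη hη)
  rw [sub_add_cancel] at hb
  refine hb.mem_bcSpace hα0 fun m => ?_
  rw [h.lyapunovPerron_eq hS hα hα2 hR hκs hκ0 hβη hU,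
    h.lyapunovPerron_eq hS hα hα2 hR hκs hκ0 hβη hU]
  simp only [opMul, Prod.fst_add, Pi.add_apply]
  rw [h.localPair_at_zero hSg hα hα2 (hR _) (hU.1 m),
    h.localPair_at_zero hSg hα hα2 (hR _) (hU.1 m), add_zero, add_zero,
    entryPoint_eq_succ hSg (h.summable_unitIncrements hS hα hα2 hR hκs hκ0 hβη hU)]
  rw [show (((0 : I) : ℝ)) = 0 from rfl, hSg.zero, ← add_assoc]
  rfl

theorem IsAdmissible.isWellDefined (h : IsAdmissible F G M f)
    (hS : IsSplitGroup S m₀ Pc Ps β γ Mc Ms) (hα : 1 / 3 < α) (hα2 : α ≤ 1 / 2)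
    (hR : ∀ 𝓥, 0 < R 𝓥) (hκs : HasLocalBound S F G f R Ps 𝓦 κ) (hκ0 : 0 ≤ κ) (hβη : -β < η)
    (hU : U ∈ bcSpace η 𝓦) : IsWellDefined S Pc Ps F G f R 𝓦 U := by
  have hSg := hS.group
  refine ⟨fun P _ m a b c hab => ⟨_, (isControlled_truncDiffusion h.flat h.nonneg h.cutoff (hR _)
    (by linarith) (hU.1 m)).isRoughIntegral_convolved hα hα2 hSg P hab c⟩, fun m t => ?_⟩
  have hs := ContinuousLinearMap.summable (S t)
    (h.summable_unitIncrements hS hα hα2 hR hκs hκ0 hβη hU m)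
  refine hs.congr fun l => ?_
  rw [h.stable_series_eq hSg hα hα2 hR hU.1, ← hSg.add_apply]
  congr 2
  ring

end LyapunovPerron

/-! ### Choice of the constants -/

lemma GapCondition.bound {β γ Mc Ms η K : ℝ} (h : GapCondition 1 β γ Mc Ms η K) (hK : 0 < K)
    (hβη : -β < η) (hη : η < 0) (hγ : 0 ≤ γ) (hMc : 0 ≤ Mc) (hMs : 0 ≤ Ms) :
    K * (Mc / (1 - Real.exp (-(γ - η))) + Ms / (1 - Real.exp (-(β + η))) + 2) < 1 / 4 := by
  have key (x y : ℝ) (hx : 0 < x) (hy : 0 ≤ y) : y / (1 - Real.exp (-x)) + 1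
      ≤ Real.exp x * (1 * y * Real.exp (-η) + 1) / (1 - Real.exp (-x)) := by
    have hq : 0 < 1 - Real.exp (-x) := sub_pos.2 (Real.exp_lt_one_iff.2 (by linarith))
    have hq1 : 1 - Real.exp (-x) ≤ 1 := by linarith [Real.exp_pos (-x)]
    have e1 : 1 ≤ Real.exp x := Real.one_le_exp hx.le
    have e2 : 1 ≤ Real.exp (-η) := Real.one_le_exp (by linarith)
    have e3 : y ≤ 1 * y * Real.exp (-η) := by
      rw [one_mul]; exact le_mul_of_one_le_right hy e2
    have e4 : y + 1 ≤ Real.exp x * (1 * y * Real.exp (-η) + 1) := by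
      have : 1 * y * Real.exp (-η) + 1 ≤ Real.exp x * (1 * y * Real.exp (-η) + 1) :=
        le_mul_of_one_le_left (by linarith) e1
      linarith
    rw [le_div_iff₀ hq, add_mul, div_mul_cancel₀ _ hq.ne', one_mul]
    linarith
  have h1 := key (β + η) Ms (by linarith) hMs
  have h2 := key (γ - η) Mc (by linarith) hMc
  refine lt_of_le_of_lt (mul_le_mul_of_nonneg_left ?_ hK.le) h
  linarith

lemma isSplitGroup_grp {n : ℕ} {A : Matrix (Fin n) (Fin n) ℝ} {m₀ : ℝ}
    (hS : IsLipschitzGroup (grp A) m₀) {Pc Ps : Sp n →L[ℝ] Sp n}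
    (h : CenterStableSplitting A Pc Ps) {β γ Mc Ms : ℝ} (hd : ExponentialDichotomy A β γ Mc Ms) :
    IsSplitGroup (grp A) m₀ Pc Ps β γ Mc Ms where
  group := hS
  center_idem x := congrArg (fun T => T x) h.center_idem
  stable_idem x := congrArg (fun T => T x) h.stable_idem
  center_comm := hS.commute_all h.center_comm
  stable_comm := hS.commute_all h.stable_comm
  sum_eq x := by
    rw [add_comm]
    exact congrArg (fun T => T x) h.sum_eq
  gamma_nonneg := hd.gamma_nonneg
  center_nonneg := zero_le_one.trans hd.one_le_center
  stable_nonneg := zero_le_one.trans hd.one_le_stable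
  center_bound t ht x hx := hd.center_bound t ht x (h.center_range ▸ ⟨x, hx⟩)
  stable_bound t ht x hx := hd.stable_bound t ht x (h.stable_range ▸ ⟨x, hx⟩)

/-- With the cut-off radius of the theorem, the local Lipschitz constants are at most `K ε`. -/
lemma IsAdmissible.hasLocalBound {V X : Type*} [NormedAddCommGroup V] [InnerProductSpace ℝ V]
    [FiniteDimensional ℝ V] [NormedAddCommGroup X] [NormedSpace ℝ X] [CompleteSpace X]
    {α M m₀ L Q ε K C₀ C₁ C₂ : ℝ} {S : ℝ → X →L[ℝ] X} {F : X → X} {G : X → V →L[ℝ] X} {f : ℝ → ℝ}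
    (h : IsAdmissible F G M f) (hS : IsLipschitzGroup S m₀) (hα : 1 / 3 < α) (hα2 : α ≤ 1 / 2)
    (hL : ∀ x y : ℝ, 0 ≤ x → 0 ≤ y → |f x - f y| ≤ L * |x - y|) (hL0 : 0 ≤ L) (hε : 0 < ε)
    (hK : 0 < K) (hK1 : K ≤ 1) (hC1 : 1 ≤ C₀) (hCε : 40 * Q * M * integralConst V α / ε ≤ C₀)
    (hF : ∀ x y, ‖x‖ ≤ K / C₀ → ‖y‖ ≤ K / C₀ → ‖F x - F y‖ ≤ ε / (2 * (Q + 1)) * K * ‖x - y‖)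
    (h1 : C₀ ≤ C₁) (h2 : C₀ ≤ C₂) {P : X →L[ℝ] X} (hP : m₀ * ‖P‖ * (1 + L) ≤ Q)
    (𝓦 : RoughPath V α) : HasLocalBound S F G f (cutoffRadius C₁ C₂ K) P 𝓦 (K * ε) := by
  intro j Y Y' hY hY'
  have hC0 : 0 < C₀ := by linarith
  have hr := cutoffRadius_pos hK hC0 h1 h2 (fibre 𝓦 j)
  have hrK := cutoffRadius_le hK hC0 h1 h2 (fibre 𝓦 j)
  have hsq := cutoffRadius_sq_mul_le hK hC0 (hK1.trans hC1) h1 h2 (fibre 𝓦 j)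
  have hm₀ := hS.nonneg
  have hQ : 0 ≤ Q := le_trans (by positivity) hP
  have hM := h.nonneg
  have hIC : 0 ≤ integralConst V α := zero_le_one.trans (one_le_integralConst hα)
  have hω : 0 ≤ ε / (2 * (Q + 1)) * K := by positivity
  refine (controlledBy_localPair_sub hα hα2 hS P h.drift_continuous
    (fun x y hx hy => hF x y (hx.trans hrK) (hy.trans hrK)) hω h.flat hM h.cutoff hL hL0 hr
    hY hY').mono (mul_le_mul_of_nonneg_right ?_ (controlledNorm_nonneg _ _))
  have b1 : Q * (ε / (2 * (Q + 1)) * K) ≤ K * ε / 2 := by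
    have : Q * (ε / (2 * (Q + 1)) * K) = Q / (Q + 1) * (K * ε / 2) := by field_simp
    rw [this]
    exact mul_le_of_le_one_left (by positivity) ((div_le_one (by positivity)).2 (by linarith))
  have b2 : Q * (10 * M * integralConst V α * (2 * (K / C₀))) ≤ K * ε / 2 := by
    rw [div_le_iff₀ hε] at hCε
    have : Q * (10 * M * integralConst V α * (2 * (K / C₀)))
        = 40 * Q * M * integralConst V α * (K / (2 * C₀)) := by field_simp; ring
    rw [this]
    refine (mul_le_mul_of_nonneg_right hCε (by positivity)).trans (le_of_eq ?_)
    field_simp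
  have b3 := mul_le_mul_of_nonneg_left hsq (by positivity : 0 ≤ 10 * M * integralConst V α)
  have ha := (fibre 𝓦 j).pathSeminorm_nonneg
  have hb := (fibre 𝓦 j).areaSeminorm_nonneg
  refine (mul_le_mul hP (add_le_add le_rfl b3) (by positivity) hQ).trans ?_
  rw [mul_add]
  linarith

end

end RoughCenter

open RoughCenter
theorem mainTheorem1 {n : ℕ} (A : Matrix (Fin n) (Fin n) ℝ) :
    ∃ CS : ℝ, 0 < CS ∧
    ∀ (d : ℕ) (α : ℝ), 1 / 3 < α → α ≤ 1 / 2 →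
    ∀ (Pc Ps : Sp n →L[ℝ] Sp n), CenterStableSplitting A Pc Ps →
    ∀ F : Sp n → Sp n, DriftHypothesis F →
    ∀ G : Sp n → Sp d →L[ℝ] Sp n, DiffusionHypothesis G →
    ∀ f : ℝ → ℝ, IsCutoff f →
    ∃ C₀ : ℝ → ℝ, (∀ K, 0 < C₀ K) ∧
      ((∃ L, LipschitzWith L (fderiv ℝ F)) → ∀ K K', C₀ K = C₀ K') ∧
    ∀ β γ Mc Ms : ℝ, ExponentialDichotomy A β γ Mc Ms →
    ∀ η : ℝ, -β < η → η < 0 →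
    ∀ K : ℝ, 0 < K → GapCondition CS β γ Mc Ms η K →
    ∀ C₁ C₂ : ℝ, C₀ K ≤ C₁ → C₀ K ≤ C₂ →
    ∀ 𝓦 : RoughPath (Sp d) α,
      (∀ U ∈ bcSpace η 𝓦, IsWellDefined (grp A) Pc Ps F G f (cutoffRadius C₁ C₂ K) 𝓦 U) ∧
      ∀ ξ : Sp n,
        (∀ U ∈ bcSpace η 𝓦,
          lyapunovPerron (grp A) Pc Ps F G f (cutoffRadius C₁ C₂ K) 𝓦 ξ U ∈ bcSpace η 𝓦) ∧
        (∀ U ∈ bcSpace η 𝓦, ∀ U' ∈ bcSpace η 𝓦,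
          bcNorm η 𝓦 (lyapunovPerron (grp A) Pc Ps F G f (cutoffRadius C₁ C₂ K) 𝓦 ξ U
              - lyapunovPerron (grp A) Pc Ps F G f (cutoffRadius C₁ C₂ K) 𝓦 ξ U')
            ≤ 1 / 4 * bcNorm η 𝓦 (U - U')) ∧
        ∃! Γ : Seq (Sp d) (Sp n), Γ ∈ bcSpace η 𝓦 ∧
          lyapunovPerron (grp A) Pc Ps F G f (cutoffRadius C₁ C₂ K) 𝓦 ξ Γ = Γ := by
  obtain ⟨m₀, hS⟩ : ∃ m₀, IsLipschitzGroup (grp A) m₀ := exists_isLipschitzGroup_expGroup _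
  have hm₀ := hS.nonneg
  refine ⟨1, one_pos, fun d α hα hα2 Pc Ps hsplit F hF G hG f hf => ?_⟩
  obtain ⟨M, hM, hflat⟩ := exists_isCubicFlat hG.smooth hG.zero hG.fderiv_zero
    hG.fderiv_fderiv_zero
  obtain ⟨L, hL0, hL⟩ := hf.exists_lipschitz
  have hadm : IsAdmissible F G M f := ⟨hF.smooth.1.continuous, hF.zero, hflat, hM, hf⟩
  have hα0 : 0 < α := by linarith
  set Q := m₀ * (‖Pc‖ + ‖Ps‖) * (1 + L) with hQ
  have hQ0 : 0 ≤ Q := by positivity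
  set ε := 1 / (8 * (m₀ + 1)) with hε
  have hε0 : 0 < ε := by positivity
  obtain ⟨C₀, hC₀, hconst, hdrift⟩ := hF.exists_scale
    (show 0 < ε / (2 * (Q + 1)) by positivity)
    (max 1 (40 * Q * M * integralConst (Sp d) α / ε))
  refine ⟨C₀, fun K => (hC₀ K).1, hconst,
    fun β γ Mc Ms hdich η hβη hη K hK hgap C₁ C₂ h1 h2 𝓦 => ?_⟩
  have hsg := isSplitGroup_grp hS hsplit hdich
  have hgap' := hgap.bound hK hβη hη hsg.gamma_nonneg hsg.center_nonneg hsg.stable_nonneg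
  have hq1 : 0 < 1 - Real.exp (-(γ - η)) :=
    sub_pos.2 (Real.exp_lt_one_iff.2 (by linarith [hsg.gamma_nonneg]))
  have hq2 : 0 < 1 - Real.exp (-(β + η)) := sub_pos.2 (Real.exp_lt_one_iff.2 (by linarith))
  have hsum : 0 ≤ Mc / (1 - Real.exp (-(γ - η))) + Ms / (1 - Real.exp (-(β + η))) :=
    add_nonneg (div_nonneg hsg.center_nonneg hq1.le) (div_nonneg hsg.stable_nonneg hq2.le)
  have hK1 : K ≤ 1 := by nlinarith
  have hR (𝓥 : RoughPath (Sp d) α) : 0 < cutoffRadius C₁ C₂ K 𝓥 :=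
    cutoffRadius_pos hK (hC₀ K).1 h1 h2 𝓥
  have hloc {P : Sp n →L[ℝ] Sp n} (hP : ‖P‖ ≤ ‖Pc‖ + ‖Ps‖) :
      HasLocalBound (grp A) F G f (cutoffRadius C₁ C₂ K) P 𝓦 (K * ε) :=
    hadm.hasLocalBound hS hα hα2 hL hL0 hε0 hK hK1 ((le_max_left _ _).trans (hC₀ K).2)
      ((le_max_right _ _).trans (hC₀ K).2) (hdrift K hK) h1 h2 (by rw [hQ]; gcongr) 𝓦
  have hκc := hloc (P := Pc) (le_add_of_nonneg_right (norm_nonneg _))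
  have hκs := hloc (P := Ps) (le_add_of_nonneg_left (norm_nonneg _))
  have hκ0 : 0 ≤ K * ε := by positivity
  refine ⟨fun U hU => hadm.isWellDefined hsg hα hα2 hR hκs hκ0 hβη hU, fun ξ => ?_⟩
  have hmem : ∀ U ∈ bcSpace η 𝓦,
      lyapunovPerron (grp A) Pc Ps F G f (cutoffRadius C₁ C₂ K) 𝓦 ξ U ∈ bcSpace η 𝓦 :=
    fun U hU => hadm.lyapunovPerron_mem hsg hα hα2 hR hκc hκs hκ0 hβη hη hU
  have hcontr : ∀ U ∈ bcSpace η 𝓦, ∀ U' ∈ bcSpace η 𝓦,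
      bcNorm η 𝓦 (lyapunovPerron (grp A) Pc Ps F G f (cutoffRadius C₁ C₂ K) 𝓦 ξ U
        - lyapunovPerron (grp A) Pc Ps F G f (cutoffRadius C₁ C₂ K) 𝓦 ξ U')
        ≤ 1 / 4 * bcNorm η 𝓦 (U - U') := by
    intro U hU U' hU'
    have h := (hadm.seqControlledBy_lyapunovPerron_sub (ξ := ξ) hsg hα hα2 hR hκc hκs hκ0 hβη hη
      hU hU').bcNorm_le
    have hD := bcNorm_nonneg η 𝓦 (U - U')
    set B := Mc / (1 - Real.exp (-(γ - η))) + Ms / (1 - Real.exp (-(β + η))) + 2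
    set D := bcNorm η 𝓦 (U - U')
    have hB : 0 ≤ B := by linarith
    have e : 4 * (2 * m₀ * (K * ε * D * B)) = m₀ / (m₀ + 1) * (K * B * D) := by
      rw [hε]; field_simp; ring
    rw [e] at h
    have h3 : m₀ / (m₀ + 1) ≤ 1 := (div_le_one (by positivity)).2 (by linarith)
    exact h.trans ((mul_le_of_le_one_left (by positivity) h3).trans
      (mul_le_mul_of_nonneg_right hgap'.le hD))
  exact ⟨hmem, hcontr, existsUnique_fixedPoint hα0 _ hmem hcontr⟩
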